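/- Let $\mu>0$, $\lambda+2\mu/3>0$, $\omega>0$, $\kappa_{\rm p}=\omega/\sqrt{\lambda+2\mu}$, $\kappa_{\rm s}=\omega/\sqrt{\mu}$. Points of $\mathbb R^3$ are written $x=(x',x_3)$. For a field $u$ with values in $\mathbb C^3$ and a unit normal $\nu=(\nu_1,\nu_2,\nu_3)$ put $$Tu=2\mu\,\partial_\nu u+\lambda(\nabla\cdot u)\nu+\mu\,\nu\times(\nabla\times u),\qquad \mathcal E(u,\bar u)=2\mu\sum_{j,k}|\partial_k u_j|^2+\lambda|\nabla\cdot u|^2-\mu|\nabla\times u|^2 ,$$ $$R(u)=2\,\Re(Tu\cdot\partial_3\bar u)-\nu_3\,\mathcal E(u,\bar u)+\omega^2|u|^2 .$$ For $\xi\in\mathbb R^2$ let $\beta(\xi)=(\kappa_{\rm p}^2-|\xi|^2)^{1/2}$ if $|\xi|<\kappa_{\rm p}$ and $\beta(\xi)={\rm i}(|\xi|^2-\kappa_{\rm p}^2)^{1/2}$ otherwise; define $\gamma(\xi)$ in the same way with $\kappa_{\rm s}$. Let $\hat v(\xi)=\frac1{2\pi}\int_{\mathbb R^2}v(x')e^{-{\rm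 i}x'\cdot\xi}\,dx'$ (extended to $L^2$). Boundary values on a graph $x_3=f(x')$ are taken from above, in the sense of $L^2_{\rm loc}$-traces; the normal $\nu$ points upwards. We say that $u$ satisfies the upward angular spectrum representation (UASR) in $x_3>b$, with boundary value $v\in L^2(\mathbb R^2)^3$ and amplitudes $A_{\rm p}(\xi)\in\mathbb C$, $\mathbf A_{\rm s}(\xi)\in\mathbb C^3$, if $v$ is the boundary value of $u$ on $\Gamma_b=\{x_3=b\}$, if for a.e. $\xi$ $$\hat v(\xi)=A_{\rm p}(\xi)(\xi,\beta)^\top+\mathbf A_{\rm s}(\xi),\qquad (\xi,\gamma)\cdot\mathbf A_{\rm s}(\xi)=0,$$ and if for a.e. $x$ with $x_3>b$ $$u(x)=\frac1{2\pi}\int_{\mathbb R^2}\Big[A_{\rm p}(\xi)(\xi,\beta)^\top e^{{\rm i}\beta(x_3-b)}+\mathbf A_{\rm s}(\xi)e^{{\rm i}\gamma(x_3-b)}\Big]e^{{\rm i}\xi\cdot x'}\,d\xi .$$ (i) Let $\Gamma$ be the graph of a Lipschitz function $f\in C^2(\mathbb R^2)$ with $f\le f_+$, let $b>f_+$ and $S_b=\{f(x')<x_3<b\}$.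 Let $u\in H^1(S_b)^3$ with $u=0$ on $\Gamma$, and suppose that $\nabla u$ has a boundary value on $\Gamma$. Then, a.e. on $\Gamma$, $$R(u)=\mu|\partial_\nu u|^2\nu_3+(\lambda+\mu)|\nabla\cdot u|^2\nu_3 .$$ Hence $$\int_\Gamma R(u)\,ds=\int_\Gamma\Big\{\mu|\partial_\nu u|^2\nu_3+(\lambda+\mu)|\nabla\cdot u|^2\nu_3\Big\}\,ds,$$ and the integrals converge if the boundary value of $\nabla u$ is in $L^2(\Gamma)$. (ii) Let $b\in\mathbb R$ and let $u$ satisfy the UASR in $x_3>b$ with boundary value $v\in H^1(\mathbb R^2)^3$ and amplitudes $A_{\rm p}$, $\mathbf A_{\rm s}$. Then $\nabla u$ has a boundary value in $L^2(\Gamma_b)$, all the following integrals converge absolutely, and $$\int_{\Gamma_b}R(u)\,ds=2\Big\{\omega^2\int_{|\xi|<\kappa_{\rm p}}\beta^2|A_{\rm p}|^2\,d\xi+\mu\int_{|\xi|<\kappa_{\rm s}}\gamma^2|\mathbf A_{\rm s}|^2\,d\xi\Big\},$$ $$\Im\int_{\Gamma_b}Tu\cdot\bar u\,ds=\int_{|\xi|<\kappa_{\rm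 p}}\omega^2\beta|A_{\rm p}|^2\,d\xi+\int_{|\xi|<\kappa_{\rm s}}\mu\gamma|\mathbf A_{\rm s}|^2\,d\xi .$$ (iii) The regularity required in (ii) is automatic away from the lowest plane: if $u$ satisfies the UASR in $x_3>c$ with amplitudes $A_{\rm p},\mathbf A_{\rm s}$, then for every $b>c$ it satisfies the UASR in $x_3>b$, with a boundary value in $H^1(\mathbb R^2)^3$ and amplitudes $A_{\rm p}e^{{\rm i}\beta(b-c)}$, $\mathbf A_{\rm s}e^{{\rm i}\gamma(b-c)}$. In particular (ii) applies at every $b>f_+$ to a field that satisfies the UASR in $x_3>b$ for all $b>f_+$. -/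

import Mathlib

open MeasureTheory Filter Topology
open scoped Matrix FourierTransform ContDiff NNReal ENNReal ComplexConjugate

noncomputable section

namespace Elastic

/-- The horizontal plane, with points `x' = (x₁, x₂)` (also used for the frequency variable `ξ`). -/
abbrev Plane := EuclideanSpace ℝ (Fin 2)

/-- Three-dimensional space, a point being `x = (x', x₃)`; `volume` is Lebesgue measure. -/
abbrev Space := Plane × ℝ

/-- The three coordinate directions of `Space`. -/
def dir : Fin 3 → Space :=
  ![(EuclideanSpace.single 0 1, 0), (EuclideanSpace.single 1 1, 0), (0, 1)]

/-! ### Weak gradients, the space `H¹`, boundary values -/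

/-- `Du` is the weak gradient of the vector field `u` on the open set `Ω`:
`Du x k j = ∂ₖ uⱼ (x)` in the sense of distributions. -/
structure HasWeakGrad (Ω : Set Space) (u : Space → Fin 3 → ℂ)
    (Du : Space → Fin 3 → Fin 3 → ℂ) : Prop where
  locInt : ∀ j, LocallyIntegrableOn (fun x => u x j) Ω
  locInt_grad : ∀ k j, LocallyIntegrableOn (fun x => Du x k j) Ω
  integral_eq : ∀ φ : Space → ℝ, ContDiff ℝ ∞ φ → HasCompactSupport φ → tsupport φ ⊆ Ω →
    ∀ k j, ∫ x in Ω, u x j * ((fderiv ℝ φ x (dir k) : ℝ) : ℂ)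
      = - ∫ x in Ω, Du x k j * ((φ x : ℝ) : ℂ)

/-- `u ∈ H¹(Ω)³` with weak gradient `Du`. -/
structure MemH1 (Ω : Set Space) (u : Space → Fin 3 → ℂ)
    (Du : Space → Fin 3 → Fin 3 → ℂ) : Prop where
  memLp : ∀ j, MemLp (fun x => u x j) 2 (volume.restrict Ω)
  memLp_grad : ∀ k j, MemLp (fun x => Du x k j) 2 (volume.restrict Ω)
  hasWeakGrad : HasWeakGrad Ω u Du

/-- `g` is the boundary value (trace), from above, of the scalar function `w` on the graph
`x₃ = f(x')`: for every compact `K`, the mean over `0 < s < t` of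
`∫_K |w(x', f(x') + s) - g(x')|² dx'` tends to `0` as `t ↓ 0`.
It only depends on the almost-everywhere classes of `w` and `g`, and determines the class of `g`. -/
def HasGraphTrace (f : Plane → ℝ) (w : Space → ℂ) (g : Plane → ℂ) : Prop :=
  AEStronglyMeasurable g volume ∧
  ∀ K : Set Plane, IsCompact K →
    Tendsto (fun t : ℝ =>
        (∫⁻ x in {x : Space | x.1 ∈ K ∧ f x.1 < x.2 ∧ x.2 < f x.1 + t},
          ‖w x - g x.1‖ₑ ^ 2) / ENNReal.ofReal t)
      (𝓝[>] 0) (𝓝 0)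

/-- The part `{f(x') < x₃ < b}` of the region above the graph of `f` which lies below height `b`. -/
def strip (f : Plane → ℝ) (b : ℝ) : Set Space := {x | f x.1 < x.2 ∧ x.2 < b}

/-- The half-space `x₃ > b`. -/
def upperHalf (b : ℝ) : Set Space := {x | b < x.2}

/-! ### Geometry of a graph -/

/-- The partial derivative `∂_α f` at `x'`. -/
def partialDeriv (f : Plane → ℝ) (α : Fin 2) (x' : Plane) : ℝ :=
  fderiv ℝ f x' (EuclideanSpace.single α 1)

/-- The surface element `√(1 + |∇f|²)` of the graph of `f`. -/
def surfaceDensity (f : Plane → ℝ) (x' : Plane) : ℝ :=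
  √(1 + partialDeriv f 0 x' ^ 2 + partialDeriv f 1 x' ^ 2)

/-- The upward unit normal `ν` of the graph of `f` at `(x', f(x'))`. For a horizontal plane
it is `(0, 0, 1)`. -/
def graphNormal (f : Plane → ℝ) (x' : Plane) : Fin 3 → ℝ :=
  ![- partialDeriv f 0 x' / surfaceDensity f x', - partialDeriv f 1 x' / surfaceDensity f x',
    1 / surfaceDensity f x']

/-! ### Pointwise elasticity expressions

In what follows `P k j` stands for the value of `∂ₖ uⱼ` at a point. -/

/-- `|v|²`. -/
def normSq3 (v : Fin 3 → ℂ) : ℝ := ∑ j, ‖v j‖ ^ 2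

/-- `∇·u`. -/
def divergence (P : Fin 3 → Fin 3 → ℂ) : ℂ := ∑ k, P k k

/-- `∇×u`. -/
def curl (P : Fin 3 → Fin 3 → ℂ) : Fin 3 → ℂ :=
  ![P 1 2 - P 2 1, P 2 0 - P 0 2, P 0 1 - P 1 0]

/-- `∂_ν u`. -/
def normalDeriv (ν : Fin 3 → ℝ) (P : Fin 3 → Fin 3 → ℂ) : Fin 3 → ℂ :=
  fun j => ∑ k, (ν k : ℂ) * P k j

/-- The traction `Tu = 2μ ∂_ν u + λ (∇·u) ν + μ ν × (∇×u)`. -/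
def traction (lam mu : ℝ) (ν : Fin 3 → ℝ) (P : Fin 3 → Fin 3 → ℂ) : Fin 3 → ℂ :=
  (2 * mu : ℂ) • normalDeriv ν P + ((lam : ℂ) * divergence P) • (fun j => (ν j : ℂ))
    + (mu : ℂ) • ((fun j => (ν j : ℂ)) ⨯₃ curl P)

/-- The bilinear form
`𝓔(u, v) = 2μ ∑ ∂ₖuⱼ ∂ₖvⱼ + λ (∇·u)(∇·v) - μ (∇×u)·(∇×v)`. -/
def energyForm (lam mu : ℝ) (P Q : Fin 3 → Fin 3 → ℂ) : ℂ :=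
  2 * mu * (∑ j, ∑ k, P k j * Q k j) + lam * divergence P * divergence Q
    - mu * (curl P ⬝ᵥ curl Q)

/-- The Rellich boundary integrand
`2 Re (Tu · ∂₃ū) - ν₃ 𝓔(u, ū) + ω² |u|²` at a point with normal `ν`, where `w` is the value of `u`
and `P` the value of its gradient. (The number `𝓔(u, ū)` is real.) -/
def rellichIntegrand (lam mu om : ℝ) (ν : Fin 3 → ℝ) (w : Fin 3 → ℂ)
    (P : Fin 3 → Fin 3 → ℂ) : ℝ :=
  2 * (traction lam mu ν P ⬝ᵥ star (P 2)).re - ν 2 * (energyForm lam mu P (star P)).re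
    + om ^ 2 * normSq3 w

/-! ### The upward angular spectrum representation -/

/-- The compressional wavenumber `κ_p = ω / √(λ + 2μ)`. -/
def kappaP (lam mu om : ℝ) : ℝ := om / √(lam + 2 * mu)

/-- The shear wavenumber `κ_s = ω / √μ`. -/
def kappaS (mu om : ℝ) : ℝ := om / √mu

/-- `(κ² - |ξ|²)^{1/2}` for `|ξ| < κ` and `i (|ξ|² - κ²)^{1/2}` otherwise. -/
def vertWave (κ : ℝ) (ξ : Plane) : ℂ :=
  if ‖ξ‖ < κ then ((√(κ ^ 2 - ‖ξ‖ ^ 2) : ℝ) : ℂ)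
  else Complex.I * ((√(‖ξ‖ ^ 2 - κ ^ 2) : ℝ) : ℂ)

/-- `β(ξ)`. -/
def beta (lam mu om : ℝ) (ξ : Plane) : ℂ := vertWave (kappaP lam mu om) ξ

/-- `γ(ξ)`. -/
def gamma (mu om : ℝ) (ξ : Plane) : ℂ := vertWave (kappaS mu om) ξ

/-- The vector `(ξ₁, ξ₂, z)`. -/
def waveVec (ξ : Plane) (z : ℂ) : Fin 3 → ℂ := ![(ξ 0 : ℂ), (ξ 1 : ℂ), z]

/-- The unitary Fourier transform on `L²(ℝ²)`, normalised as
`v̂(ξ) = (1/2π) ∫ v(x') e^{-i x'·ξ} dx'` (Mathlib's `𝓕` uses the phase `e^{-2πi x'·ξ}`). -/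
def hat (v : Lp (α := Plane) ℂ 2 volume) (ξ : Plane) : ℂ :=
  (2 * Real.pi : ℂ)⁻¹ * (𝓕 v : Lp (α := Plane) ℂ 2 volume) ((2 * Real.pi)⁻¹ • ξ)

/-- `u` satisfies the upward angular spectrum representation in `x₃ > b`, with boundary value
`v ∈ L²` on the plane `x₃ = b` and with amplitudes `A_p`, `A_s`. The first two conditions on the
amplitudes are the linear system that determines them from `v̂`. -/
structure UpwardASR (lam mu om b : ℝ) (u : Space → Fin 3 → ℂ)
    (v : Fin 3 → Lp (α := Plane) ℂ 2 volume) (Ap : Plane → ℂ) (As : Plane → Fin 3 → ℂ) : Prop where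
  trace : ∀ j, HasGraphTrace (fun _ => b) (fun x => u x j) (v j)
  hat_eq : ∀ᵐ ξ : Plane, ∀ j, hat (v j) ξ = Ap ξ * waveVec ξ (beta lam mu om ξ) j + As ξ j
  orthogonal : ∀ᵐ ξ : Plane, waveVec ξ (gamma mu om ξ) ⬝ᵥ As ξ = 0
  representation : ∀ᵐ x ∂(volume.restrict (upperHalf b)), ∀ j,
    u x j = (2 * Real.pi : ℂ)⁻¹ * ∫ ξ : Plane,
      (Ap ξ * waveVec ξ (beta lam mu om ξ) j
          * Complex.exp (Complex.I * beta lam mu om ξ * ((x.2 - b : ℝ) : ℂ))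
        + As ξ j * Complex.exp (Complex.I * gamma mu om ξ * ((x.2 - b : ℝ) : ℂ)))
      * Complex.exp (Complex.I * ((inner ℝ ξ x.1 : ℝ) : ℂ))

/-- `v ∈ H¹(ℝ²)³`, expressed through the Fourier transform. -/
def TraceInH1 (v : Fin 3 → Lp (α := Plane) ℂ 2 volume) : Prop :=
  ∀ j, MemLp (fun ξ : Plane => (‖ξ‖ : ℂ) * hat (v j) ξ) 2 volume

end Elastic

end

/-!
**Dirichlet surface.** The field vanishes on the graph of `f`, hence so do its tangential
derivatives there (`MemH1.tangential_zero`). For weak gradients this is seen by testing with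
`φ(x') t⁻¹ ψ((x₃ - f(x')) / t)`: the vector fields `∂_α + ∂_α f ∂₃` are tangential to all translates
of the graph, so they only differentiate `φ`, and as `t ↓ 0` both sides of the weak formulation tend
to integrals of boundary values. Since `f` is only `C²`, the test functions are only `C¹`, which is
made admissible by mollification (`integral_mul_fderiv_of_contDiff_one`). A gradient `ν ⊗ g` turns
the Rellich integrand into `ν₃ (μ |g|² + (λ + μ) |ν·g|²)` by algebra
(`rellichIntegrand_of_tangential_zero`).

**Horizontal plane.** On the Fourier side the field at height `s` above the plane is
`A_p (ξ, β) e^{iβs} + A_s e^{iγs}`. The amplitudes solve a linear system with determinant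
`|ξ|² + βγ`, whose real part is at least `κ_p²`; they may grow like `|ξ|² |v̂|`, but the
cancellation `β - γ = O(1 / |ξ|)` makes the mode bounded by `|v̂|`, and its gradient by
`(1 + |ξ|) |v̂|`, uniformly in `0 ≤ s ≤ 1` (`exists_amplitude_bounds`). With Plancherel's theorem and
dominated convergence this yields the boundary values of the field and of its gradient
(`hasGraphTrace_waveField`); weak derivatives come from Fubini's theorem and integration by parts
against a single plane wave (`integral_waveField_mul_fderiv`). The link between the `L²` Fourier
transform and the representation integral is `ae_eq_integral_of_hat`.

By Parseval's identity the boundary integrals become integrals over `ξ` of the same forms evaluated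
at one mode. For fixed `ξ` both forms are constant in `x₃` along the solutions of the elasticity
system, the Rellich form because it is the Hamiltonian belonging to the Lagrangian
`𝓔(u, ū) - ω² |u|²`. The product of two terms with vertical wavenumbers `β`, `γ` depends on `x₃`
through `e^{i(β - γ̄)x₃}`, so mixed terms and those of evanescent modes with themselves do not
contribute. As an identity between polynomials this is `rellich_polynomial_identity` and
`flux_polynomial_identity`.

**Higher planes.** Moving the plane up by `b - c` multiplies the amplitudes by factors that decay like
`e^{-(b - c)|ξ|}`, which absorbs every power of `|ξ|` (`UpwardASR.shift`).
-/

open MeasureTheory Filter Topology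
open scoped Matrix FourierTransform ContDiff NNReal ENNReal ComplexConjugate

noncomputable section

namespace Elastic

/-! ### The unitary Fourier transform on `L²` of the plane -/

theorem finrank_plane : Module.finrank ℝ Plane = 2 := by simp

theorem quasiMeasurePreserving_dilation {r : ℝ} (hr : r ≠ 0) :
    Measure.QuasiMeasurePreserving (fun ξ : Plane => r • ξ) volume volume := by
  refine ⟨measurable_const_smul r, ?_⟩
  rw [Measure.map_addHaar_smul volume hr]
  exact Measure.smul_absolutelyContinuous

theorem hat_add (V W : Lp (α := Plane) ℂ 2 volume) :
    hat (V + W) =ᵐ[volume] fun ξ => hat V ξ + hat W ξ := by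
  have hr : (2 * Real.pi)⁻¹ ≠ 0 := by positivity
  have h := (quasiMeasurePreserving_dilation hr).ae (Lp.coeFn_add (𝓕 V) (𝓕 W))
  filter_upwards [h] with ξ hξ
  simp only [hat, FourierTransform.fourier_add, hξ, Pi.add_apply]
  ring

theorem hat_smul (c : ℂ) (V : Lp (α := Plane) ℂ 2 volume) :
    hat (c • V) =ᵐ[volume] fun ξ => c * hat V ξ := by
  have hr : (2 * Real.pi)⁻¹ ≠ 0 := by positivity
  have h := (quasiMeasurePreserving_dilation hr).ae (Lp.coeFn_smul c (𝓕 V))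
  filter_upwards [h] with ξ hξ
  simp only [hat, FourierTransform.fourier_smul, hξ, Pi.smul_apply, smul_eq_mul]
  ring

theorem hat_sub (V W : Lp (α := Plane) ℂ 2 volume) :
    hat (V - W) =ᵐ[volume] fun ξ => hat V ξ - hat W ξ := by
  have h1 := hat_add V ((-1 : ℂ) • W)
  have h2 := hat_smul (-1) W
  have : V - W = V + (-1 : ℂ) • W := by rw [neg_one_smul, sub_eq_add_neg]
  rw [this]
  filter_upwards [h1, h2] with ξ e1 e2
  rw [e1, e2]; ring

theorem memLp_hat (V : Lp (α := Plane) ℂ 2 volume) : MemLp (hat V) 2 volume := by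
  have hr : (2 * Real.pi)⁻¹ ≠ 0 := by positivity
  have hm : AEStronglyMeasurable (fun ξ : Plane => (𝓕 V : Lp (α := Plane) ℂ 2 volume)
      ((2 * Real.pi)⁻¹ • ξ)) volume :=
    (Lp.aestronglyMeasurable (𝓕 V)).comp_quasiMeasurePreserving
      (quasiMeasurePreserving_dilation hr)
  refine MemLp.const_mul ((memLp_two_iff_integrable_sq_norm hm).2 ?_) _
  exact ((Lp.memLp (𝓕 V)).integrable_norm_pow (by norm_num)).comp_smul hr

/-- Parseval's identity. -/
theorem integral_mul_conj_eq_hat (V W : Lp (α := Plane) ℂ 2 volume) :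
    ∫ x, V x * conj (W x) = ∫ ξ, hat V ξ * conj (hat W ξ) := by
  have key : ∀ A B : Lp (α := Plane) ℂ 2 volume,
      ∫ x, A x * conj (B x) = inner ℂ B A := fun A B => by
    rw [L2.inner_def]; rfl
  have h : ∀ ξ, hat V ξ * conj (hat W ξ) = ((2 * Real.pi : ℂ)⁻¹) ^ 2 *
      ((fun η => (𝓕 V : Lp (α := Plane) ℂ 2 volume) η
        * conj ((𝓕 W : Lp (α := Plane) ℂ 2 volume) η)) ((2 * Real.pi)⁻¹ • ξ)) := fun ξ => by
    simp only [hat, map_mul, map_inv₀, Complex.conj_ofReal, map_ofNat]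
    ring
  rw [integral_congr_ae (.of_forall h), integral_const_mul, Measure.integral_comp_smul volume
    (fun η => (𝓕 V : Lp (α := Plane) ℂ 2 volume) η
        * conj ((𝓕 W : Lp (α := Plane) ℂ 2 volume) η)), finrank_plane, key V W, key,
    Lp.inner_fourier_eq, abs_of_pos (by positivity), Complex.real_smul]
  push_cast
  field_simp

/-- Plancherel's identity. -/
theorem lintegral_enorm_sq_eq_hat (V : Lp (α := Plane) ℂ 2 volume) :
    ∫⁻ x, ‖V x‖ₑ ^ 2 = ∫⁻ ξ, ‖hat V ξ‖ₑ ^ 2 := by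
  have key : ∀ g : Plane → ℂ, MemLp g 2 volume →
      ∫⁻ x, ‖g x‖ₑ ^ 2 = ENNReal.ofReal (∫ x, g x * conj (g x)).re := fun g hg => by
    have hi : Integrable (fun x => ‖g x‖ ^ 2) := hg.integrable_norm_pow (by norm_num)
    have e : ∫ x, g x * conj (g x) = ((∫ x, ‖g x‖ ^ 2 : ℝ) : ℂ) := by
      rw [← integral_complex_ofReal]
      refine integral_congr_ae (.of_forall fun x => ?_)
      simp [Complex.mul_conj']
    rw [e, Complex.ofReal_re, ofReal_integral_eq_lintegral_ofReal hi
      (.of_forall fun x => by positivity)]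
    refine lintegral_congr fun x => ?_
    rw [ENNReal.ofReal_pow (norm_nonneg _), ofReal_norm]
  rw [key _ (Lp.memLp V), key _ (memLp_hat V), integral_mul_conj_eq_hat]

theorem exists_hat_eq {w : Plane → ℂ} (hw : MemLp w 2 volume) :
    ∃ V : Lp (α := Plane) ℂ 2 volume, hat V =ᵐ[volume] w := by
  have hr : (2 * Real.pi : ℝ) ≠ 0 := by positivity
  have hm : AEStronglyMeasurable (fun η : Plane => w ((2 * Real.pi) • η)) volume :=
    hw.1.comp_quasiMeasurePreserving (quasiMeasurePreserving_dilation hr)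
  have hW : MemLp (fun η : Plane => (2 * Real.pi : ℂ) * w ((2 * Real.pi) • η)) 2 volume :=
    MemLp.const_mul ((memLp_two_iff_integrable_sq_norm hm).2
      ((hw.integrable_norm_pow (by norm_num)).comp_smul hr)) _
  refine ⟨𝓕⁻ hW.toLp, ?_⟩
  have h := (quasiMeasurePreserving_dilation (inv_ne_zero hr)).ae hW.coeFn_toLp
  filter_upwards [h] with ξ hξ
  rw [hat, FourierTransform.fourier_fourierInv_eq, hξ, smul_smul, mul_inv_cancel₀ hr, one_smul,
    inv_mul_cancel_left₀ (by exact_mod_cast hr)]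

/-- An `L²` function with integrable Fourier transform is given by the inversion integral. -/
theorem ae_eq_integral_of_hat {V : Lp (α := Plane) ℂ 2 volume} {w : Plane → ℂ}
    (hV : hat V =ᵐ[volume] w) (hw : Integrable w) :
    V =ᵐ[volume] fun x => (2 * Real.pi : ℂ)⁻¹ *
      ∫ ξ, w ξ * Complex.exp (Complex.I * ((inner ℝ ξ x : ℝ) : ℂ)) := by
  have hr : (2 * Real.pi : ℝ) ≠ 0 := by positivity
  set W : Plane → ℂ := fun η => (𝓕 V : Lp (α := Plane) ℂ 2 volume) η with hWdef
  have hWw : W =ᵐ[volume] fun η => (2 * Real.pi : ℂ) * w ((2 * Real.pi) • η) := by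
    filter_upwards [(quasiMeasurePreserving_dilation hr).ae hV] with η hη
    rw [← hη, hat, smul_smul, inv_mul_cancel₀ hr, one_smul,
      mul_inv_cancel_left₀ (by exact_mod_cast hr)]
  have hWi : Integrable W := by
    refine Integrable.congr ?_ hWw.symm
    exact ((integrable_comp_smul_iff volume w hr).2 hw).const_mul _
  -- the inversion integral in Mathlib's normalisation
  have hinv : ∀ x, 𝓕⁻ W x = (2 * Real.pi : ℂ)⁻¹ *
      ∫ ξ, w ξ * Complex.exp (Complex.I * ((inner ℝ ξ x : ℝ) : ℂ)) := fun x => by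
    rw [Real.fourierInv_eq']
    have e : (fun η : Plane => Complex.exp (((2 * Real.pi * inner ℝ η x : ℝ) : ℂ) * Complex.I) • W η)
        =ᵐ[volume] fun η => (2 * Real.pi : ℂ) * (fun ξ => w ξ *
          Complex.exp (Complex.I * ((inner ℝ ξ x : ℝ) : ℂ))) ((2 * Real.pi) • η) := by
      filter_upwards [hWw] with η hη
      simp only [hη, smul_eq_mul, real_inner_smul_left]
      rw [mul_comm Complex.I]
      ring
    rw [integral_congr_ae e, integral_const_mul, Measure.integral_comp_smul volume
      (fun ξ => w ξ * Complex.exp (Complex.I * ((inner ℝ ξ x : ℝ) : ℂ))), finrank_plane,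
      abs_of_pos (by positivity), Complex.real_smul]
    push_cast
    field_simp
  have hVinv : V =ᵐ[volume] 𝓕⁻ W := by
    have hcont : Continuous (𝓕⁻ W) := by
      have := VectorFourier.fourierIntegral_continuous (V := Plane) (W := Plane)
        Real.continuous_fourierChar (L := -innerₗ Plane) (μ := volume) (f := W)
        (by simpa using! continuous_inner.neg) hWi
      exact this
    have hli : LocallyIntegrable (fun x => V x) volume :=
      (Lp.memLp V).locallyIntegrable (by norm_num)
    have := ae_eq_zero_of_integral_contDiff_smul_eq_zero
      (f := fun x => V x - 𝓕⁻ W x) (μ := (volume : Measure Plane))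
      (hli.sub hcont.locallyIntegrable) ?_
    · filter_upwards [this] with x hx using sub_eq_zero.1 hx
    intro g hg hgc
    have hg₁ : HasCompactSupport (Complex.ofRealCLM ∘ g) := hgc.comp_left rfl
    have hg₂ : ContDiff ℝ ∞ (Complex.ofRealCLM ∘ g) := by fun_prop
    set φ := hg₁.toSchwartzMap hg₂ with hφ
    have hφg : ∀ x, φ x = (g x : ℂ) := fun x => by simp [hφ]
    have e1 : ∫ x, φ x • V x = ∫ η, (𝓕⁻ φ) η • W η := by
      have := congrArg (fun T => T (𝓕⁻ φ)) (Lp.fourier_toTemperedDistribution_eq V)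
      simp only [TemperedDistribution.fourier_apply, Lp.toTemperedDistribution_apply,
        FourierTransform.fourier_fourierInv_eq] at this
      exact this
    have e2 : ∫ η, (𝓕⁻ φ) η • W η = ∫ x, φ x • 𝓕⁻ W x := by
      have := VectorFourier.integral_fourierIntegral_smul_eq_flip (e := Real.fourierChar)
        (L := -innerₗ Plane) (μ := volume) (ν := volume) (f := φ) (g := W)
        Real.continuous_fourierChar (by simpa using! continuous_inner.neg) φ.integrable hWi
      have hflip : (-innerₗ Plane).flip = -innerₗ Plane := by
        ext x y; simp [real_inner_comm]
      rw [hflip] at this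
      rw [SchwartzMap.fourierInv_coe]
      exact this
    have i1 : Integrable (fun x => φ x • V x) := by
      have := hli.integrable_smul_left_of_hasCompactSupport (g := fun x => φ x) φ.continuous hg₁
      exact this
    have i2 : Integrable (fun x => φ x • 𝓕⁻ W x) :=
      hcont.locallyIntegrable.integrable_smul_left_of_hasCompactSupport (g := fun x => φ x)
        φ.continuous hg₁
    calc ∫ x, g x • (V x - 𝓕⁻ W x) = ∫ x, (φ x • V x - φ x • 𝓕⁻ W x) := by
          refine integral_congr_ae (.of_forall fun x => ?_)
          simp [hφg, mul_sub]
      _ = 0 := by rw [integral_sub i1 i2, e1, e2, sub_self]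
  filter_upwards [hVinv] with x hx
  rw [hx, hinv]

/-! ### Vertical wavenumbers -/

theorem vertWave_of_lt {κ : ℝ} {ξ : Plane} (h : ‖ξ‖ < κ) :
    vertWave κ ξ = ((√(κ ^ 2 - ‖ξ‖ ^ 2) : ℝ) : ℂ) := if_pos h

theorem vertWave_of_le {κ : ℝ} {ξ : Plane} (h : κ ≤ ‖ξ‖) :
    vertWave κ ξ = Complex.I * ((√(‖ξ‖ ^ 2 - κ ^ 2) : ℝ) : ℂ) := if_neg h.not_gt

theorem vertWave_sq {κ : ℝ} (hκ : 0 ≤ κ) (ξ : Plane) :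
    vertWave κ ξ ^ 2 = ((κ ^ 2 - ‖ξ‖ ^ 2 : ℝ) : ℂ) := by
  rcases lt_or_ge ‖ξ‖ κ with h | h
  · rw [vertWave_of_lt h, ← Complex.ofReal_pow, Real.sq_sqrt]
    nlinarith [norm_nonneg ξ]
  · rw [vertWave_of_le h, mul_pow, ← Complex.ofReal_pow, Real.sq_sqrt (by nlinarith),
      Complex.I_sq]
    push_cast; ring

theorem conj_vertWave_of_le {κ : ℝ} {ξ : Plane} (h : κ ≤ ‖ξ‖) :
    conj (vertWave κ ξ) = -vertWave κ ξ := by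
  rw [vertWave_of_le h, map_mul, Complex.conj_ofReal, Complex.conj_I, neg_mul]

theorem vertWave_re_nonneg (κ : ℝ) (ξ : Plane) : 0 ≤ (vertWave κ ξ).re := by
  unfold vertWave
  split_ifs <;> simp [Real.sqrt_nonneg]

theorem vertWave_im_nonneg (κ : ℝ) (ξ : Plane) : 0 ≤ (vertWave κ ξ).im := by
  unfold vertWave
  split_ifs <;> simp [Real.sqrt_nonneg]

theorem sub_le_vertWave_im {κ : ℝ} (hκ : 0 ≤ κ) (ξ : Plane) : ‖ξ‖ - κ ≤ (vertWave κ ξ).im := by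
  rcases lt_or_ge ‖ξ‖ κ with h | h
  · exact (sub_neg.2 h).le.trans (vertWave_im_nonneg κ ξ)
  · rw [vertWave_of_le h, Complex.I_mul_im, Complex.ofReal_re]
    exact Real.le_sqrt_of_sq_le (by nlinarith)

theorem norm_vertWave_sq {κ : ℝ} (hκ : 0 ≤ κ) (ξ : Plane) :
    ‖vertWave κ ξ‖ ^ 2 = |κ ^ 2 - ‖ξ‖ ^ 2| := by
  rw [← norm_pow, vertWave_sq hκ, Complex.norm_real, Real.norm_eq_abs]

theorem norm_vertWave_le {κ : ℝ} (hκ : 0 ≤ κ) (ξ : Plane) : ‖vertWave κ ξ‖ ≤ κ + ‖ξ‖ := by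
  refine abs_le_of_sq_le_sq' ?_ (by positivity) |>.2
  rw [norm_vertWave_sq hκ]
  refine abs_le.2 ⟨?_, ?_⟩ <;> nlinarith [norm_nonneg ξ]

theorem norm_le_norm_vertWave_add {κ : ℝ} (hκ : 0 ≤ κ) (ξ : Plane) :
    ‖ξ‖ ≤ ‖vertWave κ ξ‖ + κ := by
  refine abs_le_of_sq_le_sq' ?_ (by positivity) |>.2
  have := norm_vertWave_sq hκ ξ
  have h2 := neg_abs_le (κ ^ 2 - ‖ξ‖ ^ 2)
  nlinarith [norm_nonneg (vertWave κ ξ)]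

theorem measurable_vertWave (κ : ℝ) : Measurable (vertWave κ) := by
  unfold vertWave
  refine Measurable.ite (measurableSet_lt measurable_norm measurable_const) ?_ ?_ <;> fun_prop

theorem norm_exp_vertWave_eq (κ s : ℝ) (ξ : Plane) :
    ‖Complex.exp (Complex.I * vertWave κ ξ * (s : ℂ))‖ = Real.exp (-((vertWave κ ξ).im * s)) := by
  rw [Complex.norm_exp]
  congr 1
  simp

theorem norm_exp_vertWave_le_one (κ : ℝ) {s : ℝ} (hs : 0 ≤ s) (ξ : Plane) :
    ‖Complex.exp (Complex.I * vertWave κ ξ * (s : ℂ))‖ ≤ 1 := by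
  rw [norm_exp_vertWave_eq, Real.exp_le_one_iff, neg_nonpos]
  exact mul_nonneg (vertWave_im_nonneg κ ξ) hs

theorem norm_exp_vertWave_le {κ κ' : ℝ} (hκ : 0 ≤ κ) (h : κ ≤ κ') {s : ℝ} (hs : 0 ≤ s)
    (ξ : Plane) :
    ‖Complex.exp (Complex.I * vertWave κ ξ * (s : ℂ))‖ ≤ Real.exp (s * (κ' - ‖ξ‖)) := by
  rw [norm_exp_vertWave_eq, Real.exp_le_exp]
  nlinarith [sub_le_vertWave_im hκ ξ]

theorem norm_exp_sub_exp_le {M : ℝ} {z w : ℂ} (hz : z.re ≤ M) (hw : w.re ≤ M) :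
    ‖Complex.exp z - Complex.exp w‖ ≤ Real.exp M * ‖z - w‖ := by
  have hconv : Convex ℝ {z : ℂ | z.re ≤ M} := convex_halfSpace_re_le M
  refine hconv.norm_image_sub_le_of_norm_deriv_le (f := Complex.exp)
    (fun x _ => Complex.differentiableAt_exp) (fun x hx => ?_) hw hz
  rw [Complex.deriv_exp, Complex.norm_exp]
  exact Real.exp_le_exp.2 hx

theorem norm_exp_vertWave_sub_le {κ κ' : ℝ} (hκ : 0 ≤ κ) (h : κ ≤ κ') {s : ℝ} (hs : 0 ≤ s)
    (ξ : Plane) :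
    ‖Complex.exp (Complex.I * vertWave κ ξ * (s : ℂ))
      - Complex.exp (Complex.I * vertWave κ' ξ * (s : ℂ))‖
      ≤ Real.exp (s * (κ' - ‖ξ‖)) * (s * ‖vertWave κ ξ - vertWave κ' ξ‖) := by
  have e : Complex.I * vertWave κ ξ * (s : ℂ) - Complex.I * vertWave κ' ξ * (s : ℂ)
      = Complex.I * (s : ℂ) * (vertWave κ ξ - vertWave κ' ξ) := by ring
  have hre : ∀ k : ℝ, (Complex.I * vertWave k ξ * (s : ℂ)).re = -((vertWave k ξ).im * s) :=
    fun k => by simp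
  refine (norm_exp_sub_exp_le (M := s * (κ' - ‖ξ‖)) ?_ ?_).trans_eq ?_
  · rw [hre]; nlinarith [sub_le_vertWave_im hκ ξ]
  · rw [hre]; nlinarith [sub_le_vertWave_im (hκ.trans h) ξ]
  · rw [e, norm_mul, norm_mul, Complex.norm_I, Complex.norm_real, Real.norm_of_nonneg hs, one_mul]

/-- The determinant `|ξ|² + βγ` of the system for the amplitudes is bounded away from zero. -/
theorem sq_le_norm_det {κ κ' : ℝ} (hκ : 0 ≤ κ) (h : κ ≤ κ') (ξ : Plane) :
    κ ^ 2 ≤ ‖((‖ξ‖ ^ 2 : ℝ) : ℂ) + vertWave κ ξ * vertWave κ' ξ‖ := by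
  refine le_trans ?_ (Complex.re_le_norm _)
  rw [Complex.add_re, Complex.ofReal_re]
  have hξ := norm_nonneg ξ
  rcases lt_or_ge ‖ξ‖ κ with h1 | h1
  · rw [vertWave_of_lt h1, vertWave_of_lt (h1.trans_le h), ← Complex.ofReal_mul, Complex.ofReal_re]
    have h2 : √(κ ^ 2 - ‖ξ‖ ^ 2) ≤ √(κ' ^ 2 - ‖ξ‖ ^ 2) := Real.sqrt_le_sqrt (by nlinarith)
    have h3 : √(κ ^ 2 - ‖ξ‖ ^ 2) ^ 2 = κ ^ 2 - ‖ξ‖ ^ 2 := Real.sq_sqrt (by nlinarith)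
    nlinarith [Real.sqrt_nonneg (κ ^ 2 - ‖ξ‖ ^ 2)]
  rcases lt_or_ge ‖ξ‖ κ' with h2 | h2
  · rw [vertWave_of_le h1, vertWave_of_lt h2]
    simp
    exact pow_le_pow_left₀ hκ h1 2
  · rw [vertWave_of_le h1, vertWave_of_le h2]
    have e : Complex.I * ((√(‖ξ‖ ^ 2 - κ ^ 2) : ℝ) : ℂ) * (Complex.I * ((√(‖ξ‖ ^ 2 - κ' ^ 2) : ℝ) : ℂ))
        = ((-(√(‖ξ‖ ^ 2 - κ ^ 2) * √(‖ξ‖ ^ 2 - κ' ^ 2)) : ℝ) : ℂ) := by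
      push_cast
      linear_combination (((√(‖ξ‖ ^ 2 - κ ^ 2) : ℝ) : ℂ) * ((√(‖ξ‖ ^ 2 - κ' ^ 2) : ℝ) : ℂ))
        * Complex.I_sq
    rw [e, Complex.ofReal_re]
    have h2 : √(‖ξ‖ ^ 2 - κ' ^ 2) ≤ √(‖ξ‖ ^ 2 - κ ^ 2) := Real.sqrt_le_sqrt (by nlinarith)
    have h3 : √(‖ξ‖ ^ 2 - κ ^ 2) ^ 2 = ‖ξ‖ ^ 2 - κ ^ 2 := Real.sq_sqrt (by nlinarith)
    nlinarith [Real.sqrt_nonneg (‖ξ‖ ^ 2 - κ' ^ 2), Real.sqrt_nonneg (‖ξ‖ ^ 2 - κ ^ 2)]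

/-- The difference of two vertical wavenumbers decays like `1 / |ξ|`, because the difference of
their squares is constant. -/
theorem norm_vertWave_sub_mul_le {κ κ' : ℝ} (hκ : 0 ≤ κ) (h : κ ≤ κ') (ξ : Plane) :
    ‖vertWave κ ξ - vertWave κ' ξ‖ * (1 + ‖ξ‖) ≤ κ' + 2 * κ' ^ 2 := by
  have hκ' := hκ.trans h
  set a := vertWave κ ξ with ha
  set c := vertWave κ' ξ with hc
  have hprod : ‖a - c‖ * ‖a + c‖ = κ' ^ 2 - κ ^ 2 := by
    rw [← norm_mul, show (a - c) * (a + c) = a ^ 2 - c ^ 2 by ring, ha, hc, vertWave_sq hκ,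
      vertWave_sq hκ', ← Complex.ofReal_sub, Complex.norm_real, Real.norm_eq_abs, abs_sub_comm,
      abs_of_nonneg] <;> nlinarith
  have har := vertWave_re_nonneg κ ξ
  have hai := vertWave_im_nonneg κ ξ
  have hcr := vertWave_re_nonneg κ' ξ
  have hci := vertWave_im_nonneg κ' ξ
  rw [← ha] at har hai
  rw [← hc] at hcr hci
  have hle : ‖a - c‖ ≤ ‖a + c‖ := by
    rw [Complex.norm_def, Complex.norm_def]
    refine Real.sqrt_le_sqrt ?_
    simp only [Complex.normSq_apply, Complex.sub_re, Complex.sub_im, Complex.add_re,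
      Complex.add_im]
    nlinarith [mul_nonneg har hcr, mul_nonneg hai hci]
  have hcle : ‖c‖ ≤ ‖a + c‖ := by
    rw [Complex.norm_def, Complex.norm_def]
    refine Real.sqrt_le_sqrt ?_
    simp only [Complex.normSq_apply, Complex.add_re, Complex.add_im]
    nlinarith [mul_nonneg har hcr, mul_nonneg hai hci]
  have hd : ‖a - c‖ ≤ κ' := by
    refine abs_le_of_sq_le_sq' ?_ hκ' |>.2
    nlinarith [norm_nonneg (a - c)]
  have hξ : ‖ξ‖ ≤ ‖a + c‖ + κ' := (norm_le_norm_vertWave_add hκ' ξ).trans (by gcongr)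
  nlinarith [norm_nonneg (a - c)]

/-! ### Bounds for the amplitudes -/

theorem norm_sq_plane (ξ : Plane) : ξ 0 ^ 2 + ξ 1 ^ 2 = ‖ξ‖ ^ 2 := by
  rw [EuclideanSpace.norm_sq_eq]; simp

theorem norm_waveVec_le {ξ : Plane} {z : ℂ} {κ : ℝ} (hκ : 0 ≤ κ) (hz : ‖z‖ ≤ κ + ‖ξ‖) (j : Fin 3) :
    ‖waveVec ξ z j‖ ≤ (1 + κ) * (1 + ‖ξ‖) := by
  have hξ : ∀ i : Fin 2, ‖((ξ i : ℝ) : ℂ)‖ ≤ ‖ξ‖ := fun i => by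
    rw [Complex.norm_real]; exact PiLp.norm_apply_le ξ i
  have h0 := norm_nonneg ξ
  fin_cases j
  · exact (hξ 0).trans (by nlinarith)
  · exact (hξ 1).trans (by nlinarith)
  · exact hz.trans (by nlinarith)

/-- The compressional amplitude in terms of the boundary value. -/
theorem amplitude_mul_det {ξ : Plane} {a c A : ℂ} {v S : Fin 3 → ℂ}
    (hv : ∀ j, v j = A * waveVec ξ a j + S j) (hS : waveVec ξ c ⬝ᵥ S = 0) :
    A * (((‖ξ‖ ^ 2 : ℝ) : ℂ) + a * c) = waveVec ξ c ⬝ᵥ v := by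
  have : v = fun j => A * waveVec ξ a j + S j := funext hv
  rw [this, ← norm_sq_plane]
  simp only [dotProduct, Fin.sum_univ_three, waveVec, Matrix.cons_val] at hS ⊢
  push_cast
  linear_combination -hS

/-- Bounds for the amplitudes belonging to the boundary value `v` at the frequency `ξ`, and for
the resulting mode and its vertical derivative at the height `s` above the boundary. Each
of the two terms of the mode grows like `|ξ|² |v|`, but their sum is uniformly bounded by `|v|`:
it is written as `v e^{iγs} + A (ξ, β) (e^{iβs} - e^{iγs})`. -/
theorem exists_amplitude_bounds {κ κ' : ℝ} (hκ : 0 < κ) (h : κ ≤ κ') :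
    ∃ C : ℝ, 0 ≤ C ∧ ∀ (ξ : Plane) (A : ℂ) (v S : Fin 3 → ℂ),
      (∀ j, v j = A * waveVec ξ (vertWave κ ξ) j + S j) → waveVec ξ (vertWave κ' ξ) ⬝ᵥ S = 0 →
      ‖A‖ ≤ C * (1 + ‖ξ‖) * ∑ i, ‖v i‖ ∧
      ∀ j, ‖A * waveVec ξ (vertWave κ ξ) j‖ ≤ C * (1 + ‖ξ‖) ^ 2 * ∑ i, ‖v i‖ ∧
        ‖S j‖ ≤ C * (1 + ‖ξ‖) ^ 2 * ∑ i, ‖v i‖ ∧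
        ∀ s : ℝ, 0 ≤ s → s ≤ 1 →
          ‖A * waveVec ξ (vertWave κ ξ) j * Complex.exp (Complex.I * vertWave κ ξ * (s : ℂ))
            + S j * Complex.exp (Complex.I * vertWave κ' ξ * (s : ℂ))‖ ≤ C * ∑ i, ‖v i‖ ∧
          ‖Complex.I * vertWave κ ξ * (A * waveVec ξ (vertWave κ ξ) j)
              * Complex.exp (Complex.I * vertWave κ ξ * (s : ℂ))
            + Complex.I * vertWave κ' ξ * S j
              * Complex.exp (Complex.I * vertWave κ' ξ * (s : ℂ))‖
            ≤ C * (1 + ‖ξ‖) * ∑ i, ‖v i‖ := by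
  have hκ' := hκ.trans_le h
  set C₁ : ℝ := (1 + κ') / κ ^ 2 with hC₁
  set C₂ : ℝ := C₁ * (1 + κ') with hC₂
  set C₃ : ℝ := 1 + C₂ * (κ' + 2 * κ' ^ 2) * (2 * Real.exp κ') with hC₃
  set C₄ : ℝ := (1 + κ') * C₃ + C₂ * (κ' + 2 * κ' ^ 2) with hC₄
  have p1 : 0 ≤ C₁ := by positivity
  have p2 : 0 ≤ C₂ := by positivity
  have p3 : 0 ≤ C₃ := by positivity
  have p4 : 0 ≤ C₄ := by positivity
  refine ⟨C₁ + (1 + C₂) + C₃ + C₄, by positivity, fun ξ A v S hv hS => ?_⟩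
  set N : ℝ := ∑ i, ‖v i‖ with hN
  have hN0 : 0 ≤ N := by positivity
  have hvN : ∀ j, ‖v j‖ ≤ N := fun j =>
    Finset.single_le_sum (f := fun i => ‖v i‖) (fun i _ => norm_nonneg _) (Finset.mem_univ j)
  have hξ0 := norm_nonneg ξ
  set β := vertWave κ ξ with hβ
  set γ := vertWave κ' ξ with hγ
  have hβn : ‖β‖ ≤ κ' + ‖ξ‖ := (norm_vertWave_le hκ.le ξ).trans (by gcongr)
  have hγn : ‖γ‖ ≤ κ' + ‖ξ‖ := norm_vertWave_le hκ'.le ξ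
  have hA : ‖A‖ ≤ C₁ * (1 + ‖ξ‖) * N := by
    have e := amplitude_mul_det hv hS
    have h1 : ‖waveVec ξ γ ⬝ᵥ v‖ ≤ (1 + κ') * (1 + ‖ξ‖) * N := by
      rw [dotProduct, hN, Finset.mul_sum]
      refine (norm_sum_le _ _).trans (Finset.sum_le_sum fun j _ => ?_)
      rw [norm_mul]
      gcongr
      exact norm_waveVec_le hκ'.le hγn j
    have h2 := sq_le_norm_det hκ.le h ξ
    have h3 : ‖A‖ * κ ^ 2 ≤ (1 + κ') * (1 + ‖ξ‖) * N := by
      refine le_trans ?_ h1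
      rw [← e, norm_mul]
      gcongr
    calc ‖A‖ = ‖A‖ * κ ^ 2 / κ ^ 2 := by field_simp
      _ ≤ (1 + κ') * (1 + ‖ξ‖) * N / κ ^ 2 := by gcongr
      _ = C₁ * (1 + ‖ξ‖) * N := by rw [hC₁]; ring
  have hAw : ∀ j, ‖A * waveVec ξ β j‖ ≤ C₂ * (1 + ‖ξ‖) ^ 2 * N := fun j => by
    rw [norm_mul]
    calc _ ≤ C₁ * (1 + ‖ξ‖) * N * ((1 + κ') * (1 + ‖ξ‖)) := by
          gcongr
          exact norm_waveVec_le hκ'.le hβn j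
      _ = _ := by rw [hC₂]; ring
  have hSw : ∀ j, ‖S j‖ ≤ (1 + C₂) * (1 + ‖ξ‖) ^ 2 * N := fun j => by
    have e : S j = v j - A * waveVec ξ β j := by rw [hv j]; ring
    rw [e]
    refine (norm_sub_le _ _).trans ?_
    have := hvN j
    have := hAw j
    have : N ≤ (1 + ‖ξ‖) ^ 2 * N := le_mul_of_one_le_left hN0 (by nlinarith)
    nlinarith
  have hdiff : ‖β - γ‖ * (1 + ‖ξ‖) ≤ κ' + 2 * κ' ^ 2 := norm_vertWave_sub_mul_le hκ.le h ξ
  refine ⟨hA.trans ?_, fun j => ⟨(hAw j).trans ?_, (hSw j).trans ?_, fun s hs hs1 => ?_⟩⟩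
  · exact mul_le_mul_of_nonneg_right (mul_le_mul_of_nonneg_right (by linarith)
      (by positivity)) hN0
  · exact mul_le_mul_of_nonneg_right (mul_le_mul_of_nonneg_right (by linarith)
      (by positivity)) hN0
  · exact mul_le_mul_of_nonneg_right (mul_le_mul_of_nonneg_right (by linarith)
      (by positivity)) hN0
  have heγ : ‖Complex.exp (Complex.I * γ * (s : ℂ))‖ ≤ 1 := norm_exp_vertWave_le_one κ' hs ξ
  have heβ : ‖Complex.exp (Complex.I * β * (s : ℂ))‖ ≤ 1 := norm_exp_vertWave_le_one κ hs ξ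
  have hexp : Real.exp (s * (κ' - ‖ξ‖)) * (s * (1 + ‖ξ‖)) ≤ 2 * Real.exp κ' := by
    have e1 : Real.exp (s * (κ' - ‖ξ‖)) = Real.exp (s * κ') * Real.exp (-(s * ‖ξ‖)) := by
      rw [← Real.exp_add]; ring_nf
    have e2 : Real.exp (s * κ') ≤ Real.exp κ' := Real.exp_le_exp.2 (by nlinarith)
    have e3 : s * (1 + ‖ξ‖) ≤ Real.exp (s * ‖ξ‖) := by
      have := Real.add_one_le_exp (s * ‖ξ‖)
      nlinarith
    calc _ ≤ Real.exp κ' * Real.exp (-(s * ‖ξ‖)) * Real.exp (s * ‖ξ‖) := by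
          rw [e1]; gcongr
      _ = Real.exp κ' := by rw [mul_assoc, ← Real.exp_add]; simp
      _ ≤ _ := by linarith [Real.exp_pos κ']
  have hmode : ‖A * waveVec ξ β j * Complex.exp (Complex.I * β * (s : ℂ))
            + S j * Complex.exp (Complex.I * γ * (s : ℂ))‖ ≤ C₃ * N := by
    have e : A * waveVec ξ β j * Complex.exp (Complex.I * β * (s : ℂ))
            + S j * Complex.exp (Complex.I * γ * (s : ℂ))
        = v j * Complex.exp (Complex.I * γ * (s : ℂ)) + A * waveVec ξ β j *
          (Complex.exp (Complex.I * β * (s : ℂ)) - Complex.exp (Complex.I * γ * (s : ℂ))) := by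
      rw [hv j]; ring
    rw [e]
    have h1 : ‖v j * Complex.exp (Complex.I * γ * (s : ℂ))‖ ≤ N := by
      rw [norm_mul]
      exact (mul_le_of_le_one_right (norm_nonneg _) heγ).trans (hvN j)
    have h2 : ‖A * waveVec ξ β j * (Complex.exp (Complex.I * β * (s : ℂ))
        - Complex.exp (Complex.I * γ * (s : ℂ)))‖
        ≤ C₂ * (κ' + 2 * κ' ^ 2) * (2 * Real.exp κ') * N := by
      rw [norm_mul]
      calc _ ≤ C₂ * (1 + ‖ξ‖) ^ 2 * N * (Real.exp (s * (κ' - ‖ξ‖)) * (s * ‖β - γ‖)) := by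
            gcongr
            · exact hAw j
            · exact norm_exp_vertWave_sub_le hκ.le h hs ξ
        _ = C₂ * (‖β - γ‖ * (1 + ‖ξ‖)) * (Real.exp (s * (κ' - ‖ξ‖)) * (s * (1 + ‖ξ‖))) * N := by
            ring
        _ ≤ _ := by gcongr
    refine (norm_add_le _ _).trans ((add_le_add h1 h2).trans_eq ?_)
    rw [hC₃]; ring
  refine ⟨hmode.trans (by gcongr; linarith), ?_⟩
  have e : Complex.I * β * (A * waveVec ξ β j) * Complex.exp (Complex.I * β * (s : ℂ))
      + Complex.I * γ * S j * Complex.exp (Complex.I * γ * (s : ℂ))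
      = Complex.I * γ * (A * waveVec ξ β j * Complex.exp (Complex.I * β * (s : ℂ))
            + S j * Complex.exp (Complex.I * γ * (s : ℂ)))
        + Complex.I * (β - γ) * (A * waveVec ξ β j)
          * Complex.exp (Complex.I * β * (s : ℂ)) := by ring
  rw [e]
  have h1 : ‖Complex.I * γ * (A * waveVec ξ β j * Complex.exp (Complex.I * β * (s : ℂ))
            + S j * Complex.exp (Complex.I * γ * (s : ℂ)))‖
      ≤ (1 + κ') * (1 + ‖ξ‖) * (C₃ * N) := by
    rw [norm_mul, norm_mul, Complex.norm_I, one_mul]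
    gcongr
    nlinarith
  have h2 : ‖Complex.I * (β - γ) * (A * waveVec ξ β j) * Complex.exp (Complex.I * β * (s : ℂ))‖
      ≤ C₂ * (κ' + 2 * κ' ^ 2) * (1 + ‖ξ‖) * N := by
    rw [norm_mul, norm_mul (Complex.I * (β - γ)), norm_mul Complex.I, Complex.norm_I, one_mul]
    calc _ ≤ ‖β - γ‖ * (C₂ * (1 + ‖ξ‖) ^ 2 * N) * 1 := by
          gcongr
          exact hAw j
      _ = C₂ * (‖β - γ‖ * (1 + ‖ξ‖)) * (1 + ‖ξ‖) * N := by ring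
      _ ≤ _ := by gcongr
  calc _ ≤ C₄ * (1 + ‖ξ‖) * N := by
        refine (norm_add_le _ _).trans ((add_le_add h1 h2).trans_eq ?_)
        rw [hC₄]; ring
    _ ≤ _ := by gcongr; linarith

/-! ### Amplitudes of polynomial growth relative to `L²` -/

/-- `p` is measurable and bounded by `(1 + |ξ|)ⁿ h(ξ)` for some `n` and some `h ∈ L²`. -/
def PolyL2 (p : Plane → ℂ) : Prop :=
  AEStronglyMeasurable p volume ∧ ∃ (n : ℕ) (h : Plane → ℝ), MemLp h 2 volume ∧
    ∀ᵐ ξ, ‖p ξ‖ ≤ (1 + ‖ξ‖) ^ n * h ξ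

theorem PolyL2.mul_of_le {p m : Plane → ℂ} (hp : PolyL2 p) (hm : Measurable m) {C : ℝ}
    (hC : ∀ ξ, ‖m ξ‖ ≤ C * (1 + ‖ξ‖)) : PolyL2 fun ξ => m ξ * p ξ := by
  obtain ⟨hpm, n, h, hh, hb⟩ := hp
  refine ⟨hm.aestronglyMeasurable.mul hpm, n + 1, fun ξ => C * h ξ, hh.const_mul C, ?_⟩
  filter_upwards [hb] with ξ hξ
  have : 0 ≤ C * (1 + ‖ξ‖) := (norm_nonneg _).trans (hC ξ)
  calc ‖m ξ * p ξ‖ ≤ C * (1 + ‖ξ‖) * ((1 + ‖ξ‖) ^ n * h ξ) := by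
        rw [norm_mul]; exact mul_le_mul (hC ξ) hξ (norm_nonneg _) this
    _ = _ := by ring

theorem exists_pow_mul_exp_le (n : ℕ) {δ : ℝ} (hδ : 0 < δ) :
    ∃ C : ℝ, 0 ≤ C ∧ ∀ r : ℝ, 0 ≤ r → (1 + r) ^ n * Real.exp (-(δ * r)) ≤ C := by
  refine ⟨n.factorial * Real.exp δ / δ ^ n, by positivity, fun r hr => ?_⟩
  have h := Real.pow_div_factorial_le_exp (δ * (1 + r)) (by positivity) n
  rw [div_le_iff₀ (by positivity), mul_pow] at h
  rw [le_div_iff₀ (by positivity)]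
  calc (1 + r) ^ n * Real.exp (-(δ * r)) * δ ^ n
      = δ ^ n * (1 + r) ^ n * Real.exp (-(δ * r)) := by ring
    _ ≤ Real.exp (δ * (1 + r)) * n.factorial * Real.exp (-(δ * r)) := by gcongr
    _ = n.factorial * (Real.exp (δ * (1 + r)) * Real.exp (-(δ * r))) := by ring
    _ = n.factorial * Real.exp δ := by rw [← Real.exp_add]; ring_nf

theorem memLp_inv_one_add_norm_pow_three :
    MemLp (fun ξ : Plane => ((1 + ‖ξ‖) ^ 3)⁻¹) 2 volume := by
  have hc : Continuous (fun ξ : Plane => ((1 + ‖ξ‖) ^ 3)⁻¹) := by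
    refine Continuous.inv₀ (by fun_prop) fun ξ => by positivity
  refine (memLp_two_iff_integrable_sq hc.aestronglyMeasurable).2 ?_
  have := integrable_one_add_norm (E := Plane) (μ := volume) (r := 6)
    (by rw [finrank_plane]; norm_num)
  refine this.congr (.of_forall fun ξ => ?_)
  have h0 : (0 : ℝ) ≤ 1 + ‖ξ‖ := by positivity
  simp only
  rw [Real.rpow_neg h0, show (6 : ℝ) = ((6 : ℕ) : ℝ) by norm_num, Real.rpow_natCast]
  field_simp

theorem PolyL2.integrable_mul_exp {p : Plane → ℂ} (hp : PolyL2 p) {δ : ℝ} (hδ : 0 < δ) :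
    Integrable fun ξ => ‖p ξ‖ * Real.exp (-(δ * ‖ξ‖)) := by
  obtain ⟨hpm, n, h, hh, hb⟩ := hp
  obtain ⟨C, hC0, hC⟩ := exists_pow_mul_exp_le (n + 3) hδ
  have hi : Integrable fun ξ => C * (((1 + ‖ξ‖) ^ 3)⁻¹ * h ξ) :=
    (memLp_inv_one_add_norm_pow_three.integrable_mul hh).const_mul C
  refine hi.mono' (hpm.norm.mul (by fun_prop)) ?_
  filter_upwards [hb] with ξ hξ
  have h1 := hC ‖ξ‖ (norm_nonneg ξ)
  have hpos : 0 < (1 + ‖ξ‖) := by positivity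
  have hh0 : 0 ≤ h ξ := by
    by_contra hneg
    have := mul_neg_of_pos_of_neg (pow_pos hpos n) (not_le.1 hneg)
    linarith [norm_nonneg (p ξ)]
  rw [Real.norm_of_nonneg (by positivity)]
  calc ‖p ξ‖ * Real.exp (-(δ * ‖ξ‖)) ≤ (1 + ‖ξ‖) ^ n * h ξ * Real.exp (-(δ * ‖ξ‖)) := by gcongr
    _ = (1 + ‖ξ‖) ^ (n + 3) * Real.exp (-(δ * ‖ξ‖)) * (((1 + ‖ξ‖) ^ 3)⁻¹ * h ξ) := by
        field_simp; ring
    _ ≤ C * (((1 + ‖ξ‖) ^ 3)⁻¹ * h ξ) := by gcongr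

/-! ### Superpositions of plane waves -/

/-- The plane wave `e^{i(ξ·x' + β x₃)}`, where `β` is the vertical wavenumber belonging to `κ`. -/
def planeWave (κ : ℝ) (ξ : Plane) (x : Space) : ℂ :=
  Complex.exp (Complex.I * vertWave κ ξ * (x.2 : ℂ))
    * Complex.exp (Complex.I * ((inner ℝ ξ x.1 : ℝ) : ℂ))

/-- The horizontal Fourier transform at height `s` above the boundary of a superposition of plane
waves with wavenumbers `κ`, `κ'` and amplitudes `p`, `q`. -/
def mode (κ κ' : ℝ) (p q : Plane → ℂ) (ξ : Plane) (s : ℝ) : ℂ :=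
  p ξ * Complex.exp (Complex.I * vertWave κ ξ * (s : ℂ))
    + q ξ * Complex.exp (Complex.I * vertWave κ' ξ * (s : ℂ))

/-- The superposition of upward plane waves with wavenumbers `κ`, `κ'` and amplitudes `p`, `q` on
the plane `x₃ = b`. -/
def waveField (κ κ' b : ℝ) (p q : Plane → ℂ) (x : Space) : ℂ :=
  (2 * Real.pi : ℂ)⁻¹ * ∫ ξ : Plane, mode κ κ' p q ξ (x.2 - b)
    * Complex.exp (Complex.I * ((inner ℝ ξ x.1 : ℝ) : ℂ))

theorem norm_exp_I_mul_real (r : ℝ) : ‖Complex.exp (Complex.I * (r : ℂ))‖ = 1 := by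
  rw [mul_comm, Complex.norm_exp_ofReal_mul_I]

theorem norm_planeWave_le {κ : ℝ} (hκ : 0 ≤ κ) (ξ : Plane) {x : Space} {δ M : ℝ} (hδ : 0 ≤ δ)
    (h1 : δ ≤ x.2) (h2 : x.2 ≤ M) :
    ‖planeWave κ ξ x‖ ≤ Real.exp (M * κ) * Real.exp (-(δ * ‖ξ‖)) := by
  rw [planeWave, norm_mul, norm_exp_I_mul_real, mul_one, ← Real.exp_add]
  refine (norm_exp_vertWave_le hκ le_rfl (hδ.trans h1) ξ).trans (Real.exp_le_exp.2 ?_)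
  nlinarith [norm_nonneg ξ]

theorem measurable_planeWave (κ : ℝ) :
    Measurable fun z : Space × Plane => planeWave κ z.2 z.1 := by
  unfold planeWave
  have := measurable_vertWave κ
  fun_prop

theorem PolyL2.integrable_mul_planeWave {p : Plane → ℂ} (hp : PolyL2 p) {κ : ℝ} (hκ : 0 ≤ κ)
    {x : Space} (hx : 0 < x.2) : Integrable fun ξ => p ξ * planeWave κ ξ x := by
  refine ((hp.integrable_mul_exp hx).const_mul (Real.exp (x.2 * κ))).mono'
    (hp.1.mul ?_) (.of_forall fun ξ => ?_)
  · exact ((measurable_planeWave κ).comp (measurable_prodMk_left (x := x))).aestronglyMeasurable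
  · rw [norm_mul]
    calc _ ≤ ‖p ξ‖ * (Real.exp (x.2 * κ) * Real.exp (-(x.2 * ‖ξ‖))) := by
          gcongr; exact norm_planeWave_le hκ ξ hx.le le_rfl le_rfl
      _ = _ := by ring

theorem mode_mul_exp (κ κ' b : ℝ) (p q : Plane → ℂ) (ξ : Plane) (x : Space) :
    mode κ κ' p q ξ (x.2 - b) * Complex.exp (Complex.I * ((inner ℝ ξ x.1 : ℝ) : ℂ))
      = p ξ * planeWave κ ξ (x.1, x.2 - b) + q ξ * planeWave κ' ξ (x.1, x.2 - b) := by
  simp only [mode, planeWave]; ring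

theorem waveField_eq {κ κ' b : ℝ} (hκ : 0 ≤ κ) (hκ' : 0 ≤ κ') {p q : Plane → ℂ} (hp : PolyL2 p)
    (hq : PolyL2 q) {x : Space} (hx : b < x.2) :
    waveField κ κ' b p q x = (2 * Real.pi : ℂ)⁻¹ * ((∫ ξ, p ξ * planeWave κ ξ (x.1, x.2 - b))
      + ∫ ξ, q ξ * planeWave κ' ξ (x.1, x.2 - b)) := by
  simp only [waveField, mode_mul_exp]
  rw [integral_add (hp.integrable_mul_planeWave hκ (sub_pos.2 hx))
    (hq.integrable_mul_planeWave hκ' (sub_pos.2 hx))]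

theorem waveField_congr (κ κ' b : ℝ) {p p' q q' : Plane → ℂ} (hp : p =ᵐ[volume] p')
    (hq : q =ᵐ[volume] q') : waveField κ κ' b p q = waveField κ κ' b p' q' := by
  funext x
  simp only [waveField]
  congr 1
  refine integral_congr_ae ?_
  filter_upwards [hp, hq] with ξ h1 h2
  simp only [mode, h1, h2]

theorem measurable_waveField (κ κ' b : ℝ) {p q : Plane → ℂ} (hp : AEStronglyMeasurable p volume)
    (hq : AEStronglyMeasurable q volume) : Measurable (waveField κ κ' b p q) := by
  rw [waveField_congr κ κ' b hp.ae_eq_mk hq.ae_eq_mk]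
  have h1 := hp.stronglyMeasurable_mk.measurable
  have h2 := hq.stronglyMeasurable_mk.measurable
  set p' := hp.mk p
  set q' := hq.mk q
  have hv := measurable_vertWave κ
  have hv' := measurable_vertWave κ'
  have hm : Measurable fun z : Space × Plane => mode κ κ' p' q' z.2 (z.1.2 - b)
      * Complex.exp (Complex.I * ((inner ℝ z.2 z.1.1 : ℝ) : ℂ)) := by
    unfold mode
    fun_prop
  exact (hm.stronglyMeasurable.integral_prod_right' (ν := volume)).measurable.const_mul _

theorem exists_norm_waveField_le {κ κ' b : ℝ} (hκ : 0 ≤ κ) (hκ' : 0 ≤ κ') {p q : Plane → ℂ}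
    (hp : PolyL2 p) (hq : PolyL2 q) {δ M : ℝ} (hδ : 0 < δ) :
    ∃ C : ℝ, ∀ x : Space, b + δ ≤ x.2 → x.2 ≤ b + M → ‖waveField κ κ' b p q x‖ ≤ C := by
  have key : ∀ {k : ℝ} {r : Plane → ℂ}, 0 ≤ k → PolyL2 r → ∀ x : Space, b + δ ≤ x.2 → x.2 ≤ b + M →
      ‖∫ ξ, r ξ * planeWave k ξ (x.1, x.2 - b)‖
        ≤ ∫ ξ, Real.exp (M * k) * (‖r ξ‖ * Real.exp (-(δ * ‖ξ‖))) := by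
    intro k r hk hr x h1 h2
    refine norm_integral_le_of_norm_le ((hr.integrable_mul_exp hδ).const_mul _)
      (.of_forall fun ξ => ?_)
    rw [norm_mul]
    calc _ ≤ ‖r ξ‖ * (Real.exp (M * k) * Real.exp (-(δ * ‖ξ‖))) := by
          gcongr
          exact norm_planeWave_le hk ξ hδ.le (by simp; linarith) (by simp; linarith)
      _ = _ := by ring
  refine ⟨‖(2 * Real.pi : ℂ)⁻¹‖ * ((∫ ξ, Real.exp (M * κ) * (‖p ξ‖ * Real.exp (-(δ * ‖ξ‖))))
    + ∫ ξ, Real.exp (M * κ') * (‖q ξ‖ * Real.exp (-(δ * ‖ξ‖)))), fun x h1 h2 => ?_⟩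
  rw [waveField_eq hκ hκ' hp hq (by linarith), norm_mul]
  exact mul_le_mul_of_nonneg_left
    ((norm_add_le _ _).trans (add_le_add (key hκ hp x h1 h2) (key hκ' hq x h1 h2))) (norm_nonneg _)

theorem isOpen_upperHalf (b : ℝ) : IsOpen (upperHalf b) :=
  isOpen_lt continuous_const continuous_snd

theorem locallyIntegrableOn_waveField {κ κ' b : ℝ} (hκ : 0 ≤ κ) (hκ' : 0 ≤ κ') {p q : Plane → ℂ}
    (hp : PolyL2 p) (hq : PolyL2 q) :
    LocallyIntegrableOn (waveField κ κ' b p q) (upperHalf b) := by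
  intro x hx
  have hx : b < x.2 := hx
  set r := (x.2 - b) / 2 with hr
  have hr0 : 0 < r := by rw [hr]; linarith
  obtain ⟨C, hC⟩ := exists_norm_waveField_le (b := b) hκ hκ' hp hq (δ := r) (M := 3 * r) hr0
  refine ⟨Metric.ball x r, mem_nhdsWithin_of_mem_nhds (Metric.ball_mem_nhds x hr0), ?_⟩
  refine Measure.integrableOn_of_bounded (M := C) measure_ball_lt_top.ne
    (measurable_waveField κ κ' b hp.1 hq.1).aestronglyMeasurable ?_
  refine (ae_restrict_mem measurableSet_ball).mono fun y hy => ?_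
  have hy2 : |y.2 - x.2| < r := by
    have : dist y.2 x.2 ≤ dist y x := le_max_right _ _
    rw [← Real.dist_eq]; exact this.trans_lt hy
  rw [abs_lt] at hy2
  exact hC y (by linarith) (by linarith)

/-! ### Boundary values of superpositions of plane waves -/

theorem lintegral_enorm_sq_lt_top {α E : Type*} [MeasurableSpace α] [NormedAddCommGroup E]
    {μ : Measure α} {f : α → E} (hf : MemLp f 2 μ) : ∫⁻ x, ‖f x‖ₑ ^ 2 ∂μ < ⊤ := by
  have h : Integrable (fun x => ‖f x‖ ^ 2) μ := hf.integrable_norm_pow (by norm_num)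
  have := h.2
  rw [hasFiniteIntegral_iff_enorm] at this
  simpa using this

theorem mode_zero (κ κ' : ℝ) (p q : Plane → ℂ) (ξ : Plane) : mode κ κ' p q ξ 0 = p ξ + q ξ := by
  simp [mode]

theorem continuous_mode (κ κ' : ℝ) (p q : Plane → ℂ) (ξ : Plane) :
    Continuous (mode κ κ' p q ξ) := by
  unfold mode; fun_prop

theorem aestronglyMeasurable_mode (κ κ' : ℝ) {p q : Plane → ℂ}
    (hp : AEStronglyMeasurable p volume) (hq : AEStronglyMeasurable q volume) (s : ℝ) :
    AEStronglyMeasurable (fun ξ => mode κ κ' p q ξ s) volume := by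
  have hv := measurable_vertWave κ
  have hv' := measurable_vertWave κ'
  have h1 : Measurable fun ξ => Complex.exp (Complex.I * vertWave κ ξ * (s : ℂ)) := by fun_prop
  have h2 : Measurable fun ξ => Complex.exp (Complex.I * vertWave κ' ξ * (s : ℂ)) := by fun_prop
  exact (hp.mul h1.aestronglyMeasurable).add (hq.mul h2.aestronglyMeasurable)

theorem integrable_mode {κ κ' : ℝ} (hκ : 0 ≤ κ) (hκ' : 0 ≤ κ') {p q : Plane → ℂ} (hp : PolyL2 p)
    (hq : PolyL2 q) {s : ℝ} (hs : 0 < s) : Integrable (fun ξ => mode κ κ' p q ξ s) := by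
  have h1 := hp.integrable_mul_planeWave hκ (x := (0, s)) hs
  have h2 := hq.integrable_mul_planeWave hκ' (x := (0, s)) hs
  refine (h1.add h2).congr (.of_forall fun ξ => ?_)
  simp [mode, planeWave]

/-- On each horizontal plane above the boundary, a superposition of plane waves is the inverse
Fourier transform of its mode. -/
theorem ae_eq_waveField {κ κ' : ℝ} (b : ℝ) (hκ : 0 ≤ κ) (hκ' : 0 ≤ κ') {p q : Plane → ℂ}
    (hp : PolyL2 p) (hq : PolyL2 q) {s : ℝ} (hs : 0 < s) {W : Lp (α := Plane) ℂ 2 volume}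
    (hW : hat W =ᵐ[volume] fun ξ => mode κ κ' p q ξ s) :
    W =ᵐ[volume] fun x' => waveField κ κ' b p q (x', b + s) := by
  filter_upwards [ae_eq_integral_of_hat hW (integrable_mode hκ hκ' hp hq hs)] with x' hx
  rw [hx]
  simp only [waveField, add_sub_cancel_left]

theorem hasGraphTrace_waveField {κ κ' b : ℝ} (hκ : 0 ≤ κ) (hκ' : 0 ≤ κ') {p q : Plane → ℂ}
    (hp : PolyL2 p) (hq : PolyL2 q) {h : Plane → ℝ} (hh : MemLp h 2 volume)
    (hb : ∀ᵐ ξ, ∀ s : ℝ, 0 ≤ s → s ≤ 1 → ‖mode κ κ' p q ξ s‖ ≤ h ξ)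
    {V : Lp (α := Plane) ℂ 2 volume} (hV : hat V =ᵐ[volume] fun ξ => p ξ + q ξ)
    {w : Space → ℂ} (hw : ∀ᵐ x ∂(volume.restrict (upperHalf b)), w x = waveField κ κ' b p q x) :
    HasGraphTrace (fun _ => b) w V := by
  have hmeas := aestronglyMeasurable_mode κ κ' hp.1 hq.1
  set H : ℝ → ℝ≥0∞ := fun s => ∫⁻ ξ, ‖mode κ κ' p q ξ s - mode κ κ' p q ξ 0‖ₑ ^ 2 with hH
  have hslice : ∀ s : ℝ, 0 < s → s ≤ 1 →
      ∫⁻ x', ‖waveField κ κ' b p q (x', b + s) - V x'‖ₑ ^ 2 = H s := by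
    intro s hs hs1
    have hL2 : MemLp (fun ξ => mode κ κ' p q ξ s) 2 volume :=
      hh.mono' (hmeas s) (hb.mono fun ξ hξ => hξ s hs.le hs1)
    obtain ⟨W, hW⟩ := exists_hat_eq hL2
    have e1 : ∫⁻ x', ‖waveField κ κ' b p q (x', b + s) - V x'‖ₑ ^ 2
        = ∫⁻ x', ‖(W - V : Lp (α := Plane) ℂ 2 volume) x'‖ₑ ^ 2 := by
      refine lintegral_congr_ae ?_
      filter_upwards [ae_eq_waveField b hκ hκ' hp hq hs hW, Lp.coeFn_sub W V] with x' h1 h2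
      rw [h2, Pi.sub_apply, h1]
    rw [e1, lintegral_enorm_sq_eq_hat]
    refine lintegral_congr_ae ?_
    filter_upwards [hat_sub W V, hW, hV] with ξ h1 h2 h3
    rw [h1, h2, h3, mode_zero]
  have hlim : Tendsto H (𝓝[>] 0) (𝓝 0) := by
    have h0 : (0 : ℝ≥0∞) = ∫⁻ _ : Plane, 0 := by simp
    rw [h0, hH]
    refine tendsto_lintegral_filter_of_dominated_convergence' (fun ξ => ‖2 * h ξ‖ₑ ^ 2)
      (.of_forall fun s => ((hmeas s).sub (hmeas 0)).enorm.pow_const 2) ?_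
      (lintegral_enorm_sq_lt_top (hh.const_mul 2)).ne ?_
    · have : ∀ᶠ s : ℝ in 𝓝[>] 0, s ∈ Set.Ioo (0 : ℝ) 1 := Ioo_mem_nhdsGT one_pos
      filter_upwards [this] with s hs
      filter_upwards [hb] with ξ hξ
      refine pow_le_pow_left₀ zero_le (enorm_le_iff_norm_le.2 ?_) 2
      refine (norm_sub_le _ _).trans ((add_le_add (hξ s hs.1.le hs.2.le)
        (hξ 0 le_rfl zero_le_one)).trans ?_)
      rw [← two_mul]
      exact le_abs_self _
    · refine .of_forall fun ξ => ?_
      have hc : Continuous fun s => ‖mode κ κ' p q ξ s - mode κ κ' p q ξ 0‖ₑ ^ 2 := by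
        have := continuous_mode κ κ' p q ξ
        exact ENNReal.continuous_pow 2 |>.comp (this.sub continuous_const).enorm
      have := hc.tendsto 0
      simp only [sub_self, enorm_zero, ne_eq, OfNat.ofNat_ne_zero, not_false_eq_true,
        zero_pow] at this
      exact this.mono_left nhdsWithin_le_nhds
  refine ⟨Lp.aestronglyMeasurable V, fun K _ => ?_⟩
  rw [ENNReal.tendsto_nhds_zero] at hlim ⊢
  intro ε hε
  obtain ⟨t₀, ht₀, hsub⟩ := mem_nhdsGT_iff_exists_Ioo_subset.1 (hlim ε hε)
  have ht₀ : (0 : ℝ) < t₀ := ht₀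
  have : ∀ᶠ t : ℝ in 𝓝[>] 0, t ∈ Set.Ioo 0 (min t₀ 1) := Ioo_mem_nhdsGT (lt_min ht₀ one_pos)
  filter_upwards [this] with t ht
  have ht1 : t < t₀ := ht.2.trans_le (min_le_left _ _)
  have ht2 : t < 1 := ht.2.trans_le (min_le_right _ _)
  refine ENNReal.div_le_of_le_mul ?_
  have hsubset : {x : Space | x.1 ∈ K ∧ b < x.2 ∧ x.2 < b + t}
      ⊆ (Set.univ : Set Plane) ×ˢ Set.Ioo b (b + t) := fun x hx => ⟨trivial, hx.2⟩
  have hsubset' : (Set.univ : Set Plane) ×ˢ Set.Ioo b (b + t) ⊆ upperHalf b := fun x hx => hx.2.1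
  have hF := measurable_waveField κ κ' b hp.1 hq.1
  have hm : Measurable fun x : Space => ‖waveField κ κ' b p q x - V x.1‖ₑ ^ 2 :=
    ((hF.sub ((Lp.stronglyMeasurable V).measurable.comp measurable_fst)).enorm).pow_const 2
  calc ∫⁻ x in {x : Space | x.1 ∈ K ∧ b < x.2 ∧ x.2 < b + t}, ‖w x - V x.1‖ₑ ^ 2
      ≤ ∫⁻ x in (Set.univ : Set Plane) ×ˢ Set.Ioo b (b + t), ‖w x - V x.1‖ₑ ^ 2 :=
        lintegral_mono_set hsubset
    _ = ∫⁻ x in (Set.univ : Set Plane) ×ˢ Set.Ioo b (b + t),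
          ‖waveField κ κ' b p q x - V x.1‖ₑ ^ 2 := by
        refine lintegral_congr_ae ?_
        filter_upwards [ae_restrict_of_ae_restrict_of_subset hsubset' hw] with x hx
        rw [hx]
    _ = ∫⁻ y in Set.Ioo b (b + t), ∫⁻ x', ‖waveField κ κ' b p q (x', y) - V x'‖ₑ ^ 2 := by
        rw [Measure.volume_eq_prod, setLIntegral_prod_symm _ hm.aemeasurable]
        simp only [Measure.restrict_univ]
    _ ≤ ∫⁻ _ in Set.Ioo b (b + t), ε := by
        refine setLIntegral_mono measurable_const fun y hy => ?_
        have := hslice (y - b) (by linarith [hy.1]) (by linarith [hy.2])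
        rw [add_sub_cancel] at this
        rw [this]
        exact hsub ⟨by linarith [hy.1], by linarith [hy.2]⟩
    _ = ε * ENNReal.ofReal t := by
        rw [setLIntegral_const, Real.volume_Ioo, add_sub_cancel_left]

instance isAddHaarMeasure_space : (volume : Measure Space).IsAddHaarMeasure :=
  inferInstanceAs ((volume : Measure Plane).prod (volume : Measure ℝ)).IsAddHaarMeasure

/-! ### Weak derivatives of superpositions of plane waves -/

theorem planeWave_eq_exp (κ : ℝ) (ξ : Plane) (x : Space) :
    planeWave κ ξ x
      = Complex.exp (Complex.I * (vertWave κ ξ * (x.2 : ℂ) + ((inner ℝ ξ x.1 : ℝ) : ℂ))) := by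
  rw [planeWave, ← Complex.exp_add]; ring_nf

/-- The phase `ξ·x' + β x₃` of a plane wave, as a real-linear map. -/
def phase (κ : ℝ) (ξ : Plane) : Space →L[ℝ] ℂ :=
  vertWave κ ξ • (Complex.ofRealCLM ∘L ContinuousLinearMap.snd ℝ Plane ℝ)
    + Complex.ofRealCLM ∘L innerSL ℝ ξ ∘L ContinuousLinearMap.fst ℝ Plane ℝ

theorem phase_apply (κ : ℝ) (ξ : Plane) (x : Space) :
    phase κ ξ x = vertWave κ ξ * (x.2 : ℂ) + ((inner ℝ ξ x.1 : ℝ) : ℂ) := by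
  simp [phase]

theorem phase_dir (κ : ℝ) (ξ : Plane) (k : Fin 3) :
    phase κ ξ (dir k) = waveVec ξ (vertWave κ ξ) k := by
  fin_cases k <;> simp [phase_apply, dir, waveVec, EuclideanSpace.inner_single_right]

theorem hasFDerivAt_planeWave (κ : ℝ) (ξ : Plane) (x : Space) :
    HasFDerivAt (planeWave κ ξ) (planeWave κ ξ x • (Complex.I • phase κ ξ)) x := by
  have h := ((Complex.I • phase κ ξ).hasFDerivAt (x := x)).cexp
  refine (h.congr_of_eventuallyEq (.of_forall fun y => ?_)).congr_fderiv ?_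
  · simp [planeWave_eq_exp, phase_apply]
  · simp [planeWave_eq_exp, phase_apply]

theorem continuous_planeWave (κ : ℝ) (ξ : Plane) : Continuous (planeWave κ ξ) :=
  continuous_iff_continuousAt.2 fun x => (hasFDerivAt_planeWave κ ξ x).continuousAt

theorem fderiv_ofReal_comp {E : Type*} [NormedAddCommGroup E] [NormedSpace ℝ E] {φ : E → ℝ} {x : E}
    (hφ : DifferentiableAt ℝ φ x) (v : E) :
    fderiv ℝ (fun y => ((φ y : ℝ) : ℂ)) x v = ((fderiv ℝ φ x v : ℝ) : ℂ) := by
  have h : HasFDerivAt (fun y => ((φ y : ℝ) : ℂ)) (Complex.ofRealCLM ∘L fderiv ℝ φ x) x :=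
    Complex.ofRealCLM.hasFDerivAt.comp x hφ.hasFDerivAt
  rw [h.fderiv]; rfl

theorem ofReal_fderiv_apply_test {E : Type*} [NormedAddCommGroup E] [NormedSpace ℝ E] {φ : E → ℝ}
    (hφ : ContDiff ℝ 1 φ) (hc : HasCompactSupport φ) (v : E) :
    Continuous (fun x => ((fderiv ℝ φ x v : ℝ) : ℂ)) ∧
      HasCompactSupport (fun x => ((fderiv ℝ φ x v : ℝ) : ℂ)) ∧
      tsupport (fun x => ((fderiv ℝ φ x v : ℝ) : ℂ)) ⊆ tsupport φ :=
  ⟨Complex.continuous_ofReal.comp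
      ((hφ.continuous_fderiv one_ne_zero).clm_apply continuous_const),
    (hc.fderiv_apply (𝕜 := ℝ) v).comp_left Complex.ofReal_zero,
    (tsupport_comp_subset Complex.ofReal_zero _).trans (tsupport_fderiv_apply_subset ℝ v)⟩

theorem ofReal_comp_test {E : Type*} [NormedAddCommGroup E] [NormedSpace ℝ E] {φ : E → ℝ}
    (hφ : ContDiff ℝ 1 φ) (hc : HasCompactSupport φ) :
    Continuous (fun x => ((φ x : ℝ) : ℂ)) ∧ HasCompactSupport (fun x => ((φ x : ℝ) : ℂ)) ∧
      tsupport (fun x => ((φ x : ℝ) : ℂ)) ⊆ tsupport φ :=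
  ⟨Complex.continuous_ofReal.comp hφ.continuous, hc.comp_left Complex.ofReal_zero,
    tsupport_comp_subset Complex.ofReal_zero φ⟩

theorem integral_planeWave_mul_fderiv (κ : ℝ) (ξ : Plane) {φ : Space → ℝ} (hφ : ContDiff ℝ 1 φ)
    (hc : HasCompactSupport φ) (k : Fin 3) :
    ∫ x, planeWave κ ξ x * ((fderiv ℝ φ x (dir k) : ℝ) : ℂ)
      = - ∫ x, Complex.I * waveVec ξ (vertWave κ ξ) k * planeWave κ ξ x * ((φ x : ℝ) : ℂ) := by
  have hd := hφ.differentiable one_ne_zero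
  have hcont := continuous_planeWave κ ξ
  obtain ⟨hφ'cont, hφ'c, hφ's⟩ := ofReal_fderiv_apply_test hφ hc (dir k)
  obtain ⟨hφcont, hφc, -⟩ := ofReal_comp_test hφ hc
  have e1 : ∀ x, fderiv ℝ (planeWave κ ξ) x (dir k)
      = Complex.I * waveVec ξ (vertWave κ ξ) k * planeWave κ ξ x := fun x => by
    rw [(hasFDerivAt_planeWave κ ξ x).fderiv]
    simp only [FunLike.coe_smul, Pi.smul_apply, phase_dir, smul_eq_mul]
    ring
  have e2 : ∀ x, fderiv ℝ (fun y => ((φ y : ℝ) : ℂ)) x (dir k)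
      = ((fderiv ℝ φ x (dir k) : ℝ) : ℂ) := fun x => fderiv_ofReal_comp (hd x) _
  have := integral_mul_fderiv_eq_neg_fderiv_mul_of_integrable (μ := (volume : Measure Space))
    (f := planeWave κ ξ) (g := fun y => ((φ y : ℝ) : ℂ)) (v := dir k) ?_ ?_ ?_
    (fun x _ => (hasFDerivAt_planeWave κ ξ x).differentiableAt)
    (fun x _ => Complex.ofRealCLM.differentiableAt.comp x (hd x))
  · simpa only [e1, e2] using this
  · simp only [e1]
    exact ((continuous_const.mul hcont).mul hφcont).integrable_of_hasCompactSupport hφc.mul_left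
  · simp only [e2]
    exact (hcont.mul hφ'cont).integrable_of_hasCompactSupport hφ'c.mul_left
  · exact (hcont.mul hφcont).integrable_of_hasCompactSupport hφc.mul_left

theorem exists_height_bounds {b : ℝ} {K : Set Space} (hK : IsCompact K) (hKb : K ⊆ upperHalf b) :
    ∃ δ M : ℝ, 0 < δ ∧ ∀ x ∈ K, b + δ ≤ x.2 ∧ x.2 ≤ b + M := by
  rcases K.eq_empty_or_nonempty with rfl | hne
  · exact ⟨1, 0, one_pos, by simp⟩
  obtain ⟨y, hy, hmin⟩ := hK.exists_isMinOn hne continuous_snd.continuousOn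
  obtain ⟨z, hz, hmax⟩ := hK.exists_isMaxOn hne continuous_snd.continuousOn
  have hyb : b < y.2 := hKb hy
  refine ⟨y.2 - b, z.2 - b, sub_pos.2 hyb, fun x hx => ⟨?_, ?_⟩⟩
  · rw [add_sub_cancel]; exact hmin hx
  · rw [add_sub_cancel]; exact hmax hx

theorem integrable_prod_planeWave {κ b : ℝ} (hκ : 0 ≤ κ) {p : Plane → ℂ} (hp : PolyL2 p)
    {ψ : Space → ℂ} (hψ : Continuous ψ) (hc : HasCompactSupport ψ)
    (hs : tsupport ψ ⊆ upperHalf b) :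
    Integrable (fun z : Space × Plane => p z.2 * planeWave κ z.2 (z.1.1, z.1.2 - b) * ψ z.1)
      (volume.prod volume) := by
  obtain ⟨δ, M, hδ, hK⟩ := exists_height_bounds (K := tsupport ψ) hc hs
  have hi : Integrable (fun x => ‖ψ x‖) (volume : Measure Space) :=
    (hψ.integrable_of_hasCompactSupport hc).norm
  refine ((hi.const_mul (Real.exp (M * κ))).mul_prod (hp.integrable_mul_exp hδ)).mono' ?_
    (.of_forall fun z => ?_)
  · have h1 : Measurable fun z : Space × Plane => planeWave κ z.2 (z.1.1, z.1.2 - b) :=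
      (measurable_planeWave κ).comp (by fun_prop : Measurable fun z : Space × Plane =>
        (((z.1.1, z.1.2 - b), z.2) : Space × Plane))
    exact (hp.1.comp_snd.mul h1.aestronglyMeasurable).mul
      (hψ.comp continuous_fst).aestronglyMeasurable
  · by_cases hz : z.1 ∈ tsupport ψ
    · obtain ⟨h1, h2⟩ := hK _ hz
      rw [norm_mul, norm_mul]
      calc _ ≤ ‖p z.2‖ * (Real.exp (M * κ) * Real.exp (-(δ * ‖z.2‖))) * ‖ψ z.1‖ := by
            gcongr
            exact norm_planeWave_le hκ z.2 hδ.le (by simp; linarith) (by simp; linarith)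
        _ = _ := by ring
    · rw [image_eq_zero_of_notMem_tsupport hz]; simp

theorem measurable_waveVec_vertWave (κ : ℝ) (k : Fin 3) :
    Measurable fun ξ => waveVec ξ (vertWave κ ξ) k := by
  have := measurable_vertWave κ
  fin_cases k <;> simp only [waveVec] <;> simp <;> fun_prop

theorem PolyL2.mul_waveVec {κ : ℝ} (hκ : 0 ≤ κ) {p : Plane → ℂ} (hp : PolyL2 p) (k : Fin 3) :
    PolyL2 fun ξ => Complex.I * waveVec ξ (vertWave κ ξ) k * p ξ := by
  refine hp.mul_of_le ((measurable_waveVec_vertWave κ k).const_mul _) (C := 1 + κ) fun ξ => ?_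
  rw [norm_mul, Complex.norm_I, one_mul]
  exact norm_waveVec_le hκ (norm_vertWave_le hκ ξ) k

theorem integral_superposition_mul_fderiv {κ b : ℝ} (hκ : 0 ≤ κ) {p : Plane → ℂ} (hp : PolyL2 p)
    {φ : Space → ℝ} (hφ : ContDiff ℝ 1 φ) (hc : HasCompactSupport φ)
    (hs : tsupport φ ⊆ upperHalf b) (k : Fin 3) :
    ∫ x : Space, (∫ ξ, p ξ * planeWave κ ξ (x.1, x.2 - b)) * ((fderiv ℝ φ x (dir k) : ℝ) : ℂ)
      = - ∫ x : Space, (∫ ξ, Complex.I * waveVec ξ (vertWave κ ξ) k * p ξ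
          * planeWave κ ξ (x.1, x.2 - b)) * ((φ x : ℝ) : ℂ) := by
  obtain ⟨hφcont, hφc, hφs⟩ := ofReal_comp_test hφ hc
  obtain ⟨hφ'cont, hφ'c, hφ's⟩ := ofReal_fderiv_apply_test hφ hc (dir k)
  have i1 := integrable_prod_planeWave hκ hp hφ'cont hφ'c (hφ's.trans hs)
  have i2 := integrable_prod_planeWave hκ (hp.mul_waveVec hκ k) hφcont hφc (hφs.trans hs)
  simp_rw [← integral_mul_const]
  refine (integral_integral_swap i1).trans
    (Eq.trans ?_ (congrArg Neg.neg (integral_integral_swap i2)).symm)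
  rw [← integral_neg]
  refine integral_congr_ae (.of_forall fun ξ => ?_)
  have hshift : ∀ x : Space, planeWave κ ξ (x.1, x.2 - b)
      = Complex.exp (-(Complex.I * vertWave κ ξ * (b : ℂ))) * planeWave κ ξ x := fun x => by
    rw [planeWave_eq_exp, planeWave_eq_exp, ← Complex.exp_add]
    congr 1
    push_cast
    ring
  have := integral_planeWave_mul_fderiv κ ξ hφ hc k
  set c := Complex.exp (-(Complex.I * vertWave κ ξ * (b : ℂ)))
  calc ∫ x : Space, p ξ * planeWave κ ξ (x.1, x.2 - b) * ((fderiv ℝ φ x (dir k) : ℝ) : ℂ)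
      = ∫ x : Space, (p ξ * c) * (planeWave κ ξ x * ((fderiv ℝ φ x (dir k) : ℝ) : ℂ)) := by
        refine integral_congr_ae (.of_forall fun x => ?_)
        simp only [hshift]; ring
    _ = - ∫ x : Space, (p ξ * c) * (Complex.I * waveVec ξ (vertWave κ ξ) k * planeWave κ ξ x
          * ((φ x : ℝ) : ℂ)) := by
        rw [integral_const_mul, this, integral_const_mul, mul_neg]
    _ = _ := by
        congr 1
        refine integral_congr_ae (.of_forall fun x => ?_)
        simp only [hshift]; ring

theorem integrable_superposition_mul {κ b : ℝ} (hκ : 0 ≤ κ) {p : Plane → ℂ} (hp : PolyL2 p)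
    {ψ : Space → ℂ} (hψ : Continuous ψ) (hc : HasCompactSupport ψ)
    (hs : tsupport ψ ⊆ upperHalf b) :
    Integrable (fun x : Space => (∫ ξ, p ξ * planeWave κ ξ (x.1, x.2 - b)) * ψ x) := by
  have := (integrable_prod_planeWave hκ hp hψ hc hs).integral_prod_left
  simpa only [integral_mul_const] using this

/-- A superposition of plane waves is weakly differentiable, and may be differentiated under the
integral sign. -/
theorem integral_waveField_mul_fderiv {κ κ' b : ℝ} (hκ : 0 ≤ κ) (hκ' : 0 ≤ κ') {p q : Plane → ℂ}
    (hp : PolyL2 p) (hq : PolyL2 q) {φ : Space → ℝ} (hφ : ContDiff ℝ 1 φ)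
    (hc : HasCompactSupport φ) (hs : tsupport φ ⊆ upperHalf b) (k : Fin 3) :
    ∫ x in upperHalf b, waveField κ κ' b p q x * ((fderiv ℝ φ x (dir k) : ℝ) : ℂ)
      = - ∫ x in upperHalf b, waveField κ κ' b
          (fun ξ => Complex.I * waveVec ξ (vertWave κ ξ) k * p ξ)
          (fun ξ => Complex.I * waveVec ξ (vertWave κ' ξ) k * q ξ) x * ((φ x : ℝ) : ℂ) := by
  have key : ∀ {p q : Plane → ℂ}, PolyL2 p → PolyL2 q → ∀ {ψ : Space → ℂ}, Continuous ψ →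
      HasCompactSupport ψ → tsupport ψ ⊆ upperHalf b →
      ∫ x in upperHalf b, waveField κ κ' b p q x * ψ x
        = (2 * Real.pi : ℂ)⁻¹ * ((∫ x : Space, (∫ ξ, p ξ * planeWave κ ξ (x.1, x.2 - b)) * ψ x)
          + ∫ x : Space, (∫ ξ, q ξ * planeWave κ' ξ (x.1, x.2 - b)) * ψ x) := by
    intro p q hp hq ψ hψ hc hs
    rw [← integral_add (integrable_superposition_mul hκ hp hψ hc hs)
      (integrable_superposition_mul hκ' hq hψ hc hs), ← integral_const_mul]
    refine Eq.trans (setIntegral_congr_fun (isOpen_upperHalf b).measurableSet fun x hx => ?_)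
      (setIntegral_eq_integral_of_forall_compl_eq_zero fun x hx => ?_)
    · simp only [waveField_eq hκ hκ' hp hq hx]
      ring
    · rw [image_eq_zero_of_notMem_tsupport fun h => hx (hs h)]; simp
  obtain ⟨hφcont, hφc, hφs⟩ := ofReal_comp_test hφ hc
  obtain ⟨hφ'cont, hφ'c, hφ's⟩ := ofReal_fderiv_apply_test hφ hc (dir k)
  rw [key hp hq hφ'cont hφ'c (hφ's.trans hs),
    key (hp.mul_waveVec hκ k) (hq.mul_waveVec hκ' k) hφcont hφc (hφs.trans hs),
    integral_superposition_mul_fderiv hκ hp hφ hc hs, integral_superposition_mul_fderiv hκ' hq hφ hc hs]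
  ring

/-! ### Pointwise identities for the Rellich integrand -/

theorem conj_energyForm (lam mu : ℝ) (P : Fin 3 → Fin 3 → ℂ) :
    conj (energyForm lam mu P (star P)) = energyForm lam mu P (star P) := by
  simp only [energyForm, divergence, curl, dotProduct, Fin.sum_univ_three, Matrix.cons_val,
    Pi.star_apply, RCLike.star_def, map_add, map_sub, map_mul, Complex.conj_conj,
    Complex.conj_ofReal, map_ofNat]
  ring

/-- The Rellich integrand as a complex expression without real parts. -/
theorem ofReal_rellichIntegrand (lam mu om : ℝ) (ν : Fin 3 → ℝ) (w : Fin 3 → ℂ)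
    (P : Fin 3 → Fin 3 → ℂ) :
    ((rellichIntegrand lam mu om ν w P : ℝ) : ℂ)
      = (∑ j, traction lam mu ν P j * conj (P 2 j)) + (∑ j, conj (traction lam mu ν P j) * P 2 j)
        - ν 2 * energyForm lam mu P (star P) + (om : ℂ) ^ 2 * ∑ j, w j * conj (w j) := by
  have h1 : (((traction lam mu ν P ⬝ᵥ star (P 2)).re : ℝ) : ℂ) * 2
      = (∑ j, traction lam mu ν P j * conj (P 2 j))
        + ∑ j, conj (traction lam mu ν P j) * P 2 j := by
    have : (∑ j, conj (traction lam mu ν P j) * P 2 j)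
        = conj (∑ j, traction lam mu ν P j * conj (P 2 j)) := by
      rw [map_sum]
      exact Finset.sum_congr rfl fun j _ => by rw [map_mul, Complex.conj_conj]
    rw [this, Complex.add_conj]
    simp only [dotProduct, Pi.star_apply, RCLike.star_def]
    push_cast
    ring
  have h2 : (((energyForm lam mu P (star P)).re : ℝ) : ℂ) = energyForm lam mu P (star P) :=
    Complex.conj_eq_iff_re.1 (conj_energyForm lam mu P)
  have h3 : ((normSq3 w : ℝ) : ℂ) = ∑ j, w j * conj (w j) := by
    simp only [normSq3, Complex.mul_conj']
    push_cast
    rfl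
  rw [rellichIntegrand]
  push_cast
  rw [h2, h3, ← h1]
  ring

/-- If the gradient is `ν ⊗ g` with a unit vector `ν` and the field vanishes, then the Rellich
integrand is `ν₃ (μ |∂_ν u|² + (λ + μ) |∇·u|²)`. -/
theorem rellichIntegrand_of_tangential_zero (lam mu om : ℝ) {ν : Fin 3 → ℝ}
    (hν : ν 0 ^ 2 + ν 1 ^ 2 + ν 2 ^ 2 = 1) {P : Fin 3 → Fin 3 → ℂ} {g : Fin 3 → ℂ}
    (hP : ∀ k j, P k j = ν k * g j) :
    rellichIntegrand lam mu om ν 0 P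
      = mu * normSq3 (normalDeriv ν P) * ν 2 + (lam + mu) * ‖divergence P‖ ^ 2 * ν 2 := by
  apply Complex.ofReal_injective
  have hνc : (ν 0 : ℂ) ^ 2 + (ν 1 : ℂ) ^ 2 + (ν 2 : ℂ) ^ 2 = 1 := by exact_mod_cast hν
  rw [ofReal_rellichIntegrand]
  have hP' : P = fun k j => ν k * g j := by funext k j; exact hP k j
  subst hP'
  simp only [normSq3]
  push_cast
  simp only [← Complex.mul_conj', traction, energyForm, divergence, curl, normalDeriv, dotProduct,
    Fin.sum_univ_three, Matrix.cons_val, cross_apply, Pi.add_apply, Pi.smul_apply, smul_eq_mul,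
    Pi.star_apply, RCLike.star_def, map_add, map_sub, map_mul, Complex.conj_ofReal, map_ofNat,
    Pi.zero_apply, map_zero]
  generalize conj (g 0) = h0
  generalize conj (g 1) = h1
  generalize conj (g 2) = h2
  grind

/-- The polynomial identity behind the conservation of the Rellich form: `b`, `c` are the two
vertical wavenumbers, `e`, `d` and `A'`, `T` stand for the conjugates of `b`, `c`, `A`, `S`. All
terms that mix `A` and `S` cancel. -/
theorem rellich_polynomial_identity {l m o x y b c d e A A' : ℂ} {S T : Fin 3 → ℂ}
    {P Q : Fin 3 → Fin 3 → ℂ} (he : e ^ 2 = b ^ 2) (hd : d ^ 2 = c ^ 2)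
    (h1 : o = (l + 2 * m) * (x ^ 2 + y ^ 2 + b ^ 2)) (h2 : o = m * (x ^ 2 + y ^ 2 + c ^ 2))
    (hS : x * S 0 + y * S 1 + c * S 2 = 0) (hT : x * T 0 + y * T 1 + d * T 2 = 0)
    (hP : ∀ k j, P k j = A * ![x, y, b] k * ![x, y, b] j + ![x, y, c] k * S j)
    (hQ : ∀ k j, Q k j = A' * ![x, y, e] k * ![x, y, e] j + ![x, y, d] k * T j) :
    ((2 * m * P 2 0 - m * (P 2 0 - P 0 2)) * Q 2 0 + (2 * m * P 2 1 - m * (P 2 1 - P 1 2)) * Q 2 1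
      + (2 * m * P 2 2 + l * (P 0 0 + P 1 1 + P 2 2)) * Q 2 2)
    + ((2 * m * Q 2 0 - m * (Q 2 0 - Q 0 2)) * P 2 0 + (2 * m * Q 2 1 - m * (Q 2 1 - Q 1 2)) * P 2 1
      + (2 * m * Q 2 2 + l * (Q 0 0 + Q 1 1 + Q 2 2)) * P 2 2)
    - (2 * m * (P 0 0 * Q 0 0 + P 0 1 * Q 0 1 + P 0 2 * Q 0 2 + P 1 0 * Q 1 0 + P 1 1 * Q 1 1
        + P 1 2 * Q 1 2 + P 2 0 * Q 2 0 + P 2 1 * Q 2 1 + P 2 2 * Q 2 2)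
      + l * (P 0 0 + P 1 1 + P 2 2) * (Q 0 0 + Q 1 1 + Q 2 2)
      - m * ((P 1 2 - P 2 1) * (Q 1 2 - Q 2 1) + (P 2 0 - P 0 2) * (Q 2 0 - Q 0 2)
        + (P 0 1 - P 1 0) * (Q 0 1 - Q 1 0)))
    + o * ((A * x + S 0) * (A' * x + T 0) + (A * y + S 1) * (A' * y + T 1)
      + (A * b + S 2) * (A' * e + T 2))
    = o * b * (b + e) * A * A' + m * c * (c + d) * (S 0 * T 0 + S 1 * T 1 + S 2 * T 2) := by
  simp only [hP, hQ, Matrix.cons_val]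
  generalize S 0 = S0 at *
  generalize S 1 = S1 at *
  generalize S 2 = S2 at *
  generalize T 0 = T0 at *
  generalize T 1 = T1 at *
  generalize T 2 = T2 at *
  clear hP hQ
  grind

/-- The analogue of `rellich_polynomial_identity` for the energy flux. -/
theorem flux_polynomial_identity {l m o x y b c d e A A' : ℂ} {S T : Fin 3 → ℂ}
    {P Q : Fin 3 → Fin 3 → ℂ} (he : e ^ 2 = b ^ 2) (hd : d ^ 2 = c ^ 2)
    (h1 : o = (l + 2 * m) * (x ^ 2 + y ^ 2 + b ^ 2)) (h2 : o = m * (x ^ 2 + y ^ 2 + c ^ 2))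
    (hS : x * S 0 + y * S 1 + c * S 2 = 0) (hT : x * T 0 + y * T 1 + d * T 2 = 0)
    (hP : ∀ k j, P k j = A * ![x, y, b] k * ![x, y, b] j + ![x, y, c] k * S j)
    (hQ : ∀ k j, Q k j = A' * ![x, y, e] k * ![x, y, e] j + ![x, y, d] k * T j) :
    ((2 * m * P 2 0 - m * (P 2 0 - P 0 2)) * (A' * x + T 0)
      + (2 * m * P 2 1 - m * (P 2 1 - P 1 2)) * (A' * y + T 1)
      + (2 * m * P 2 2 + l * (P 0 0 + P 1 1 + P 2 2)) * (A' * e + T 2))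
    + ((2 * m * Q 2 0 - m * (Q 2 0 - Q 0 2)) * (A * x + S 0)
      + (2 * m * Q 2 1 - m * (Q 2 1 - Q 1 2)) * (A * y + S 1)
      + (2 * m * Q 2 2 + l * (Q 0 0 + Q 1 1 + Q 2 2)) * (A * b + S 2))
    = o * (b + e) * A * A' + m * (c + d) * (S 0 * T 0 + S 1 * T 1 + S 2 * T 2) := by
  simp only [hP, hQ, Matrix.cons_val]
  generalize S 0 = S0 at *
  generalize S 1 = S1 at *
  generalize S 2 = S2 at *
  generalize T 0 = T0 at *
  generalize T 1 = T1 at *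
  generalize T 2 = T2 at *
  clear hP hQ
  grind

theorem conj_waveVec (ξ : Plane) (z : ℂ) (k : Fin 3) :
    conj (waveVec ξ z k) = waveVec ξ (conj z) k := by
  fin_cases k <;> simp [waveVec]

theorem vertWave_add_conj {κ : ℝ} (ξ : Plane) :
    vertWave κ ξ + conj (vertWave κ ξ)
      = 2 * ((if ‖ξ‖ < κ then (vertWave κ ξ).re else 0 : ℝ) : ℂ) := by
  split_ifs with h
  · rw [Complex.add_conj]; push_cast; ring
  · rw [conj_vertWave_of_le (not_lt.1 h)]; simp

theorem vertWave_mul_add_conj {κ : ℝ} (ξ : Plane) :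
    vertWave κ ξ * (vertWave κ ξ + conj (vertWave κ ξ))
      = 2 * ((if ‖ξ‖ < κ then (vertWave κ ξ).re ^ 2 else 0 : ℝ) : ℂ) := by
  rw [vertWave_add_conj]
  split_ifs with h
  · rw [vertWave_of_lt h, Complex.ofReal_re]; push_cast; ring
  · simp

/-- The Fourier transform of the gradient of the field with amplitudes `A`, `S`, at the boundary. -/
def modeGrad (κ κ' : ℝ) (ξ : Plane) (A : ℂ) (S : Fin 3 → ℂ) (k j : Fin 3) : ℂ :=
  Complex.I * waveVec ξ (vertWave κ ξ) k * (A * waveVec ξ (vertWave κ ξ) j)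
    + Complex.I * waveVec ξ (vertWave κ' ξ) k * S j

theorem vertWave_relations {κ : ℝ} (hκ : 0 ≤ κ) (ξ : Plane) :
    (ξ 0 : ℂ) ^ 2 + (ξ 1 : ℂ) ^ 2 + vertWave κ ξ ^ 2 = (κ : ℂ) ^ 2 ∧
      conj (vertWave κ ξ) ^ 2 = vertWave κ ξ ^ 2 := by
  constructor
  · rw [vertWave_sq hκ, ← norm_sq_plane]; push_cast; ring
  · rw [← map_pow, vertWave_sq hκ, Complex.conj_ofReal]

/-- For a single mode the Rellich form only sees the propagating part. -/
theorem rellichIntegrand_modeGrad {lam mu om κ κ' : ℝ} (hκ : 0 ≤ κ) (hκ' : 0 ≤ κ')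
    (h1 : om ^ 2 = (lam + 2 * mu) * κ ^ 2) (h2 : om ^ 2 = mu * κ' ^ 2) {ξ : Plane} {A : ℂ}
    {S : Fin 3 → ℂ} (hS : waveVec ξ (vertWave κ' ξ) ⬝ᵥ S = 0) :
    rellichIntegrand lam mu om ![0, 0, 1] (fun j => A * waveVec ξ (vertWave κ ξ) j + S j)
        (modeGrad κ κ' ξ A S)
      = 2 * (om ^ 2 * ((if ‖ξ‖ < κ then (vertWave κ ξ).re ^ 2 else 0) * ‖A‖ ^ 2)
        + mu * ((if ‖ξ‖ < κ' then (vertWave κ' ξ).re ^ 2 else 0) * normSq3 S)) := by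
  obtain ⟨r1, r2⟩ := vertWave_relations hκ ξ
  obtain ⟨r3, r4⟩ := vertWave_relations hκ' ξ
  have hS' := congrArg conj hS
  simp only [dotProduct, Fin.sum_univ_three, map_add, map_mul, conj_waveVec, map_zero] at hS hS'
  have k1 : (om : ℂ) ^ 2 = (lam + 2 * mu) * ((ξ 0 : ℂ) ^ 2 + (ξ 1 : ℂ) ^ 2 + vertWave κ ξ ^ 2) := by
    rw [r1]; exact_mod_cast h1
  have k2 : (om : ℂ) ^ 2 = mu * ((ξ 0 : ℂ) ^ 2 + (ξ 1 : ℂ) ^ 2 + vertWave κ' ξ ^ 2) := by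
    rw [r3]; exact_mod_cast h2
  have key := rellich_polynomial_identity (A := A) (A' := conj A) (S := S)
    (T := fun j => conj (S j)) r2 r4 k1 k2 hS hS' (fun k j => rfl) (fun k j => rfl)
  have f1 := vertWave_mul_add_conj (κ := κ) ξ
  have f2 := vertWave_mul_add_conj (κ := κ') ξ
  apply Complex.ofReal_injective
  rw [ofReal_rellichIntegrand]
  simp only [Complex.ofReal_mul, Complex.ofReal_add, normSq3, Complex.ofReal_sum,
    Complex.ofReal_pow, ← Complex.mul_conj', Complex.ofReal_ofNat]
  simp only [Fin.sum_univ_three]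
  rw [show (2 : ℂ) * ((om : ℂ) ^ 2 * (((if ‖ξ‖ < κ then (vertWave κ ξ).re ^ 2 else 0 : ℝ) : ℂ)
        * (A * conj A)) + mu * (((if ‖ξ‖ < κ' then (vertWave κ' ξ).re ^ 2 else 0 : ℝ) : ℂ)
        * (S 0 * conj (S 0) + S 1 * conj (S 1) + S 2 * conj (S 2))))
      = (om : ℂ) ^ 2 * vertWave κ ξ * (vertWave κ ξ + conj (vertWave κ ξ)) * A * conj A
        + mu * vertWave κ' ξ * (vertWave κ' ξ + conj (vertWave κ' ξ))
          * (S 0 * conj (S 0) + S 1 * conj (S 1) + S 2 * conj (S 2)) by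
    linear_combination -(om : ℂ) ^ 2 * A * conj A * f1
      - mu * (S 0 * conj (S 0) + S 1 * conj (S 1) + S 2 * conj (S 2)) * f2, ← key]
  simp only [modeGrad, traction, energyForm, divergence, curl, normalDeriv, dotProduct,
    Fin.sum_univ_three, Matrix.cons_val, cross_apply, Pi.add_apply, Pi.smul_apply, smul_eq_mul,
    Pi.star_apply, RCLike.star_def, map_add, map_sub, map_mul, Complex.conj_ofReal, map_ofNat,
    Complex.conj_I, waveVec, Complex.ofReal_zero, Complex.ofReal_one, map_zero, map_one]
  ring_nf
  simp only [Complex.I_sq]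
  ring

/-- For a single mode only the propagating part carries energy upwards. -/
theorem traction_modeGrad_im {lam mu om κ κ' : ℝ} (hκ : 0 ≤ κ) (hκ' : 0 ≤ κ')
    (h1 : om ^ 2 = (lam + 2 * mu) * κ ^ 2) (h2 : om ^ 2 = mu * κ' ^ 2) {ξ : Plane} {A : ℂ}
    {S : Fin 3 → ℂ} (hS : waveVec ξ (vertWave κ' ξ) ⬝ᵥ S = 0) :
    (∑ j, traction lam mu ![0, 0, 1] (modeGrad κ κ' ξ A S) j
        * conj (A * waveVec ξ (vertWave κ ξ) j + S j)).im
      = om ^ 2 * ((if ‖ξ‖ < κ then (vertWave κ ξ).re else 0) * ‖A‖ ^ 2)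
        + mu * ((if ‖ξ‖ < κ' then (vertWave κ' ξ).re else 0) * normSq3 S) := by
  obtain ⟨r1, r2⟩ := vertWave_relations hκ ξ
  obtain ⟨r3, r4⟩ := vertWave_relations hκ' ξ
  have hS' := congrArg conj hS
  simp only [dotProduct, Fin.sum_univ_three, map_add, map_mul, conj_waveVec, map_zero] at hS hS'
  have k1 : (om : ℂ) ^ 2 = (lam + 2 * mu) * ((ξ 0 : ℂ) ^ 2 + (ξ 1 : ℂ) ^ 2 + vertWave κ ξ ^ 2) := by
    rw [r1]; exact_mod_cast h1
  have k2 : (om : ℂ) ^ 2 = mu * ((ξ 0 : ℂ) ^ 2 + (ξ 1 : ℂ) ^ 2 + vertWave κ' ξ ^ 2) := by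
    rw [r3]; exact_mod_cast h2
  have key := flux_polynomial_identity (A := A) (A' := conj A) (S := S)
    (T := fun j => conj (S j)) r2 r4 k1 k2 hS hS' (fun k j => rfl) (fun k j => rfl)
  have f1 := vertWave_add_conj (κ := κ) ξ
  have f2 := vertWave_add_conj (κ := κ') ξ
  have him : ∀ z : ℂ, (z.im : ℂ) = -Complex.I / 2 * (z - conj z) := fun z => by
    rw [Complex.sub_conj]
    push_cast
    linear_combination (z.im : ℂ) * Complex.I_sq
  apply Complex.ofReal_injective
  rw [him]
  simp only [Complex.ofReal_mul, Complex.ofReal_add, normSq3, Complex.ofReal_sum,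
    Complex.ofReal_pow, ← Complex.mul_conj']
  simp only [Fin.sum_univ_three]
  rw [show (om : ℂ) ^ 2 * (((if ‖ξ‖ < κ then (vertWave κ ξ).re else 0 : ℝ) : ℂ)
        * (A * conj A)) + mu * (((if ‖ξ‖ < κ' then (vertWave κ' ξ).re else 0 : ℝ) : ℂ)
        * (S 0 * conj (S 0) + S 1 * conj (S 1) + S 2 * conj (S 2)))
      = 1 / 2 * ((om : ℂ) ^ 2 * (vertWave κ ξ + conj (vertWave κ ξ)) * A * conj A
        + mu * (vertWave κ' ξ + conj (vertWave κ' ξ))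
          * (S 0 * conj (S 0) + S 1 * conj (S 1) + S 2 * conj (S 2))) by
    linear_combination -(1 / 2) * (om : ℂ) ^ 2 * A * conj A * f1
      - 1 / 2 * mu * (S 0 * conj (S 0) + S 1 * conj (S 1) + S 2 * conj (S 2)) * f2, ← key]
  simp only [modeGrad, traction, divergence, curl, normalDeriv,
    Fin.sum_univ_three, Matrix.cons_val, cross_apply, Pi.add_apply, Pi.smul_apply, smul_eq_mul,
    map_add, map_sub, map_mul, Complex.conj_ofReal, map_ofNat,
    Complex.conj_I, waveVec, Complex.ofReal_zero, Complex.ofReal_one, map_zero, map_one,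
    Complex.conj_conj]
  ring_nf
  simp only [Complex.I_sq]
  ring

/-! ### Parseval's identity for the Rellich form and the energy flux -/

/-- `a` is an `L²` function with Fourier transform `A`. -/
def L2Pair (a A : Plane → ℂ) : Prop :=
  ∃ V : Lp (α := Plane) ℂ 2 volume, V =ᵐ[volume] a ∧ hat V =ᵐ[volume] A

theorem L2Pair.add {a A c D : Plane → ℂ} (h : L2Pair a A) (h' : L2Pair c D) :
    L2Pair (fun x => a x + c x) (fun x => A x + D x) := by
  obtain ⟨V, h1, h2⟩ := h
  obtain ⟨W, h3, h4⟩ := h'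
  refine ⟨V + W, ?_, ?_⟩
  · filter_upwards [Lp.coeFn_add V W, h1, h3] with x e1 e2 e3
    rw [e1, Pi.add_apply, e2, e3]
  · filter_upwards [hat_add V W, h2, h4] with x e1 e2 e3
    rw [e1, e2, e3]

theorem L2Pair.const_mul {a A : Plane → ℂ} (h : L2Pair a A) (z : ℂ) :
    L2Pair (fun x => z * a x) (fun x => z * A x) := by
  obtain ⟨V, h1, h2⟩ := h
  refine ⟨z • V, ?_, ?_⟩
  · filter_upwards [Lp.coeFn_smul z V, h1] with x e1 e2
    rw [e1, Pi.smul_apply, e2, smul_eq_mul]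
  · filter_upwards [hat_smul z V, h2] with x e1 e2
    rw [e1, e2]

theorem L2Pair.sub {a A c D : Plane → ℂ} (h : L2Pair a A) (h' : L2Pair c D) :
    L2Pair (fun x => a x - c x) (fun x => A x - D x) := by
  simpa only [neg_one_mul, ← sub_eq_add_neg] using h.add (h'.const_mul (-1))

/-- Two integrable functions with the same integral. -/
def ParsevalPair (F G : Plane → ℂ) : Prop :=
  Integrable F ∧ Integrable G ∧ ∫ x, F x = ∫ x, G x

theorem ParsevalPair.add {F G F' G' : Plane → ℂ} (h : ParsevalPair F G) (h' : ParsevalPair F' G') :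
    ParsevalPair (fun x => F x + F' x) (fun x => G x + G' x) :=
  ⟨h.1.add h'.1, h.2.1.add h'.2.1, by
    rw [integral_add h.1 h'.1, integral_add h.2.1 h'.2.1, h.2.2, h'.2.2]⟩

theorem ParsevalPair.const_mul {F G : Plane → ℂ} (h : ParsevalPair F G) (z : ℂ) :
    ParsevalPair (fun x => z * F x) (fun x => z * G x) :=
  ⟨h.1.const_mul z, h.2.1.const_mul z, by rw [integral_const_mul, integral_const_mul, h.2.2]⟩

theorem ParsevalPair.sub {F G F' G' : Plane → ℂ} (h : ParsevalPair F G) (h' : ParsevalPair F' G') :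
    ParsevalPair (fun x => F x - F' x) (fun x => G x - G' x) := by
  simpa only [neg_one_mul, ← sub_eq_add_neg] using h.add (h'.const_mul (-1))

theorem ParsevalPair.sum {ι : Type*} {s : Finset ι} {F G : ι → Plane → ℂ}
    (h : ∀ i ∈ s, ParsevalPair (F i) (G i)) :
    ParsevalPair (fun x => ∑ i ∈ s, F i x) (fun x => ∑ i ∈ s, G i x) :=
  ⟨integrable_finsetSum _ fun i hi => (h i hi).1, integrable_finsetSum _ fun i hi => (h i hi).2.1, by
    rw [integral_finsetSum _ fun i hi => (h i hi).1, integral_finsetSum _ fun i hi => (h i hi).2.1]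
    exact Finset.sum_congr rfl fun i hi => (h i hi).2.2⟩

theorem L2Pair.mul_conj {a A c D : Plane → ℂ} (h : L2Pair a A) (h' : L2Pair c D) :
    ParsevalPair (fun x => a x * conj (c x)) (fun x => A x * conj (D x)) := by
  obtain ⟨V, h1, h2⟩ := h
  obtain ⟨W, h3, h4⟩ := h'
  have e1 : (fun x => V x * conj (W x)) =ᵐ[volume] fun x => a x * conj (c x) := by
    filter_upwards [h1, h3] with x e1 e2
    rw [e1, e2]
  have e2 : (fun x => hat V x * conj (hat W x)) =ᵐ[volume] fun x => A x * conj (D x) := by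
    filter_upwards [h2, h4] with x e1 e2
    rw [e1, e2]
  have hm : ∀ f g : Plane → ℂ, MemLp f 2 volume → MemLp g 2 volume →
      Integrable fun x => f x * conj (g x) := fun f g hf hg => hf.integrable_mul hg.star
  exact ⟨(hm _ _ (Lp.memLp V) (Lp.memLp W)).congr e1, (hm _ _ (memLp_hat V) (memLp_hat W)).congr e2,
    by rw [← integral_congr_ae e1, ← integral_congr_ae e2, integral_mul_conj_eq_hat]⟩

theorem traction_vertical (lam mu : ℝ) (P : Fin 3 → Fin 3 → ℂ) :
    traction lam mu ![0, 0, 1] P = ![mu * (P 2 0 + P 0 2), mu * (P 2 1 + P 1 2),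
      2 * mu * P 2 2 + lam * (P 0 0 + P 1 1 + P 2 2)] := by
  funext j
  fin_cases j <;>
  · simp [traction, normalDeriv, divergence, curl, cross_apply, Fin.sum_univ_three]
    try ring

theorem l2Pair_divergence {G H : Plane → Fin 3 → Fin 3 → ℂ}
    (hG : ∀ k j, L2Pair (fun x => G x k j) (fun ξ => H ξ k j)) :
    L2Pair (fun x => divergence (G x)) (fun ξ => divergence (H ξ)) := by
  simp only [divergence, Fin.sum_univ_three]
  exact ((hG 0 0).add (hG 1 1)).add (hG 2 2)

theorem l2Pair_curl {G H : Plane → Fin 3 → Fin 3 → ℂ}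
    (hG : ∀ k j, L2Pair (fun x => G x k j) (fun ξ => H ξ k j)) (j : Fin 3) :
    L2Pair (fun x => curl (G x) j) (fun ξ => curl (H ξ) j) := by
  fin_cases j
  · exact (hG 1 2).sub (hG 2 1)
  · exact (hG 2 0).sub (hG 0 2)
  · exact (hG 0 1).sub (hG 1 0)

theorem l2Pair_traction {G H : Plane → Fin 3 → Fin 3 → ℂ}
    (hG : ∀ k j, L2Pair (fun x => G x k j) (fun ξ => H ξ k j)) (lam mu : ℝ) (j : Fin 3) :
    L2Pair (fun x => traction lam mu ![0, 0, 1] (G x) j)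
      (fun ξ => traction lam mu ![0, 0, 1] (H ξ) j) := by
  simp only [traction_vertical]
  fin_cases j
  · exact ((hG 2 0).add (hG 0 2)).const_mul _
  · exact ((hG 2 1).add (hG 1 2)).const_mul _
  · exact ((hG 2 2).const_mul _).add ((((hG 0 0).add (hG 1 1)).add (hG 2 2)).const_mul _)

/-- Parseval's identity for the energy flux through a horizontal plane. -/
theorem parsevalPair_flux {G H : Plane → Fin 3 → Fin 3 → ℂ}
    (hG : ∀ k j, L2Pair (fun x => G x k j) (fun ξ => H ξ k j)) {v w : Plane → Fin 3 → ℂ}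
    (hv : ∀ j, L2Pair (fun x => v x j) (fun ξ => w ξ j)) (lam mu : ℝ) :
    ParsevalPair (fun x => ∑ j, traction lam mu ![0, 0, 1] (G x) j * conj (v x j))
      (fun ξ => ∑ j, traction lam mu ![0, 0, 1] (H ξ) j * conj (w ξ j)) :=
  ParsevalPair.sum fun j _ => (l2Pair_traction hG lam mu j).mul_conj (hv j)

/-- Parseval's identity for the Rellich form on a horizontal plane. -/
theorem parsevalPair_rellichIntegrand {G H : Plane → Fin 3 → Fin 3 → ℂ}
    (hG : ∀ k j, L2Pair (fun x => G x k j) (fun ξ => H ξ k j)) {v w : Plane → Fin 3 → ℂ}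
    (hv : ∀ j, L2Pair (fun x => v x j) (fun ξ => w ξ j)) (lam mu om : ℝ) :
    ParsevalPair (fun x => ((rellichIntegrand lam mu om ![0, 0, 1] (v x) (G x) : ℝ) : ℂ))
      (fun ξ => ((rellichIntegrand lam mu om ![0, 0, 1] (w ξ) (H ξ) : ℝ) : ℂ)) := by
  have hE : ∀ P : Fin 3 → Fin 3 → ℂ, energyForm lam mu P (star P)
      = 2 * mu * (∑ j, ∑ k, P k j * conj (P k j)) + lam * (divergence P * conj (divergence P))
        - mu * ∑ j, curl P j * conj (curl P j) := fun P => by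
    simp only [energyForm, divergence, curl, dotProduct, Fin.sum_univ_three, Matrix.cons_val,
      Pi.star_apply, RCLike.star_def, map_add, map_sub]
    ring
  simp only [ofReal_rellichIntegrand, hE, mul_comm (conj _)]
  refine ((ParsevalPair.add ?_ ?_).sub ?_).add ?_
  · exact .sum fun j _ => (l2Pair_traction hG lam mu j).mul_conj (hG 2 j)
  · exact .sum fun j _ => (hG 2 j).mul_conj (l2Pair_traction hG lam mu j)
  · refine ParsevalPair.const_mul (((ParsevalPair.const_mul ?_ _).add
      (ParsevalPair.const_mul ?_ _)).sub (ParsevalPair.const_mul ?_ _)) _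
    · exact .sum fun j _ => .sum fun k _ => (hG k j).mul_conj (hG k j)
    · exact (l2Pair_divergence hG).mul_conj (l2Pair_divergence hG)
    · exact .sum fun j _ => (l2Pair_curl hG j).mul_conj (l2Pair_curl hG j)
  · exact ParsevalPair.const_mul (.sum fun j _ => (hv j).mul_conj (hv j)) _

/-! ### The upward angular spectrum representation -/

theorem LocallyIntegrableOn.congr_ae {s : Set Space} {f g : Space → ℂ}
    (hf : LocallyIntegrableOn f s) (h : ∀ᵐ x ∂(volume.restrict s), g x = f x) :
    LocallyIntegrableOn g s := by
  intro x hx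
  obtain ⟨U, hU, hi⟩ := hf x hx
  refine ⟨U ∩ s, inter_mem hU self_mem_nhdsWithin, ?_⟩
  refine (hi.mono_set Set.inter_subset_left).congr ?_
  have := ae_restrict_of_ae_restrict_of_subset (Set.inter_subset_right (s := U)) h
  exact this.mono fun y hy => hy.symm

/-- `|v̂(ξ)|` in the `ℓ¹`-norm. -/
def hatNorm (v : Fin 3 → Lp (α := Plane) ℂ 2 volume) (ξ : Plane) : ℝ := ∑ i, ‖hat (v i) ξ‖

theorem memLp_hatNorm (v : Fin 3 → Lp (α := Plane) ℂ 2 volume) : MemLp (hatNorm v) 2 volume :=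
  memLp_finsetSum _ fun i _ => (memLp_hat (v i)).norm

theorem TraceInH1.memLp {v : Fin 3 → Lp (α := Plane) ℂ 2 volume} (h : TraceInH1 v) :
    MemLp (fun ξ => (1 + ‖ξ‖) * hatNorm v ξ) 2 volume := by
  have h1 : MemLp (fun ξ => ∑ i, ‖(‖ξ‖ : ℂ) * hat (v i) ξ‖) 2 volume :=
    memLp_finsetSum _ fun i _ => (h i).norm
  refine ((memLp_hatNorm v).add h1).ae_eq (.of_forall fun ξ => ?_)
  simp only [Pi.add_apply, hatNorm, norm_mul, Complex.norm_real, norm_norm, ← Finset.mul_sum]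
  ring

section

variable {lam mu om : ℝ}

theorem kappaP_pos (hmu : 0 < mu) (hlam : 0 < lam + 2 * mu / 3) (hom : 0 < om) :
    0 < kappaP lam mu om :=
  div_pos hom (Real.sqrt_pos.2 (by linarith))

theorem kappaP_le_kappaS (hmu : 0 < mu) (hlam : 0 < lam + 2 * mu / 3) (hom : 0 < om) :
    kappaP lam mu om ≤ kappaS mu om := by
  unfold kappaP kappaS
  gcongr
  linarith

theorem sq_eq_mul_kappaP_sq (hmu : 0 < mu) (hlam : 0 < lam + 2 * mu / 3) :
    om ^ 2 = (lam + 2 * mu) * kappaP lam mu om ^ 2 := by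
  have h : 0 < lam + 2 * mu := by linarith
  rw [kappaP, div_pow, Real.sq_sqrt h.le]
  field_simp

theorem sq_eq_mul_kappaS_sq (hmu : 0 < mu) : om ^ 2 = mu * kappaS mu om ^ 2 := by
  rw [kappaS, div_pow, Real.sq_sqrt hmu.le]
  field_simp

variable {b : ℝ} {u : Space → Fin 3 → ℂ} {v : Fin 3 → Lp (α := Plane) ℂ 2 volume} {Ap : Plane → ℂ}
  {As : Plane → Fin 3 → ℂ}

theorem UpwardASR.aestronglyMeasurable (hκ : 0 < kappaP lam mu om)
    (hκκ : kappaP lam mu om ≤ kappaS mu om) (h : UpwardASR lam mu om b u v Ap As) :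
    AEStronglyMeasurable Ap volume ∧ ∀ j, AEStronglyMeasurable (fun ξ => As ξ j) volume := by
  have hm : ∀ j, AEMeasurable (hat (v j)) volume := fun j => (memLp_hat (v j)).1.aemeasurable
  have hA : AEMeasurable Ap volume := by
    have hmeas : AEMeasurable (fun ξ : Plane =>
        (∑ j, waveVec ξ (vertWave (kappaS mu om) ξ) j * hat (v j) ξ)
        / (((‖ξ‖ ^ 2 : ℝ) : ℂ) + vertWave (kappaP lam mu om) ξ * vertWave (kappaS mu om) ξ))
        volume := by
      refine AEMeasurable.div (Finset.aemeasurable_fun_sum _ fun j _ =>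
        (measurable_waveVec_vertWave _ j).aemeasurable.mul (hm j)) (Measurable.aemeasurable ?_)
      have := measurable_vertWave (kappaP lam mu om)
      have := measurable_vertWave (kappaS mu om)
      fun_prop
    refine hmeas.congr ?_
    filter_upwards [h.hat_eq, h.orthogonal] with ξ h1 h2
    have e := amplitude_mul_det h1 h2
    have hD := sq_le_norm_det hκ.le hκκ ξ
    have hD0 : ((‖ξ‖ ^ 2 : ℝ) : ℂ) + vertWave (kappaP lam mu om) ξ * vertWave (kappaS mu om) ξ ≠ 0 :=
      norm_pos_iff.1 ((pow_pos hκ 2).trans_le hD)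
    rw [div_eq_iff hD0]
    exact e.symm
  refine ⟨hA.aestronglyMeasurable, fun j => AEMeasurable.aestronglyMeasurable ?_⟩
  refine ((hm j).sub (hA.mul
    (measurable_waveVec_vertWave (kappaP lam mu om) j).aemeasurable)).congr ?_
  filter_upwards [h.hat_eq] with ξ h1
  rw [Pi.sub_apply, h1 j]
  exact add_sub_cancel_left _ _

/-- The amplitudes of a UASR satisfy the bounds of `exists_amplitude_bounds` almost everywhere. -/
theorem UpwardASR.exists_bounds (hκ : 0 < kappaP lam mu om)
    (hκκ : kappaP lam mu om ≤ kappaS mu om) (h : UpwardASR lam mu om b u v Ap As) :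
    ∃ C : ℝ, 0 ≤ C ∧ ∀ᵐ ξ, ‖Ap ξ‖ ≤ C * (1 + ‖ξ‖) * hatNorm v ξ ∧
      ∀ j, ‖Ap ξ * waveVec ξ (vertWave (kappaP lam mu om) ξ) j‖
          ≤ C * (1 + ‖ξ‖) ^ 2 * hatNorm v ξ ∧
        ‖As ξ j‖ ≤ C * (1 + ‖ξ‖) ^ 2 * hatNorm v ξ ∧
        ∀ s : ℝ, 0 ≤ s → s ≤ 1 →
          ‖mode (kappaP lam mu om) (kappaS mu om)
              (fun ξ => Ap ξ * waveVec ξ (vertWave (kappaP lam mu om) ξ) j) (fun ξ => As ξ j) ξ s‖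
            ≤ C * hatNorm v ξ ∧
          ‖mode (kappaP lam mu om) (kappaS mu om)
              (fun ξ => Complex.I * vertWave (kappaP lam mu om) ξ
                * (Ap ξ * waveVec ξ (vertWave (kappaP lam mu om) ξ) j))
              (fun ξ => Complex.I * vertWave (kappaS mu om) ξ * As ξ j) ξ s‖
            ≤ C * (1 + ‖ξ‖) * hatNorm v ξ := by
  obtain ⟨C, hC0, hC⟩ := exists_amplitude_bounds hκ hκκ
  refine ⟨C, hC0, ?_⟩
  filter_upwards [h.hat_eq, h.orthogonal] with ξ h1 h2
  exact hC ξ (Ap ξ) (fun j => hat (v j) ξ) (As ξ) h1 h2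

theorem UpwardASR.polyL2 (hκ : 0 < kappaP lam mu om)
    (hκκ : kappaP lam mu om ≤ kappaS mu om) (h : UpwardASR lam mu om b u v Ap As) (j : Fin 3) :
    PolyL2 (fun ξ => Ap ξ * waveVec ξ (vertWave (kappaP lam mu om) ξ) j) ∧
      PolyL2 (fun ξ => As ξ j) := by
  obtain ⟨C, hC0, hC⟩ := h.exists_bounds hκ hκκ
  obtain ⟨m1, m2⟩ := h.aestronglyMeasurable hκ hκκ
  refine ⟨⟨m1.mul (measurable_waveVec_vertWave _ j).aestronglyMeasurable, 2,
    fun ξ => C * hatNorm v ξ, (memLp_hatNorm v).const_mul C, ?_⟩,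
    ⟨m2 j, 2, fun ξ => C * hatNorm v ξ, (memLp_hatNorm v).const_mul C, ?_⟩⟩
  · filter_upwards [hC] with ξ hξ
    exact (hξ.2 j).1.trans_eq (by ring)
  · filter_upwards [hC] with ξ hξ
    exact (hξ.2 j).2.1.trans_eq (by ring)

theorem UpwardASR.ae_eq_waveField (h : UpwardASR lam mu om b u v Ap As) (j : Fin 3) :
    ∀ᵐ x ∂(volume.restrict (upperHalf b)), u x j = waveField (kappaP lam mu om) (kappaS mu om) b
      (fun ξ => Ap ξ * waveVec ξ (vertWave (kappaP lam mu om) ξ) j) (fun ξ => As ξ j) x := by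
  filter_upwards [h.representation] with x hx
  exact hx j

/-- A UASR above `x₃ = c` restricts to a UASR above any higher plane; there the evanescent modes
are damped exponentially, so the boundary value is in `H¹`. -/
theorem UpwardASR.shift {c : ℝ} (hκ : 0 < kappaP lam mu om)
    (hκκ : kappaP lam mu om ≤ kappaS mu om) (h : UpwardASR lam mu om c u v Ap As) (hcb : c < b) :
    ∃ v' : Fin 3 → Lp (α := Plane) ℂ 2 volume, TraceInH1 v' ∧ UpwardASR lam mu om b u v'
      (fun ξ => Ap ξ * Complex.exp (Complex.I * beta lam mu om ξ * ((b - c : ℝ) : ℂ)))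
      (fun ξ j => As ξ j * Complex.exp (Complex.I * gamma mu om ξ * ((b - c : ℝ) : ℂ))) := by
  set κ := kappaP lam mu om with hκdef
  set κ' := kappaS mu om with hκ'def
  have hκ' : 0 < κ' := hκ.trans_le hκκ
  have hs : 0 < b - c := sub_pos.2 hcb
  set E : ℝ → Plane → ℂ := fun k ξ => Complex.exp (Complex.I * vertWave k ξ * ((b - c : ℝ) : ℂ))
    with hE
  have hEm : ∀ k, Measurable (E k) := fun k => by
    have := measurable_vertWave k
    rw [hE]; fun_prop
  obtain ⟨C, hC0, hC⟩ := h.exists_bounds hκ hκκ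
  obtain ⟨C', hC'0, hC'⟩ := exists_pow_mul_exp_le 3 hs
  obtain ⟨m1, m2⟩ := h.aestronglyMeasurable hκ hκκ
  -- the damped amplitudes
  set p : Fin 3 → Plane → ℂ := fun j ξ => Ap ξ * E κ ξ * waveVec ξ (vertWave κ ξ) j with hp
  set q : Fin 3 → Plane → ℂ := fun j ξ => As ξ j * E κ' ξ with hq
  set M : ℝ := C * (Real.exp ((b - c) * κ') * C') with hM
  have hM0 : 0 ≤ M := by positivity
  have hpm : ∀ j, AEStronglyMeasurable (p j) volume := fun j =>
    (m1.mul (hEm κ).aestronglyMeasurable).mul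
      (measurable_waveVec_vertWave _ j).aestronglyMeasurable
  have hqm : ∀ j, AEStronglyMeasurable (q j) volume := fun j =>
    (m2 j).mul (hEm κ').aestronglyMeasurable
  have hdamp : ∀ k, 0 ≤ k → k ≤ κ' → ∀ ξ (z : ℂ), ‖z‖ ≤ C * (1 + ‖ξ‖) ^ 2 * hatNorm v ξ →
      (1 + ‖ξ‖) * ‖z * E k ξ‖ ≤ M * hatNorm v ξ := by
    intro k hk hkκ ξ z hz
    have h0 : 0 ≤ hatNorm v ξ := Finset.sum_nonneg fun i _ => norm_nonneg _
    have h1 := norm_exp_vertWave_le hk hkκ hs.le ξ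
    have h2 : Real.exp ((b - c) * (κ' - ‖ξ‖))
        = Real.exp ((b - c) * κ') * Real.exp (-((b - c) * ‖ξ‖)) := by
      rw [← Real.exp_add]; ring_nf
    have h3 := hC' ‖ξ‖ (norm_nonneg ξ)
    rw [norm_mul]
    calc (1 + ‖ξ‖) * (‖z‖ * ‖E k ξ‖) ≤ (1 + ‖ξ‖) * (C * (1 + ‖ξ‖) ^ 2 * hatNorm v ξ
          * (Real.exp ((b - c) * κ') * Real.exp (-((b - c) * ‖ξ‖)))) := by
          rw [← h2]; gcongr
      _ = C * (Real.exp ((b - c) * κ') * ((1 + ‖ξ‖) ^ 3 * Real.exp (-((b - c) * ‖ξ‖))))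
          * hatNorm v ξ := by ring
      _ ≤ M * hatNorm v ξ := by rw [hM]; gcongr
  have hpb : ∀ᵐ ξ, ∀ j, (1 + ‖ξ‖) * ‖p j ξ‖ ≤ M * hatNorm v ξ ∧
      (1 + ‖ξ‖) * ‖q j ξ‖ ≤ M * hatNorm v ξ := by
    filter_upwards [hC] with ξ hξ j
    refine ⟨?_, hdamp κ' hκ'.le le_rfl ξ _ (hξ.2 j).2.1⟩
    have := hdamp κ hκ.le hκκ ξ _ (hξ.2 j).1
    rwa [show Ap ξ * waveVec ξ (vertWave κ ξ) j * E κ ξ = p j ξ by rw [hp]; ring] at this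
  have hle : ∀ ξ (z : ℂ), (1 + ‖ξ‖) * ‖z‖ ≤ M * hatNorm v ξ → ‖z‖ ≤ M * hatNorm v ξ :=
    fun ξ z hz => by nlinarith [norm_nonneg ξ, norm_nonneg z]
  have hNM := (memLp_hatNorm v).const_mul M
  have hN2 := (memLp_hatNorm v).const_mul (2 * M)
  have hpP : ∀ j, PolyL2 (p j) := fun j => ⟨hpm j, 0, _, hNM, by
    filter_upwards [hpb] with ξ hξ
    rw [pow_zero, one_mul]; exact hle ξ _ (hξ j).1⟩
  have hqP : ∀ j, PolyL2 (q j) := fun j => ⟨hqm j, 0, _, hNM, by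
    filter_upwards [hpb] with ξ hξ
    rw [pow_zero, one_mul]; exact hle ξ _ (hξ j).2⟩
  have hsum : ∀ᵐ ξ, ∀ j, (1 + ‖ξ‖) * ‖p j ξ + q j ξ‖ ≤ 2 * M * hatNorm v ξ := by
    filter_upwards [hpb] with ξ hξ j
    have := norm_add_le (p j ξ) (q j ξ)
    nlinarith [hξ j, norm_nonneg ξ]
  have hV : ∀ j, ∃ V : Lp (α := Plane) ℂ 2 volume, hat V =ᵐ[volume] fun ξ => p j ξ + q j ξ :=
    fun j => exists_hat_eq <| hN2.mono' ((hpm j).add (hqm j)) <| by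
      filter_upwards [hsum] with ξ hξ
      nlinarith [hξ j, norm_nonneg ξ, norm_nonneg (p j ξ + q j ξ)]
  choose v' hv' using hV
  refine ⟨v', fun j => ?_, ?_⟩
  · refine hN2.mono' ((Complex.continuous_ofReal.comp continuous_norm).aestronglyMeasurable.mul
      (memLp_hat (v' j)).1) ?_
    filter_upwards [hsum, hv' j] with ξ hξ he
    rw [he, norm_mul, Complex.norm_real, norm_norm]
    nlinarith [hξ j, norm_nonneg (p j ξ + q j ξ)]
  have hrep : ∀ᵐ x ∂(volume.restrict (upperHalf b)), ∀ j,
      u x j = waveField κ κ' b (p j) (q j) x := by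
    have hsub : upperHalf b ⊆ upperHalf c := fun x hx => hcb.trans hx
    filter_upwards [ae_restrict_of_ae_restrict_of_subset hsub h.representation] with x hx j
    refine (hx j).trans ?_
    simp only [waveField]
    congr 1
    refine integral_congr_ae (.of_forall fun ξ => ?_)
    have e : ∀ k, Complex.exp (Complex.I * vertWave k ξ * ((x.2 - c : ℝ) : ℂ))
        = E k ξ * Complex.exp (Complex.I * vertWave k ξ * ((x.2 - b : ℝ) : ℂ)) := fun k => by
      rw [hE, ← Complex.exp_add]
      congr 1
      push_cast
      ring
    simp only [mode, beta, gamma, ← hκdef, ← hκ'def, e, hp, hq]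
    ring
  refine ⟨fun j => ?_, ?_, ?_, ?_⟩
  · refine hasGraphTrace_waveField hκ.le hκ'.le (hpP j) (hqP j) hN2 ?_ (hv' j)
      (hrep.mono fun x hx => hx j)
    filter_upwards [hpb] with ξ hξ s hs0 _
    have h1 := hle ξ _ (hξ j).1
    have h2 := hle ξ _ (hξ j).2
    have e1 := norm_exp_vertWave_le_one κ hs0 ξ
    have e2 := norm_exp_vertWave_le_one κ' hs0 ξ
    have n1 := (norm_mul_le (p j ξ) _).trans (mul_le_of_le_one_right (norm_nonneg (p j ξ)) e1)
    have n2 := (norm_mul_le (q j ξ) _).trans (mul_le_of_le_one_right (norm_nonneg (q j ξ)) e2)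
    exact (norm_add_le _ _).trans
      ((add_le_add (n1.trans h1) (n2.trans h2)).trans_eq (by ring))
  · rw [ae_all_iff]
    exact fun j => hv' j
  · filter_upwards [h.orthogonal] with ξ hξ
    simp only [dotProduct, Fin.sum_univ_three] at hξ ⊢
    linear_combination Complex.exp (Complex.I * gamma mu om ξ * ((b - c : ℝ) : ℂ)) * hξ
  · exact hrep

/-- The weak gradient of a UASR, as a superposition of plane waves. -/
def asrGrad (lam mu om b : ℝ) (Ap : Plane → ℂ) (As : Plane → Fin 3 → ℂ) (x : Space)
    (k j : Fin 3) : ℂ :=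
  waveField (kappaP lam mu om) (kappaS mu om) b
    (fun ξ => Complex.I * waveVec ξ (vertWave (kappaP lam mu om) ξ) k
      * (Ap ξ * waveVec ξ (vertWave (kappaP lam mu om) ξ) j))
    (fun ξ => Complex.I * waveVec ξ (vertWave (kappaS mu om) ξ) k * As ξ j) x

theorem UpwardASR.hasWeakGrad (hκ : 0 < kappaP lam mu om)
    (hκκ : kappaP lam mu om ≤ kappaS mu om) (h : UpwardASR lam mu om b u v Ap As) :
    HasWeakGrad (upperHalf b) u (asrGrad lam mu om b Ap As) := by
  have hκ' : 0 < kappaS mu om := hκ.trans_le hκκ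
  have hP := fun j => h.polyL2 hκ hκκ j
  refine ⟨fun j => ?_, fun k j => ?_, fun φ hφ hc hs k j => ?_⟩
  · exact LocallyIntegrableOn.congr_ae
      (locallyIntegrableOn_waveField hκ.le hκ'.le (hP j).1 (hP j).2) (h.ae_eq_waveField j)
  · exact locallyIntegrableOn_waveField hκ.le hκ'.le ((hP j).1.mul_waveVec hκ.le k)
      ((hP j).2.mul_waveVec hκ'.le k)
  · refine Eq.trans (integral_congr_ae ?_) (integral_waveField_mul_fderiv hκ.le hκ'.le (hP j).1
      (hP j).2 (hφ.of_le (by simp)) hc hs k)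
    filter_upwards [h.ae_eq_waveField j] with x hx
    rw [hx]

theorem UpwardASR.mode_grad_le (hκ : 0 < kappaP lam mu om)
    (hκκ : kappaP lam mu om ≤ kappaS mu om) (h : UpwardASR lam mu om b u v Ap As) :
    ∃ C : ℝ, ∀ k j, ∀ᵐ ξ, ∀ s : ℝ, 0 ≤ s → s ≤ 1 →
      ‖mode (kappaP lam mu om) (kappaS mu om)
        (fun ξ => Complex.I * waveVec ξ (vertWave (kappaP lam mu om) ξ) k
          * (Ap ξ * waveVec ξ (vertWave (kappaP lam mu om) ξ) j))
        (fun ξ => Complex.I * waveVec ξ (vertWave (kappaS mu om) ξ) k * As ξ j) ξ s‖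
      ≤ C * ((1 + ‖ξ‖) * hatNorm v ξ) := by
  obtain ⟨C, hC0, hC⟩ := h.exists_bounds hκ hκκ
  refine ⟨C, fun k j => ?_⟩
  filter_upwards [hC] with ξ hξ s h0 h1
  obtain ⟨e1, e2⟩ := (hξ.2 j).2.2 s h0 h1
  -- a horizontal derivative multiplies both parts of the mode by the same factor
  have horiz : ∀ i : Fin 2, ‖Complex.I * (ξ i : ℂ) * mode (kappaP lam mu om) (kappaS mu om)
      (fun ξ => Ap ξ * waveVec ξ (vertWave (kappaP lam mu om) ξ) j) (fun ξ => As ξ j) ξ s‖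
      ≤ C * ((1 + ‖ξ‖) * hatNorm v ξ) := fun i => by
    have hi : ‖(ξ i : ℂ)‖ ≤ 1 + ‖ξ‖ := by
      rw [Complex.norm_real]
      exact (PiLp.norm_apply_le ξ i).trans (by linarith)
    rw [norm_mul, norm_mul, Complex.norm_I, one_mul]
    calc _ ≤ (1 + ‖ξ‖) * (C * hatNorm v ξ) := by gcongr
      _ = _ := by ring
  fin_cases k
  · refine le_of_eq_of_le (congrArg norm ?_) (horiz 0)
    simp only [mode, waveVec, Fin.zero_eta, Matrix.cons_val]
    ring
  · refine le_of_eq_of_le (congrArg norm ?_) (horiz 1)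
    simp only [mode, waveVec, Fin.mk_one, Matrix.cons_val]
    ring
  · exact e2.trans_eq (by ring)

/-- The energy identities on a horizontal plane. -/
theorem UpwardASR.rellich (hmu : 0 < mu) (hlam : 0 < lam + 2 * mu / 3) (hom : 0 < om)
    (h : UpwardASR lam mu om b u v Ap As) (hv : TraceInH1 v) :
    ∃ (Du : Space → Fin 3 → Fin 3 → ℂ) (G : Plane → Fin 3 → Fin 3 → ℂ),
      HasWeakGrad (upperHalf b) u Du ∧
      (∀ k j, HasGraphTrace (fun _ => b) (fun x => Du x k j) (fun x' => G x' k j)) ∧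
      (∀ k j, MemLp (fun x' => G x' k j) 2 volume) ∧
      IntegrableOn (fun ξ => (beta lam mu om ξ).re ^ 2 * ‖Ap ξ‖ ^ 2)
        {ξ | ‖ξ‖ < kappaP lam mu om} ∧
      IntegrableOn (fun ξ => (gamma mu om ξ).re ^ 2 * normSq3 (As ξ)) {ξ | ‖ξ‖ < kappaS mu om} ∧
      IntegrableOn (fun ξ => (beta lam mu om ξ).re * ‖Ap ξ‖ ^ 2) {ξ | ‖ξ‖ < kappaP lam mu om} ∧
      IntegrableOn (fun ξ => (gamma mu om ξ).re * normSq3 (As ξ)) {ξ | ‖ξ‖ < kappaS mu om} ∧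
      Integrable (fun x' => rellichIntegrand lam mu om ![0, 0, 1] (fun j => v j x') (G x')) ∧
      Integrable (fun x' => traction lam mu ![0, 0, 1] (G x') ⬝ᵥ star (fun j => v j x')) ∧
      ∫ x', rellichIntegrand lam mu om ![0, 0, 1] (fun j => v j x') (G x')
        = 2 * (om ^ 2 * (∫ ξ in {ξ | ‖ξ‖ < kappaP lam mu om},
              (beta lam mu om ξ).re ^ 2 * ‖Ap ξ‖ ^ 2)
            + mu * ∫ ξ in {ξ | ‖ξ‖ < kappaS mu om}, (gamma mu om ξ).re ^ 2 * normSq3 (As ξ)) ∧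
      (∫ x', traction lam mu ![0, 0, 1] (G x') ⬝ᵥ star (fun j => v j x')).im
        = om ^ 2 * (∫ ξ in {ξ | ‖ξ‖ < kappaP lam mu om}, (beta lam mu om ξ).re * ‖Ap ξ‖ ^ 2)
            + mu * ∫ ξ in {ξ | ‖ξ‖ < kappaS mu om}, (gamma mu om ξ).re * normSq3 (As ξ) := by
  have hκ := kappaP_pos hmu hlam hom
  have hκκ := kappaP_le_kappaS hmu hlam hom
  have r1 := sq_eq_mul_kappaP_sq (om := om) hmu hlam
  have r2 := sq_eq_mul_kappaS_sq (om := om) hmu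
  have hgrad := h.hasWeakGrad hκ hκκ
  obtain ⟨m1, m2⟩ := h.aestronglyMeasurable hκ hκκ
  have hP := fun j => h.polyL2 hκ hκκ j
  obtain ⟨C, hC0, hC⟩ := h.exists_bounds hκ hκκ
  obtain ⟨C', hC'⟩ := h.mode_grad_le hκ hκκ
  set κ := kappaP lam mu om with hκdef
  set κ' := kappaS mu om with hκ'def
  have hκ' : 0 < κ' := hκ.trans_le hκκ
  have hN := memLp_hatNorm v
  -- the boundary value of the gradient has Fourier transform `modeGrad`
  have hV : ∀ k j, ∃ V : Lp (α := Plane) ℂ 2 volume,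
      hat V =ᵐ[volume] fun ξ => modeGrad κ κ' ξ (Ap ξ) (As ξ) k j := by
    intro k j
    refine exists_hat_eq ((hv.memLp.const_mul C').mono'
      (((hP j).1.mul_waveVec hκ.le k).1.add ((hP j).2.mul_waveVec hκ'.le k).1) ?_)
    filter_upwards [hC' k j] with ξ hξ
    have := hξ 0 le_rfl zero_le_one
    rwa [mode_zero] at this
  choose V hVhat using hV
  have hG : ∀ k j, L2Pair (fun x => V k j x) (fun ξ => modeGrad κ κ' ξ (Ap ξ) (As ξ) k j) :=
    fun k j => ⟨V k j, .rfl, hVhat k j⟩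
  have hvp : ∀ j, L2Pair (fun x => v j x) (fun ξ => Ap ξ * waveVec ξ (vertWave κ ξ) j + As ξ j) :=
    fun j => ⟨v j, .rfl, h.hat_eq.mono fun ξ hξ => hξ j⟩
  obtain ⟨iR, iR', eR⟩ := parsevalPair_rellichIntegrand (G := fun x k j => V k j x)
    (H := fun ξ => modeGrad κ κ' ξ (Ap ξ) (As ξ)) hG (v := fun x j => v j x)
    (w := fun ξ j => Ap ξ * waveVec ξ (vertWave κ ξ) j + As ξ j) hvp lam mu om
  obtain ⟨iT, iT', eT⟩ := parsevalPair_flux (G := fun x k j => V k j x)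
    (H := fun ξ => modeGrad κ κ' ξ (Ap ξ) (As ξ)) hG (v := fun x j => v j x)
    (w := fun ξ j => Ap ξ * waveVec ξ (vertWave κ ξ) j + As ξ j) hvp lam mu
  have hmP : MeasurableSet {ξ : Plane | ‖ξ‖ < κ} := measurableSet_lt measurable_norm measurable_const
  have hmS : MeasurableSet {ξ : Plane | ‖ξ‖ < κ'} :=
    measurableSet_lt measurable_norm measurable_const
  -- on a disc the amplitudes are square-integrable, and the wavenumbers are bounded
  have hN0 : ∀ ξ, 0 ≤ hatNorm v ξ := fun ξ => Finset.sum_nonneg fun i _ => norm_nonneg _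
  have hint : ∀ (k : ℝ), 0 < k → ∀ (n : ℕ) (a : Plane → ℂ), AEStronglyMeasurable a volume →
      (∀ᵐ ξ, ‖a ξ‖ ≤ C * (1 + ‖ξ‖) ^ 2 * hatNorm v ξ) →
      IntegrableOn (fun ξ => (vertWave k ξ).re ^ n * ‖a ξ‖ ^ 2) {ξ | ‖ξ‖ < k} := by
    intro k hk n a ha hb
    have hms : MeasurableSet {ξ : Plane | ‖ξ‖ < k} :=
      measurableSet_lt measurable_norm measurable_const
    have hi : Integrable (fun ξ => (k + k) ^ n * (C * (1 + k) ^ 2) ^ 2 * ‖hatNorm v ξ‖ ^ 2) :=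
      (hN.integrable_norm_pow (by norm_num)).const_mul _
    refine hi.integrableOn.mono' ?_ ?_
    · have hvm := measurable_vertWave k
      have : Measurable fun ξ => (vertWave k ξ).re ^ n := by fun_prop
      exact (this.aestronglyMeasurable.mul (ha.norm.pow 2)).restrict
    · filter_upwards [ae_restrict_mem hms, ae_restrict_of_ae hb] with ξ hξ hbξ
      have hξ : ‖ξ‖ < k := hξ
      have hre0 := vertWave_re_nonneg k ξ
      have hre : (vertWave k ξ).re ≤ k + k :=
        (Complex.re_le_norm _).trans ((norm_vertWave_le hk.le ξ).trans (by linarith))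
      have hN0 := hN0 ξ
      rw [Real.norm_of_nonneg (by positivity), Real.norm_of_nonneg hN0, mul_assoc, ← mul_pow]
      gcongr
      exact hbξ.trans (by gcongr)
  have hAp : ∀ᵐ ξ, ‖Ap ξ‖ ≤ C * (1 + ‖ξ‖) ^ 2 * hatNorm v ξ := by
    filter_upwards [hC] with ξ hξ
    refine hξ.1.trans ?_
    have := hN0 ξ
    gcongr
    nlinarith [norm_nonneg ξ]
  have hAs : ∀ j, ∀ᵐ ξ, ‖As ξ j‖ ≤ C * (1 + ‖ξ‖) ^ 2 * hatNorm v ξ := fun j =>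
    hC.mono fun ξ hξ => (hξ.2 j).2.1
  have I1 : ∀ n : ℕ, IntegrableOn (fun ξ => (vertWave κ ξ).re ^ n * ‖Ap ξ‖ ^ 2) {ξ | ‖ξ‖ < κ} :=
    fun n => hint κ hκ n Ap m1 hAp
  have I2 : ∀ n : ℕ, IntegrableOn (fun ξ => (vertWave κ' ξ).re ^ n * normSq3 (As ξ))
      {ξ | ‖ξ‖ < κ'} := fun n => by
    simp only [normSq3, Finset.mul_sum]
    exact integrable_finsetSum _ fun j _ => hint κ' hκ' n (fun ξ => As ξ j) (m2 j) (hAs j)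
  -- integrals over the discs as integrals over the plane
  have J : ∀ (k : ℝ) (n : ℕ) (g : Plane → ℝ) (hm : MeasurableSet {ξ : Plane | ‖ξ‖ < k}),
      IntegrableOn (fun ξ => (vertWave k ξ).re ^ n * g ξ) {ξ | ‖ξ‖ < k} →
      Integrable (fun ξ => (if ‖ξ‖ < k then (vertWave k ξ).re ^ n else 0) * g ξ) ∧
      ∫ ξ, (if ‖ξ‖ < k then (vertWave k ξ).re ^ n else 0) * g ξ
        = ∫ ξ in {ξ | ‖ξ‖ < k}, (vertWave k ξ).re ^ n * g ξ := by
    intro k n g hm hi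
    have e : (fun ξ => (if ‖ξ‖ < k then (vertWave k ξ).re ^ n else 0) * g ξ)
        = Set.indicator {ξ | ‖ξ‖ < k} (fun ξ => (vertWave k ξ).re ^ n * g ξ) := by
      funext ξ
      simp only [Set.indicator, Set.mem_ofPred_eq, ite_mul, zero_mul]
    rw [e]
    exact ⟨hi.integrable_indicator hm, integral_indicator hm⟩
  obtain ⟨J1, J1'⟩ := J κ 2 _ hmP (I1 2)
  obtain ⟨J2, J2'⟩ := J κ' 2 _ hmS (I2 2)
  obtain ⟨J3, J3'⟩ := J κ 1 _ hmP (I1 1)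
  obtain ⟨J4, J4'⟩ := J κ' 1 _ hmS (I2 1)
  simp only [pow_one] at J3 J3' J4 J4'
  have I3 := I1 1
  have I4 := I2 1
  simp only [pow_one] at I3 I4
  refine ⟨asrGrad lam mu om b Ap As, fun x k j => V k j x, hgrad, fun k j => ?_,
    fun k j => Lp.memLp _, I1 2, I2 2, I3, I4, ?_, ?_, ?_, ?_⟩
  · exact hasGraphTrace_waveField hκ.le hκ'.le ((hP j).1.mul_waveVec hκ.le k)
      ((hP j).2.mul_waveVec hκ'.le k) (hv.memLp.const_mul C') (hC' k j) (hVhat k j)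
      (.of_forall fun x => rfl)
  · simpa only [RCLike.re_to_complex, Complex.ofReal_re] using iR.re
  · exact iT
  · apply Complex.ofReal_injective
    rw [← integral_complex_ofReal, eR, integral_complex_ofReal]
    congr 1
    refine Eq.trans (integral_congr_ae (h.orthogonal.mono fun ξ hξ =>
      rellichIntegrand_modeGrad hκ.le hκ'.le r1 r2 hξ)) ?_
    rw [integral_const_mul, integral_add (J1.const_mul _) (J2.const_mul _), integral_const_mul,
      integral_const_mul, J1', J2']
    rfl
  · have e1 : (∫ x', traction lam mu ![0, 0, 1] (fun k j => V k j x')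
        ⬝ᵥ star (fun j => v j x')).im = (∫ ξ, ∑ j, traction lam mu ![0, 0, 1]
          (modeGrad κ κ' ξ (Ap ξ) (As ξ)) j
          * conj (Ap ξ * waveVec ξ (vertWave κ ξ) j + As ξ j)).im := congrArg Complex.im eT
    have e2 := integral_im iT'
    simp only [RCLike.im_to_complex] at e2
    rw [e1, ← e2]
    refine Eq.trans (integral_congr_ae (h.orthogonal.mono fun ξ hξ =>
      traction_modeGrad_im hκ.le hκ'.le r1 r2 hξ)) ?_
    rw [integral_add (J3.const_mul _) (J4.const_mul _), integral_const_mul,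
      integral_const_mul, J3', J4']
    rfl

end

/-! ### Weak gradients and continuously differentiable test functions -/

section Mollify

open scoped Convolution

/-- A sequence of mollifiers supported in the balls of radius `ε / (n + 1)`. -/
def mollifier (E : Type*) [NormedAddCommGroup E] [NormedSpace ℝ E] {ε : ℝ} (hε : 0 < ε) (n : ℕ) :
    ContDiffBump (0 : E) where
  rIn := ε / (n + 1) / 2
  rOut := ε / (n + 1)
  rIn_pos := by positivity
  rIn_lt_rOut := half_lt_self (by positivity)

theorem tendsto_mollifier_rOut {E : Type*} [NormedAddCommGroup E] [NormedSpace ℝ E]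
    {ε : ℝ} (hε : 0 < ε) :
    Tendsto (fun n => (mollifier E hε n).rOut) atTop (𝓝 0) := by
  have := (tendsto_one_div_add_atTop_nhds_zero_nat (𝕜 := ℝ)).const_mul ε
  simpa [mollifier, div_eq_mul_inv] using this

theorem mollifier_rOut_le {E : Type*} [NormedAddCommGroup E] [NormedSpace ℝ E] {ε : ℝ}
    (hε : 0 < ε) (n : ℕ) : (mollifier E hε n).rOut ≤ ε :=
  div_le_self hε.le (by linarith [n.cast_nonneg (α := ℝ)])

variable {E : Type*} [NormedAddCommGroup E] [NormedSpace ℝ E] [FiniteDimensional ℝ E]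
  [MeasurableSpace E] [BorelSpace E] {μ : Measure E} [μ.IsAddHaarMeasure]

theorem support_mollify_subset {ε : ℝ} (hε : 0 < ε) (n : ℕ) {g : E → ℝ} :
    Function.support (((mollifier E hε n).normed μ) ⋆[ContinuousLinearMap.lsmul ℝ ℝ, μ] g)
      ⊆ Metric.cthickening ε (tsupport g) := by
  refine (support_convolution_subset _).trans ?_
  rintro _ ⟨a, ha, c, hc, rfl⟩
  rw [ContDiffBump.support_normed_eq, mem_ball_zero_iff] at ha
  refine Metric.mem_cthickening_of_dist_le _ c _ _ (subset_tsupport g hc) ?_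
  rw [dist_eq_norm, add_sub_cancel_right]
  exact ha.le.trans (mollifier_rOut_le hε n)

theorem abs_mollify_le {ε : ℝ} (hε : 0 < ε) (n : ℕ) {g : E → ℝ} (hg : Continuous g) {B : ℝ}
    (hB : ∀ x, |g x| ≤ B) (x : E) :
    |(((mollifier E hε n).normed μ) ⋆[ContinuousLinearMap.lsmul ℝ ℝ, μ] g) x| ≤ 3 * B := by
  have h := ContDiffBump.dist_normed_convolution_le (φ := mollifier E hε n) (μ := μ) (g := g)
    (x₀ := x) (ε := 2 * B) hg.aestronglyMeasurable fun y _ => by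
      rw [Real.dist_eq]
      exact (abs_sub _ _).trans (by linarith [hB x, hB y])
  rw [Real.dist_eq] at h
  have h2 := abs_sub_abs_le_abs_sub
    ((((mollifier E hε n).normed μ) ⋆[ContinuousLinearMap.lsmul ℝ ℝ, μ] g) x) (g x)
  linarith [hB x]

/-- Integrals against mollified functions converge. -/
theorem tendsto_integral_mul_mollify {Ω : Set E} {w : E → ℂ}
    (hw : LocallyIntegrableOn w Ω μ) {g : E → ℝ} (hg : Continuous g) (hc : HasCompactSupport g)
    {ε : ℝ} (hε : 0 < ε) (hK : Metric.cthickening ε (tsupport g) ⊆ Ω) :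
    Tendsto (fun n => ∫ x in Ω, w x *
        (((((mollifier E hε n).normed μ) ⋆[ContinuousLinearMap.lsmul ℝ ℝ, μ] g) x : ℝ) : ℂ) ∂μ)
      atTop (𝓝 (∫ x in Ω, w x * ((g x : ℝ) : ℂ) ∂μ)) := by
  obtain ⟨B, hB⟩ := hg.bounded_above_of_compact_support hc
  set K := Metric.cthickening ε (tsupport g) with hKdef
  have hKc : IsCompact K := IsCompact.cthickening hc
  have hwK : IntegrableOn w K μ := hw.integrableOn_compact_subset hK hKc
  have hcont : ∀ n, Continuous
      (((mollifier E hε n).normed μ) ⋆[ContinuousLinearMap.lsmul ℝ ℝ, μ] g) := fun n =>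
    (mollifier E hε n).hasCompactSupport_normed.continuous_convolution_left _
      ((mollifier E hε n).contDiff_normed (n := 0)).continuous hg.locallyIntegrable
  refine tendsto_integral_of_dominated_convergence (K.indicator fun x => 3 * B * ‖w x‖)
    (fun n => ?_) ?_ (fun n => ?_) ?_
  · exact (hw.aestronglyMeasurable).mul
      (Complex.continuous_ofReal.comp (hcont n)).aestronglyMeasurable
  · exact ((integrable_indicator_iff hKc.measurableSet).2 (hwK.norm.const_mul (3 * B))).restrict
  · refine .of_forall fun x => ?_
    by_cases hx : x ∈ K
    · rw [Set.indicator_of_mem hx, norm_mul, Complex.norm_real, Real.norm_eq_abs, mul_comm]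
      gcongr
      exact abs_mollify_le hε n hg hB x
    · have h0 : (((mollifier E hε n).normed μ) ⋆[ContinuousLinearMap.lsmul ℝ ℝ, μ] g) x = 0 := by
        by_contra hne
        exact hx (support_mollify_subset hε n hne)
      rw [Set.indicator_of_notMem hx, h0]
      simp
  · refine .of_forall fun x => ?_
    have := ContDiffBump.convolution_tendsto_right_of_continuous (μ := μ)
      (tendsto_mollifier_rOut (E := E) hε) hg x
    exact ((Complex.continuous_ofReal.tendsto _).comp this).const_mul _

theorem integral_mul_fderiv_of_contDiff_one {Ω : Set E} (hΩ : IsOpen Ω) {w D : E → ℂ} {v : E}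
    (hw : LocallyIntegrableOn w Ω μ) (hD : LocallyIntegrableOn D Ω μ)
    (h : ∀ φ : E → ℝ, ContDiff ℝ ∞ φ → HasCompactSupport φ → tsupport φ ⊆ Ω →
      ∫ x in Ω, w x * ((fderiv ℝ φ x v : ℝ) : ℂ) ∂μ = - ∫ x in Ω, D x * ((φ x : ℝ) : ℂ) ∂μ)
    {φ : E → ℝ} (hφ : ContDiff ℝ 1 φ) (hc : HasCompactSupport φ) (hs : tsupport φ ⊆ Ω) :
    ∫ x in Ω, w x * ((fderiv ℝ φ x v : ℝ) : ℂ) ∂μ = - ∫ x in Ω, D x * ((φ x : ℝ) : ℂ) ∂μ := by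
  obtain ⟨ε, hε, hK⟩ := hc.exists_cthickening_subset_open hΩ hs
  have hφ' : Continuous fun x => fderiv ℝ φ x v :=
    (hφ.continuous_fderiv one_ne_zero).clm_apply continuous_const
  have hc' : HasCompactSupport fun x => fderiv ℝ φ x v := hc.fderiv_apply (𝕜 := ℝ) v
  have hs' : tsupport (fun x => fderiv ℝ φ x v) ⊆ tsupport φ := tsupport_fderiv_apply_subset ℝ v
  have t1 := tendsto_integral_mul_mollify hw hφ' hc' hε
    ((Metric.cthickening_subset_of_subset ε hs').trans hK)
  have t2 := tendsto_integral_mul_mollify hD hφ.continuous hc hε hK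
  refine tendsto_nhds_unique t1 (t2.neg.congr fun n => ?_)
  set ρ := (mollifier E hε n).normed μ with hρ
  have hρc : HasCompactSupport ρ := (mollifier E hε n).hasCompactSupport_normed
  have hsub : tsupport (ρ ⋆[ContinuousLinearMap.lsmul ℝ ℝ, μ] φ)
      ⊆ Metric.cthickening ε (tsupport φ) :=
    closure_minimal (support_mollify_subset hε n) Metric.isClosed_cthickening
  have key := h (ρ ⋆[ContinuousLinearMap.lsmul ℝ ℝ, μ] φ)
    (hρc.contDiff_convolution_left _ (mollifier E hε n).contDiff_normed
      hφ.continuous.locallyIntegrable)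
    ((IsCompact.cthickening hc).of_isClosed_subset (isClosed_tsupport _) hsub)
    (hsub.trans hK)
  rw [← key]
  refine integral_congr_ae (.of_forall fun x => ?_)
  have hd := hc.hasFDerivAt_convolution_right (ContinuousLinearMap.lsmul ℝ ℝ)
    (f := ρ) (μ := μ) ((mollifier E hε n).continuous_normed.locallyIntegrable) hφ x
  simp only [hd.fderiv]
  rw [convolution_precompR_apply _ (mollifier E hε n).continuous_normed.locallyIntegrable
    (hc.fderiv ℝ) (hφ.continuous_fderiv one_ne_zero)]

end Mollify

/-! ### Integrals over thin layers above a graph -/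

/-- The shear that flattens the graph of `f`. -/
def flatten (f : Plane → ℝ) (x : Space) : Space := (x.1, x.2 - f x.1)

theorem measurePreserving_flatten {f : Plane → ℝ} (hf : Measurable f) :
    MeasurePreserving (flatten f) volume volume := by
  have := (MeasurePreserving.id (volume : Measure Plane)).skew_product (μc := (volume : Measure ℝ))
    (μd := (volume : Measure ℝ)) (g := fun x y => y - f x)
    (measurable_snd.sub (hf.comp measurable_fst))
    (.of_forall fun x => (measurePreserving_sub_right volume (f x)).map_eq)
  exact this

/-- The part of the layer of thickness `t` above the graph of `f` that lies over `K`. -/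
def layer (f : Plane → ℝ) (K : Set Plane) (t : ℝ) : Set Space :=
  {x | x.1 ∈ K ∧ f x.1 < x.2 ∧ x.2 < f x.1 + t}

theorem layer_eq_preimage (f : Plane → ℝ) (K : Set Plane) (t : ℝ) :
    layer f K t = flatten f ⁻¹' (K ×ˢ Set.Ioo 0 t) := by
  ext x
  simp only [layer, flatten, Set.mem_preimage, Set.mem_prod, Set.mem_Ioo]
  constructor
  · rintro ⟨h1, h2, h3⟩; exact ⟨h1, by linarith, by linarith⟩
  · rintro ⟨h1, h2, h3⟩; exact ⟨h1, by linarith, by linarith⟩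

theorem measurableSet_layer {f : Plane → ℝ} (hf : Measurable f) {K : Set Plane}
    (hK : MeasurableSet K) (t : ℝ) : MeasurableSet (layer f K t) := by
  rw [layer_eq_preimage]
  exact (measurePreserving_flatten hf).measurable (hK.prod measurableSet_Ioo)

theorem setLIntegral_layer {f : Plane → ℝ} (hf : Measurable f) {K : Set Plane}
    (hK : MeasurableSet K) (t : ℝ) {F : Plane → ℝ≥0∞} (hF : AEMeasurable F volume) :
    ∫⁻ x in layer f K t, F x.1 = ENNReal.ofReal t * ∫⁻ x' in K, F x' := by
  have hmp := (measurePreserving_flatten hf).restrict_preimage (hK.prod measurableSet_Ioo)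
    (s := K ×ˢ Set.Ioo 0 t)
  have hF' : AEMeasurable (fun x : Space => F x.1) (volume.restrict (K ×ˢ Set.Ioo 0 t)) :=
    (hF.comp_quasiMeasurePreserving Measure.quasiMeasurePreserving_fst).restrict
  rw [layer_eq_preimage]
  have h1 : ∫⁻ x in flatten f ⁻¹' (K ×ˢ Set.Ioo 0 t), F x.1
      = ∫⁻ x in K ×ˢ Set.Ioo 0 t, F x.1 := by
    rw [← hmp.map_eq] at hF' ⊢
    rw [lintegral_map' hF' hmp.measurable.aemeasurable]
    rfl
  rw [h1, Measure.volume_eq_prod, ← Measure.prod_restrict]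
  rw [Measure.volume_eq_prod, ← Measure.prod_restrict] at hF'
  rw [lintegral_prod _ hF']
  simp only [lintegral_const, Measure.restrict_apply_univ, Real.volume_Ioo, sub_zero]
  rw [lintegral_mul_const'' _ hF.restrict, mul_comm]

theorem volume_layer_lt_top {f : Plane → ℝ} (hf : Measurable f) {K : Set Plane}
    (hK : IsCompact K) (t : ℝ) : volume (layer f K t) < ⊤ := by
  have := setLIntegral_layer hf hK.measurableSet t (F := fun _ => 1) aemeasurable_const
  simp only [lintegral_const, Measure.restrict_apply_univ, one_mul] at this
  rw [this]
  exact ENNReal.mul_lt_top ENNReal.ofReal_lt_top hK.measure_lt_top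

theorem layer_subset_strip {f : Plane → ℝ} {fplus b : ℝ} (hf : ∀ x, f x ≤ fplus) (K : Set Plane)
    {t : ℝ} (ht : t ≤ b - fplus) : layer f K t ⊆ strip f b := fun x hx =>
  ⟨hx.2.1, by have := hf x.1; have := hx.2.2; linarith⟩

/-- Boundary values of fields that are square-integrable near the graph are locally integrable. -/
theorem HasGraphTrace.locallyIntegrable {f : Plane → ℝ} (hfm : Measurable f) {fplus b : ℝ}
    (hf : ∀ x, f x ≤ fplus) (hb : fplus < b) {w : Space → ℂ}
    (hw : MemLp w 2 (volume.restrict (strip f b))) {g : Plane → ℂ} (h : HasGraphTrace f w g) :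
    LocallyIntegrable g volume := by
  rw [locallyIntegrable_iff]
  intro K hK
  obtain ⟨hgm, hlim⟩ := h
  have h1 : ∀ᶠ t : ℝ in 𝓝[>] 0, t ∈ Set.Ioo 0 (b - fplus) := Ioo_mem_nhdsGT (sub_pos.2 hb)
  have h2 := (ENNReal.tendsto_nhds_zero.1 (hlim K hK)) 1 one_pos
  obtain ⟨t, ht, hq⟩ := (h1.and h2).exists
  have ht0 : ENNReal.ofReal t ≠ 0 := by simpa using ht.1
  rw [ENNReal.div_le_iff ht0 ENNReal.ofReal_ne_top, one_mul] at hq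
  have hfin : IsFiniteMeasure (volume.restrict (layer f K t)) :=
    ⟨by rw [Measure.restrict_apply_univ]; exact volume_layer_lt_top hfm hK t⟩
  have hwL : MemLp w 2 (volume.restrict (layer f K t)) :=
    hw.mono_measure (Measure.restrict_mono (layer_subset_strip hf K ht.2.le) le_rfl)
  have hgL : AEStronglyMeasurable (fun x : Space => g x.1) (volume.restrict (layer f K t)) :=
    (hgm.comp_quasiMeasurePreserving Measure.quasiMeasurePreserving_fst).restrict
  have hdL : MemLp (fun x : Space => w x - g x.1) 2 (volume.restrict (layer f K t)) := by
    refine (memLp_two_iff_integrable_sq_norm (hwL.1.sub hgL)).2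
      ⟨((hwL.1.sub hgL).norm.pow 2), ?_⟩
    rw [hasFiniteIntegral_iff_enorm]
    simp only [enorm_pow, enorm_norm]
    exact hq.trans_lt ENNReal.ofReal_lt_top
  have hgL2 : Integrable (fun x : Space => g x.1) (volume.restrict (layer f K t)) := by
    refine ((hwL.sub hdL).integrable (by norm_num)).congr (.of_forall fun x => ?_)
    simp
  refine ⟨hgm.restrict, ?_⟩
  have := hgL2.2
  rw [hasFiniteIntegral_iff_enorm] at this ⊢
  rw [setLIntegral_layer hfm hK.measurableSet t hgm.enorm] at this
  exact lt_of_mul_lt_mul_left' (a := ENNReal.ofReal t) (by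
    rwa [ENNReal.mul_top ht0])

theorem enorm_le_add_inv_mul_sq (z : ℂ) {ε : ℝ≥0} (hε : 0 < ε) :
    ‖z‖ₑ ≤ ε + (ε⁻¹ : ℝ≥0) * ‖z‖ₑ ^ 2 := by
  rw [enorm_eq_nnnorm]
  norm_cast
  rw [← NNReal.coe_le_coe]
  push_cast
  have hε' : (0 : ℝ) < ε := hε
  have : (ε : ℝ) + (ε : ℝ)⁻¹ * ‖z‖ ^ 2 = (ε ^ 2 + ‖z‖ ^ 2) / ε := by field_simp
  rw [this, le_div_iff₀ hε']
  nlinarith [sq_nonneg ((ε : ℝ) - ‖z‖), norm_nonneg z]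

theorem tendsto_zero_of_le_add_inv_mul {l : Filter ℝ} {X q : ℝ → ℝ≥0∞} (hq : Tendsto q l (𝓝 0))
    {c : ℝ≥0∞} (hc : c ≠ ⊤) (h : ∀ᶠ t in l, ∀ ε : ℝ≥0, 0 < ε → X t ≤ c * (ε + (ε⁻¹ : ℝ≥0) * q t)) :
    Tendsto X l (𝓝 0) := by
  rw [ENNReal.tendsto_nhds_zero]
  intro δ hδ
  obtain ⟨ε, hε, hεδ⟩ := ENNReal.exists_nnreal_pos_mul_lt (a := c * 2) (b := δ)
    (ENNReal.mul_ne_top hc (by norm_num)) hδ.ne'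
  have hq2 := ENNReal.tendsto_nhds_zero.1 hq ((ε : ℝ≥0∞) * ε) (by positivity)
  filter_upwards [h, hq2] with t h1 h2
  calc X t ≤ c * (ε + (ε⁻¹ : ℝ≥0) * q t) := h1 ε hε
    _ ≤ c * (ε + (ε⁻¹ : ℝ≥0) * ((ε : ℝ≥0∞) * ε)) := by gcongr
    _ = c * (ε + ε) := by
        rw [← mul_assoc, ← ENNReal.coe_mul, inv_mul_cancel₀ hε.ne', ENNReal.coe_one, one_mul]
    _ = ε * (c * 2) := by ring
    _ ≤ δ := hεδ.le

/-- A smooth bump function with support in `(0, 1)`. -/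
def heightBump : ContDiffBump (1 / 2 : ℝ) where
  rIn := 1 / 8
  rOut := 1 / 4
  rIn_pos := by norm_num
  rIn_lt_rOut := by norm_num

/-- The profile `t⁻¹ ψ(s / t)` of the test functions, which concentrates at the boundary `s = 0`. -/
def profile (t s : ℝ) : ℝ := t⁻¹ * heightBump.normed volume (s / t)

theorem profile_eq_zero {t s : ℝ} (ht : 0 < t) (h : s ∉ Set.Icc (t / 4) (3 * t / 4)) :
    profile t s = 0 := by
  have : heightBump.normed volume (s / t) = 0 := by
    rw [← Function.notMem_support, ContDiffBump.support_normed_eq]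
    intro hs
    rw [Metric.mem_ball, Real.dist_eq, abs_lt] at hs
    have e : heightBump.rOut = 1 / 4 := rfl
    rw [e] at hs
    obtain ⟨h1, h2⟩ := hs
    have h3 : 1 / 4 < s / t := by linarith
    have h4 : s / t < 3 / 4 := by linarith
    rw [lt_div_iff₀ ht] at h3
    rw [div_lt_iff₀ ht] at h4
    exact h ⟨by linarith, by linarith⟩
  rw [profile, this, mul_zero]

theorem contDiff_profile (t : ℝ) : ContDiff ℝ ∞ (profile t) := by
  unfold profile
  exact contDiff_const.mul (heightBump.contDiff_normed.comp (contDiff_id.div_const t))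

theorem integral_profile {t : ℝ} (ht : 0 < t) : ∫ s, profile t s = 1 := by
  simp only [profile]
  rw [integral_const_mul, Measure.integral_comp_div, ContDiffBump.integral_normed, abs_of_pos ht,
    smul_eq_mul, mul_one, inv_mul_cancel₀ ht.ne']

theorem exists_profile_le : ∃ M : ℝ, 0 ≤ M ∧ ∀ t s : ℝ, 0 < t → |profile t s| ≤ t⁻¹ * M := by
  obtain ⟨M, hM⟩ := (heightBump.continuous_normed (μ := volume)).bounded_above_of_compact_support
    heightBump.hasCompactSupport_normed
  refine ⟨M, (norm_nonneg _).trans (hM 0), fun t s ht => ?_⟩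
  rw [profile, abs_mul, abs_of_pos (inv_pos.2 ht)]
  gcongr
  exact hM _

/-- The test function `η(x') t⁻¹ ψ((x₃ - f(x')) / t)`. -/
def layerTest (f : Plane → ℝ) (η : Plane → ℝ) (t : ℝ) (x : Space) : ℝ :=
  η x.1 * profile t (x.2 - f x.1)

theorem continuous_layerTest {f η : Plane → ℝ} (hf : Continuous f) (hη : Continuous η) (t : ℝ) :
    Continuous (layerTest f η t) := by
  have := (contDiff_profile t).continuous
  unfold layerTest
  fun_prop

theorem layerTest_eq_zero {f η : Plane → ℝ} {t : ℝ} (ht : 0 < t) {x : Space}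
    (hx : x ∉ layer f (tsupport η) t) : layerTest f η t x = 0 := by
  by_cases h : x.1 ∈ tsupport η
  · rw [layerTest, profile_eq_zero ht, mul_zero]
    rintro ⟨h1, h2⟩
    exact hx ⟨h, by linarith, by linarith⟩
  · rw [layerTest, image_eq_zero_of_notMem_tsupport h, zero_mul]

/-- The support of `layerTest f η t` stays away from the graph. -/
theorem tsupport_layerTest_subset {f η : Plane → ℝ} (hf : Continuous f) {t : ℝ} (ht : 0 < t) :
    tsupport (layerTest f η t)
      ⊆ {x | x.1 ∈ tsupport η ∧ x.2 - f x.1 ∈ Set.Icc (t / 4) (3 * t / 4)} := by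
  refine closure_minimal (fun x hx => ?_) ?_
  · rw [Function.mem_support, layerTest, mul_ne_zero_iff] at hx
    refine ⟨subset_tsupport _ hx.1, ?_⟩
    by_contra hne
    exact hx.2 (profile_eq_zero ht hne)
  · exact ((isClosed_tsupport η).preimage continuous_fst).inter
      (isClosed_Icc.preimage (continuous_snd.sub (hf.comp continuous_fst)))

theorem hasCompactSupport_layerTest {f η : Plane → ℝ} (hf : Continuous f)
    (hη : HasCompactSupport η) {t : ℝ} (ht : 0 < t) : HasCompactSupport (layerTest f η t) := by
  have hK : IsCompact ((fun z : Space => ((z.1, z.2 + f z.1) : Space))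
      '' (tsupport η ×ˢ Set.Icc (t / 4) (3 * t / 4))) :=
    (IsCompact.prod hη isCompact_Icc).image (by fun_prop)
  refine hK.of_isClosed_subset (isClosed_tsupport _)
    ((tsupport_layerTest_subset hf ht).trans fun x hx => ?_)
  exact ⟨(x.1, x.2 - f x.1), ⟨hx.1, hx.2⟩, by simp⟩

theorem tsupport_layerTest_subset_strip {f η : Plane → ℝ} (hf : Continuous f) {fplus b : ℝ}
    (hle : ∀ x, f x ≤ fplus) {t : ℝ} (ht : 0 < t) (htb : t < b - fplus) :
    tsupport (layerTest f η t) ⊆ strip f b :=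
  (tsupport_layerTest_subset hf ht).trans fun x hx =>
    ⟨by linarith [hx.2.1], by linarith [hx.2.2, hle x.1]⟩

theorem isOpen_strip {f : Plane → ℝ} (hf : Continuous f) (b : ℝ) : IsOpen (strip f b) :=
  (isOpen_lt (hf.comp continuous_fst) continuous_snd).inter
    (isOpen_lt continuous_snd continuous_const)

/-- Testing with functions that concentrate at the graph yields the boundary value. -/
theorem HasGraphTrace.tendsto_integral_layerTest {f : Plane → ℝ} (hfc : Continuous f)
    {fplus b : ℝ} (hf : ∀ x, f x ≤ fplus) (hb : fplus < b) {w : Space → ℂ}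
    (hw : MemLp w 2 (volume.restrict (strip f b))) {g : Plane → ℂ} (h : HasGraphTrace f w g)
    {η : Plane → ℝ} (hη : Continuous η) (hc : HasCompactSupport η) :
    Tendsto (fun t => ∫ x in strip f b, w x * ((layerTest f η t x : ℝ) : ℂ)) (𝓝[>] 0)
      (𝓝 (∫ x', g x' * ((η x' : ℝ) : ℂ))) := by
  have hgl := h.locallyIntegrable hfc.measurable hf hb hw
  set K := tsupport η with hKdef
  have hK : IsCompact K := hc
  obtain ⟨B, hB⟩ := hη.bounded_above_of_compact_support hc
  have hB0 : 0 ≤ B := (norm_nonneg _).trans (hB 0)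
  obtain ⟨M, hM0, hM⟩ := exists_profile_le
  have hgη : Integrable (fun x' => g x' * ((η x' : ℝ) : ℂ)) := by
    have := hgl.integrable_smul_right_of_hasCompactSupport (g := fun x' => ((η x' : ℝ) : ℂ))
      (Complex.continuous_ofReal.comp hη) (hc.comp_left Complex.ofReal_zero)
    simpa only [smul_eq_mul] using this
  have hsmall : ∀ᶠ t : ℝ in 𝓝[>] 0, t ∈ Set.Ioo 0 (b - fplus) := Ioo_mem_nhdsGT (sub_pos.2 hb)
  rw [tendsto_iff_edist_tendsto_0]
  refine tendsto_zero_of_le_add_inv_mul (h.2 K hK)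
    (c := ENNReal.ofReal (B * M) * (1 + volume K))
    (ENNReal.mul_ne_top ENNReal.ofReal_ne_top
      (ENNReal.add_ne_top.2 ⟨ENNReal.one_ne_top, hK.measure_lt_top.ne⟩)) ?_
  filter_upwards [hsmall] with t ht ε hε
  have ht0 := ht.1
  have hsub : layer f K t ⊆ strip f b := layer_subset_strip hf K ht.2.le
  have hkc := continuous_layerTest hfc hη t
  have hkcs := hasCompactSupport_layerTest hfc hc ht0
  have hkc' : Continuous fun x => ((layerTest f η t x : ℝ) : ℂ) :=
    Complex.continuous_ofReal.comp hkc
  -- the integral of the boundary value, in the flattened coordinates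
  have hprod : Integrable (fun z : Space => (g z.1 * ((η z.1 : ℝ) : ℂ))
      * ((profile t z.2 : ℝ) : ℂ)) := by
    refine hgη.mul_prod (g := fun s => ((profile t s : ℝ) : ℂ)) ?_
    refine (Complex.continuous_ofReal.comp
      (contDiff_profile t).continuous).integrable_of_hasCompactSupport
      (HasCompactSupport.of_support_subset_isCompact (isCompact_Icc (a := t / 4) (b := 3 * t / 4))
        fun s hs => ?_)
    by_contra hne
    exact hs (by simp [profile_eq_zero ht0 hne])
  have hmp := measurePreserving_flatten hfc.measurable
  have hgk : Integrable (fun x : Space => g x.1 * ((layerTest f η t x : ℝ) : ℂ)) := by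
    refine (hmp.integrable_comp_of_integrable hprod).congr (.of_forall fun x => ?_)
    simp only [Function.comp, flatten, layerTest]
    push_cast
    ring
  have hgkI : ∫ x in strip f b, g x.1 * ((layerTest f η t x : ℝ) : ℂ)
      = ∫ x', g x' * ((η x' : ℝ) : ℂ) := by
    rw [setIntegral_eq_integral_of_forall_compl_eq_zero fun x hx => by
      rw [layerTest_eq_zero ht0 fun h => hx (hsub h)]; simp]
    have e1 : ∫ x : Space, g x.1 * ((layerTest f η t x : ℝ) : ℂ)
        = ∫ z : Space, (g z.1 * ((η z.1 : ℝ) : ℂ)) * ((profile t z.2 : ℝ) : ℂ) := by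
      have hae : AEStronglyMeasurable (fun z : Space => (g z.1 * ((η z.1 : ℝ) : ℂ))
          * ((profile t z.2 : ℝ) : ℂ)) (Measure.map (flatten f) volume) := by
        rw [hmp.map_eq]; exact hprod.1
      have := integral_map hmp.measurable.aemeasurable hae
      rw [hmp.map_eq] at this
      rw [this]
      refine integral_congr_ae (.of_forall fun x => ?_)
      simp only [flatten, layerTest]
      push_cast
      ring
    rw [e1, Measure.volume_eq_prod, integral_prod_mul (fun x' => g x' * ((η x' : ℝ) : ℂ))
      (fun s => ((profile t s : ℝ) : ℂ)), integral_complex_ofReal, integral_profile ht0]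
    simp
  have hwk : Integrable (fun x => w x * ((layerTest f η t x : ℝ) : ℂ))
      (volume.restrict (strip f b)) := by
    refine hw.integrable_mul (q := 2) ?_
    exact (hkc'.memLp_of_hasCompactSupport (hkcs.comp_left Complex.ofReal_zero)).restrict _
  rw [edist_eq_enorm_sub, ← hgkI, ← integral_sub hwk hgk.restrict]
  calc ‖∫ x in strip f b, (w x * ((layerTest f η t x : ℝ) : ℂ)
          - g x.1 * ((layerTest f η t x : ℝ) : ℂ))‖ₑ
      ≤ ∫⁻ x in strip f b, ‖w x * ((layerTest f η t x : ℝ) : ℂ)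
          - g x.1 * ((layerTest f η t x : ℝ) : ℂ)‖ₑ := enorm_integral_le_lintegral_enorm _
    _ ≤ ∫⁻ x, (layer f K t).indicator
          (fun x => ENNReal.ofReal (t⁻¹ * (B * M)) * ‖w x - g x.1‖ₑ) x := by
        refine (setLIntegral_le_lintegral _ _).trans (lintegral_mono fun x => ?_)
        by_cases hx : x ∈ layer f K t
        · rw [Set.indicator_of_mem hx, ← sub_mul, enorm_mul, mul_comm]
          gcongr
          rw [← ofReal_norm, Complex.norm_real]
          refine ENNReal.ofReal_le_ofReal ?_
          rw [layerTest, norm_mul]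
          calc _ ≤ B * (t⁻¹ * M) := by
                gcongr
                · exact hB _
                · exact hM t _ ht0
            _ = _ := by ring
        · rw [Set.indicator_of_notMem hx, layerTest_eq_zero ht0 hx]
          simp
    _ = ENNReal.ofReal (t⁻¹ * (B * M)) * ∫⁻ x in layer f K t, ‖w x - g x.1‖ₑ := by
        rw [lintegral_indicator (measurableSet_layer hfc.measurable hK.measurableSet t),
          lintegral_const_mul' _ _ ENNReal.ofReal_ne_top]
    _ ≤ ENNReal.ofReal (t⁻¹ * (B * M)) * ∫⁻ x in layer f K t,
          ((ε : ℝ≥0∞) + (ε⁻¹ : ℝ≥0) * ‖w x - g x.1‖ₑ ^ 2) := by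
        gcongr with x
        exact enorm_le_add_inv_mul_sq _ hε
    _ = ENNReal.ofReal (B * M) * ((ε : ℝ≥0∞) * volume K + (ε⁻¹ : ℝ≥0)
          * ((∫⁻ x in layer f K t, ‖w x - g x.1‖ₑ ^ 2) / ENNReal.ofReal t)) := by
        have hT0 : ENNReal.ofReal t ≠ 0 := by simpa using ht0
        have e := setLIntegral_layer hfc.measurable hK.measurableSet t
          (F := fun _ => (ε : ℝ≥0∞)) aemeasurable_const
        rw [lintegral_add_left measurable_const, e, lintegral_const_mul' _ _ ENNReal.coe_ne_top,
          setLIntegral_const, ENNReal.ofReal_mul (by positivity), ENNReal.ofReal_inv_of_pos ht0,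
          ENNReal.div_eq_inv_mul]
        set T := ENNReal.ofReal t
        have hT : T⁻¹ * T = 1 := ENNReal.inv_mul_cancel hT0 ENNReal.ofReal_ne_top
        calc _ = ENNReal.ofReal (B * M) * ((T⁻¹ * T) * (ε * volume K)
              + (ε⁻¹ : ℝ≥0) * (T⁻¹ * ∫⁻ x in layer f K t, ‖w x - g x.1‖ₑ ^ 2)) := by ring
          _ = _ := by rw [hT, one_mul]
    _ ≤ ENNReal.ofReal (B * M) * (1 + volume K) * ((ε : ℝ≥0∞) + (ε⁻¹ : ℝ≥0)
          * ((∫⁻ x in layer f K t, ‖w x - g x.1‖ₑ ^ 2) / ENNReal.ofReal t)) := by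
        rw [mul_assoc]
        refine mul_le_mul' le_rfl ?_
        rw [mul_add, mul_comm (ε : ℝ≥0∞)]
        exact add_le_add (mul_le_mul' le_add_self le_rfl) (le_mul_of_one_le_left' le_self_add)

/-! ### The Dirichlet condition on a graph -/

theorem HasWeakGrad.integral_eq_of_contDiff_one {Ω : Set Space} (hΩ : IsOpen Ω)
    {u : Space → Fin 3 → ℂ} {Du : Space → Fin 3 → Fin 3 → ℂ} (h : HasWeakGrad Ω u Du)
    {φ : Space → ℝ} (hφ : ContDiff ℝ 1 φ) (hc : HasCompactSupport φ) (hs : tsupport φ ⊆ Ω)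
    (k j : Fin 3) :
    ∫ x in Ω, u x j * ((fderiv ℝ φ x (dir k) : ℝ) : ℂ) = - ∫ x in Ω, Du x k j * ((φ x : ℝ) : ℂ) :=
  integral_mul_fderiv_of_contDiff_one hΩ (h.locInt j) (h.locInt_grad k j)
    (fun φ h1 h2 h3 => h.integral_eq φ h1 h2 h3 k j) hφ hc hs

theorem contDiff_layerTest {f η : Plane → ℝ} {n : ℕ∞} (hf : ContDiff ℝ n f) (hη : ContDiff ℝ n η)
    (t : ℝ) : ContDiff ℝ n (layerTest f η t) := by
  have h1 : ContDiff ℝ n (profile t) := (contDiff_profile t).of_le (by exact_mod_cast le_top)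
  exact (hη.comp contDiff_fst).mul (h1.comp (contDiff_snd.sub (hf.comp contDiff_fst)))

/-- The derivative of `layerTest` in the direction `(e, c)`. -/
theorem fderiv_layerTest {f η : Plane → ℝ} (hf : Differentiable ℝ f) (hη : Differentiable ℝ η)
    (t : ℝ) (x : Space) (e : Plane) (c : ℝ) :
    fderiv ℝ (layerTest f η t) x (e, c) = fderiv ℝ η x.1 e * profile t (x.2 - f x.1)
      + η x.1 * (deriv (profile t) (x.2 - f x.1) * (c - fderiv ℝ f x.1 e)) := by
  have hp : Differentiable ℝ (profile t) := (contDiff_profile t).differentiable (by simp)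
  have h1 : HasFDerivAt (fun x : Space => η x.1)
      ((fderiv ℝ η x.1).comp (ContinuousLinearMap.fst ℝ Plane ℝ)) x :=
    (hη x.1).hasFDerivAt.comp x hasFDerivAt_fst
  have h2 : HasFDerivAt (fun x : Space => x.2 - f x.1) (ContinuousLinearMap.snd ℝ Plane ℝ
      - (fderiv ℝ f x.1).comp (ContinuousLinearMap.fst ℝ Plane ℝ)) x :=
    hasFDerivAt_snd.sub ((hf x.1).hasFDerivAt.comp x hasFDerivAt_fst)
  have h3 := (hp (x.2 - f x.1)).hasDerivAt.comp_hasFDerivAt x h2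
  have h4 := h1.mul h3
  have h5 : fderiv ℝ (layerTest f η t) x = _ := h4.fderiv
  rw [h5]
  simp
  ring

theorem dir_castSucc (α : Fin 2) : dir α.castSucc = (EuclideanSpace.single α 1, 0) := by
  fin_cases α <;> rfl

theorem contDiff_partialDeriv {f : Plane → ℝ} {n : ℕ} (hf : ContDiff ℝ (n + 1) f) (α : Fin 2) :
    ContDiff ℝ n (partialDeriv f α) :=
  (hf.fderiv_right le_rfl).clm_apply contDiff_const

/-- The tangential derivatives `∂_α + ∂_α f ∂₃` along the graph do not see the profile of the test
functions, so only derivatives of the cut-off `φ` are left on the field. -/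
theorem HasWeakGrad.tangential_identity {f : Plane → ℝ} (hf : ContDiff ℝ 2 f) {fplus b : ℝ}
    (hle : ∀ x, f x ≤ fplus) {u : Space → Fin 3 → ℂ} {Du : Space → Fin 3 → Fin 3 → ℂ}
    (h : HasWeakGrad (strip f b) u Du) {φ : Plane → ℝ} (hφ : ContDiff ℝ 1 φ)
    (hc : HasCompactSupport φ) {t : ℝ} (ht : 0 < t) (htb : t < b - fplus) (α : Fin 2) (j : Fin 3) :
    ∫ x in strip f b, u x j * ((layerTest f (partialDeriv φ α) t x : ℝ) : ℂ)
      = - ((∫ x in strip f b, Du x α.castSucc j * ((layerTest f φ t x : ℝ) : ℂ))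
        + ∫ x in strip f b, Du x 2 j
          * ((layerTest f (fun x' => partialDeriv f α x' * φ x') t x : ℝ) : ℂ)) := by
  have hfc := hf.continuous
  have hf1 : ContDiff ℝ 1 f := hf.of_le (by norm_num)
  have hΩ := isOpen_strip hfc b
  have hpf : ContDiff ℝ 1 (partialDeriv f α) := by
    have := contDiff_partialDeriv (n := 1) (f := f) (by exact_mod_cast hf) α
    exact_mod_cast this
  set φ' : Plane → ℝ := fun x' => partialDeriv f α x' * φ x' with hφ'
  have hφ'1 : ContDiff ℝ 1 φ' := hpf.mul hφ
  have hφ'c : HasCompactSupport φ' := hc.mul_left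
  have d1 : ContDiff ℝ 1 (layerTest f φ t) := by
    exact_mod_cast contDiff_layerTest (n := 1) (by exact_mod_cast hf1) (by exact_mod_cast hφ) t
  have d2 : ContDiff ℝ 1 (layerTest f φ' t) := by
    exact_mod_cast contDiff_layerTest (n := 1) (by exact_mod_cast hf1) (by exact_mod_cast hφ'1) t
  have c1 := hasCompactSupport_layerTest hfc hc ht
  have c2 := hasCompactSupport_layerTest hfc hφ'c ht
  have s1 := tsupport_layerTest_subset_strip (η := φ) hfc hle ht htb
  have s2 := tsupport_layerTest_subset_strip (η := φ') hfc hle ht htb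
  rw [neg_add, ← h.integral_eq_of_contDiff_one hΩ d1 c1 s1, ← h.integral_eq_of_contDiff_one hΩ d2 c2 s2]
  have hint : ∀ {ψ : Space → ℝ}, ContDiff ℝ 1 ψ → HasCompactSupport ψ → tsupport ψ ⊆ strip f b →
      ∀ k, Integrable (fun x => u x j * ((fderiv ℝ ψ x (dir k) : ℝ) : ℂ))
        (volume.restrict (strip f b)) := by
    intro ψ hψ hψc hψs k
    obtain ⟨e1, e2, e3⟩ := ofReal_fderiv_apply_test hψ hψc (dir k)
    have hK : IsCompact (tsupport ψ) := hψc
    have hi : IntegrableOn (fun x => u x j * ((fderiv ℝ ψ x (dir k) : ℝ) : ℂ)) (tsupport ψ) :=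
      ((h.locInt j).integrableOn_compact_subset hψs hK).mul_continuousOn e1.continuousOn hK
    refine Integrable.restrict ?_
    rwa [← integrableOn_iff_integrable_of_support_subset]
    intro x hx
    exact e3 (subset_tsupport _ (right_ne_zero_of_mul hx))
  rw [← integral_add (hint d1 c1 s1 _) (hint d2 c2 s2 _)]
  refine integral_congr_ae (.of_forall fun x => ?_)
  have hdf : Differentiable ℝ f := hf1.differentiable one_ne_zero
  simp only
  rw [dir_castSucc, show dir 2 = (0, 1) from rfl,
    fderiv_layerTest hdf (hφ.differentiable one_ne_zero),
    fderiv_layerTest hdf (hφ'1.differentiable one_ne_zero)]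
  simp only [layerTest, partialDeriv, map_zero, hφ']
  push_cast
  ring

/-- If `u` vanishes on the graph, then so does its tangential gradient. -/
theorem MemH1.tangential_zero {f : Plane → ℝ} (hf : ContDiff ℝ 2 f) {fplus b : ℝ}
    (hle : ∀ x, f x ≤ fplus) (hb : fplus < b) {u : Space → Fin 3 → ℂ}
    {Du : Space → Fin 3 → Fin 3 → ℂ} (h : MemH1 (strip f b) u Du) {u₀ : Plane → Fin 3 → ℂ}
    {G : Plane → Fin 3 → Fin 3 → ℂ}
    (hu : ∀ j, HasGraphTrace f (fun x => u x j) (fun x' => u₀ x' j)) (h0 : ∀ᵐ x', u₀ x' = 0)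
    (hG : ∀ k j, HasGraphTrace f (fun x => Du x k j) (fun x' => G x' k j)) (α : Fin 2) (j : Fin 3) :
    ∀ᵐ x', G x' α.castSucc j + (partialDeriv f α x' : ℂ) * G x' 2 j = 0 := by
  have hfc := hf.continuous
  have hpf : Continuous (partialDeriv f α) := by
    have := contDiff_partialDeriv (n := 1) (f := f) (by exact_mod_cast hf) α
    exact this.continuous
  have hpfc : Continuous fun x' => (partialDeriv f α x' : ℂ) := Complex.continuous_ofReal.comp hpf
  have l1 := (hG α.castSucc j).locallyIntegrable hfc.measurable hle hb (h.memLp_grad _ j)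
  have l2 := (hG 2 j).locallyIntegrable hfc.measurable hle hb (h.memLp_grad _ j)
  have l3 : LocallyIntegrable (fun x' => (partialDeriv f α x' : ℂ) * G x' 2 j) volume := by
    have := (locallyIntegrableOn_univ.2 l2).continuousOn_mul hpfc.continuousOn isOpen_univ.isLocallyClosed
    exact locallyIntegrableOn_univ.1 this
  refine ae_eq_zero_of_integral_contDiff_smul_eq_zero (l1.add l3) fun φ hφ hc => ?_
  have hφ1 : ContDiff ℝ 1 φ := hφ.of_le (by simp)
  have hφ'c : HasCompactSupport (partialDeriv φ α) := hc.fderiv_apply (𝕜 := ℝ) _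
  have hφ'cont : Continuous (partialDeriv φ α) :=
    (hφ1.continuous_fderiv one_ne_zero).clm_apply continuous_const
  have t1 := (hu j).tendsto_integral_layerTest hfc hle hb (h.memLp j) hφ'cont hφ'c
  have t2 := (hG α.castSucc j).tendsto_integral_layerTest hfc hle hb (h.memLp_grad _ j)
    hφ.continuous hc
  have t3 := (hG 2 j).tendsto_integral_layerTest hfc hle hb (h.memLp_grad _ j)
    (η := fun x' => partialDeriv f α x' * φ x') (hpf.mul hφ.continuous) hc.mul_left
  have hsmall : ∀ᶠ t : ℝ in 𝓝[>] 0, t ∈ Set.Ioo 0 (b - fplus) := Ioo_mem_nhdsGT (sub_pos.2 hb)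
  have t4 := t1.congr' (hsmall.mono fun t ht =>
    h.hasWeakGrad.tangential_identity hf hle hφ1 hc ht.1 ht.2 α j)
  have e := tendsto_nhds_unique t4 (t2.add t3).neg
  have e0 : ∫ x', u₀ x' j * ((partialDeriv φ α x' : ℝ) : ℂ) = 0 := by
    refine integral_eq_zero_of_ae ?_
    filter_upwards [h0] with x' hx
    simp [hx]
  rw [e0, zero_eq_neg] at e
  have i1 := l1.integrable_smul_left_of_hasCompactSupport hφ.continuous hc
  have i3 := l3.integrable_smul_left_of_hasCompactSupport hφ.continuous hc
  calc ∫ x', φ x' • (G x' α.castSucc j + (partialDeriv f α x' : ℂ) * G x' 2 j)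
      = ∫ x', (φ x' • G x' α.castSucc j + φ x' • ((partialDeriv f α x' : ℂ) * G x' 2 j)) := by
        simp only [smul_add]
    _ = (∫ x', G x' α.castSucc j * ((φ x' : ℝ) : ℂ))
        + ∫ x', G x' 2 j * ((partialDeriv f α x' * φ x' : ℝ) : ℂ) := by
        rw [integral_add i1 i3]
        congr 1 <;>
        · refine integral_congr_ae (.of_forall fun x' => ?_)
          simp only [Complex.real_smul]
          push_cast
          ring
    _ = 0 := e

theorem surfaceDensity_pos (f : Plane → ℝ) (x' : Plane) : 0 < surfaceDensity f x' :=
  Real.sqrt_pos.2 (by positivity)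

theorem graphNormal_sq (f : Plane → ℝ) (x' : Plane) :
    graphNormal f x' 0 ^ 2 + graphNormal f x' 1 ^ 2 + graphNormal f x' 2 ^ 2 = 1 := by
  have h := surfaceDensity_pos f x'
  have h2 : surfaceDensity f x' ^ 2 = 1 + partialDeriv f 0 x' ^ 2 + partialDeriv f 1 x' ^ 2 :=
    Real.sq_sqrt (by positivity)
  simp only [graphNormal, Matrix.cons_val]
  field_simp
  linarith

theorem rellich_of_dirichlet {f : Plane → ℝ} {x' : Plane} {P : Fin 3 → Fin 3 → ℂ}
    (lam mu om : ℝ) (h : ∀ (α : Fin 2) j, P α.castSucc j + (partialDeriv f α x' : ℂ) * P 2 j = 0) :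
    rellichIntegrand lam mu om (graphNormal f x') 0 P
      = mu * normSq3 (normalDeriv (graphNormal f x') P) * graphNormal f x' 2
        + (lam + mu) * ‖divergence P‖ ^ 2 * graphNormal f x' 2 := by
  have hs : (surfaceDensity f x' : ℂ) ≠ 0 := by exact_mod_cast (surfaceDensity_pos f x').ne'
  refine rellichIntegrand_of_tangential_zero lam mu om (graphNormal_sq f x')
    (g := fun j => surfaceDensity f x' * P 2 j) fun k j => ?_
  fin_cases k
  · have := h 0 j
    simp [graphNormal] at this ⊢
    field_simp
    linear_combination this
  · have := h 1 j
    simp [graphNormal] at this ⊢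
    field_simp
    linear_combination this
  · simp [graphNormal]
    field_simp

theorem abs_graphNormal_le_one (f : Plane → ℝ) (x' : Plane) (k : Fin 3) :
    |graphNormal f x' k| ≤ 1 := by
  rw [← sq_le_one_iff_abs_le_one]
  have := graphNormal_sq f x'
  fin_cases k <;> simp only [Fin.zero_eta, Fin.mk_one, Fin.reduceFinMk] <;>
    nlinarith [sq_nonneg (graphNormal f x' 0), sq_nonneg (graphNormal f x' 1),
      sq_nonneg (graphNormal f x' 2)]

theorem continuous_graphNormal {f : Plane → ℝ} (hf : ContDiff ℝ 1 f) (k : Fin 3) :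
    Continuous fun x' => graphNormal f x' k := by
  have hp : ∀ α, Continuous (partialDeriv f α) := fun α =>
    (hf.continuous_fderiv one_ne_zero).clm_apply continuous_const
  have h0 := hp 0
  have h1 := hp 1
  have hs : Continuous (surfaceDensity f) := by unfold surfaceDensity; fun_prop
  have hne := fun x' => (surfaceDensity_pos f x').ne'
  fin_cases k
  · exact h0.neg.div hs hne
  · exact h1.neg.div hs hne
  · exact continuous_const.div hs hne

/-- The boundary integrand of the Dirichlet problem is integrable if the boundary value of the
gradient is square-integrable. -/
theorem integrable_dirichlet {f : Plane → ℝ} (hf : ContDiff ℝ 1 f) (lam mu : ℝ)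
    {G : Plane → Fin 3 → Fin 3 → ℂ} (hG : ∀ k j, MemLp (fun x' => G x' k j) 2 volume) :
    Integrable fun x' => (mu * normSq3 (normalDeriv (graphNormal f x') (G x')) * graphNormal f x' 2
      + (lam + mu) * ‖divergence (G x')‖ ^ 2 * graphNormal f x' 2) * surfaceDensity f x' := by
  have hν : ∀ x', graphNormal f x' 2 * surfaceDensity f x' = 1 := fun x' => by
    simp [graphNormal, (surfaceDensity_pos f x').ne']
  have hn : ∀ j, MemLp (fun x' => normalDeriv (graphNormal f x') (G x') j) 2 volume := fun j => by
    refine memLp_finsetSum _ fun k _ => ?_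
    refine (hG k j).mono ((Complex.continuous_ofReal.comp
      (continuous_graphNormal hf k)).aestronglyMeasurable.mul (hG k j).1) (.of_forall fun x' => ?_)
    rw [norm_mul, Complex.norm_real, Real.norm_eq_abs]
    exact mul_le_of_le_one_left (norm_nonneg _) (abs_graphNormal_le_one f x' k)
  have hd : MemLp (fun x' => divergence (G x')) 2 volume := memLp_finsetSum _ fun k _ => hG k k
  have i1 : Integrable fun x' => normSq3 (normalDeriv (graphNormal f x') (G x')) :=
    integrable_finsetSum _ fun j _ => (hn j).integrable_norm_pow (by norm_num)
  have i2 : Integrable fun x' => ‖divergence (G x')‖ ^ 2 := hd.integrable_norm_pow (by norm_num)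
  refine ((i1.const_mul mu).add (i2.const_mul (lam + mu))).congr (.of_forall fun x' => ?_)
  simp only [Pi.add_apply]
  linear_combination -(mu * normSq3 (normalDeriv (graphNormal f x') (G x'))
    + (lam + mu) * ‖divergence (G x')‖ ^ 2) * hν x'

end Elastic

end

theorem mainTheorem2 (lam mu om : ℝ) (hmu : 0 < mu) (hlam : 0 < lam + 2 * mu / 3) (hom : 0 < om) :
    -- (i) the Dirichlet surface
    (∀ (f : Elastic.Plane → ℝ) (L : ℝ≥0) (fplus b : ℝ),
      ContDiff ℝ 2 f → LipschitzWith L f → (∀ x', f x' ≤ fplus) → fplus < b →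
      ∀ (u : Elastic.Space → Fin 3 → ℂ) (Du : Elastic.Space → Fin 3 → Fin 3 → ℂ)
        (u₀ : Elastic.Plane → Fin 3 → ℂ) (G : Elastic.Plane → Fin 3 → Fin 3 → ℂ),
      Elastic.MemH1 (Elastic.strip f b) u Du →
      (∀ j, Elastic.HasGraphTrace f (fun x => u x j) (fun x' => u₀ x' j)) →
      (∀ᵐ x', u₀ x' = 0) →
      (∀ k j, Elastic.HasGraphTrace f (fun x => Du x k j) (fun x' => G x' k j)) →
      (∀ᵐ x', Elastic.rellichIntegrand lam mu om (Elastic.graphNormal f x') (u₀ x') (G x')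
          = mu * Elastic.normSq3 (Elastic.normalDeriv (Elastic.graphNormal f x') (G x'))
              * Elastic.graphNormal f x' 2
            + (lam + mu) * ‖Elastic.divergence (G x')‖ ^ 2 * Elastic.graphNormal f x' 2) ∧
      ((∀ k j, MemLp (fun x' => G x' k j) 2 volume) →
        Integrable (fun x' =>
          Elastic.rellichIntegrand lam mu om (Elastic.graphNormal f x') (u₀ x') (G x')
            * Elastic.surfaceDensity f x')) ∧
      ∫ x', Elastic.rellichIntegrand lam mu om (Elastic.graphNormal f x') (u₀ x') (G x')
          * Elastic.surfaceDensity f x'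
        = ∫ x', (mu * Elastic.normSq3 (Elastic.normalDeriv (Elastic.graphNormal f x') (G x'))
              * Elastic.graphNormal f x' 2
            + (lam + mu) * ‖Elastic.divergence (G x')‖ ^ 2 * Elastic.graphNormal f x' 2)
          * Elastic.surfaceDensity f x') ∧
    -- (ii) the horizontal plane
    (∀ (b : ℝ) (u : Elastic.Space → Fin 3 → ℂ)
        (v : Fin 3 → Lp (α := Elastic.Plane) ℂ 2 volume)
        (Ap : Elastic.Plane → ℂ) (As : Elastic.Plane → Fin 3 → ℂ),
      Elastic.UpwardASR lam mu om b u v Ap As → Elastic.TraceInH1 v →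
      ∃ (Du : Elastic.Space → Fin 3 → Fin 3 → ℂ) (G : Elastic.Plane → Fin 3 → Fin 3 → ℂ),
        Elastic.HasWeakGrad (Elastic.upperHalf b) u Du ∧
        (∀ k j, Elastic.HasGraphTrace (fun _ => b) (fun x => Du x k j) (fun x' => G x' k j)) ∧
        (∀ k j, MemLp (fun x' => G x' k j) 2 volume) ∧
        IntegrableOn (fun ξ => (Elastic.beta lam mu om ξ).re ^ 2 * ‖Ap ξ‖ ^ 2)
          {ξ | ‖ξ‖ < Elastic.kappaP lam mu om} ∧
        IntegrableOn (fun ξ => (Elastic.gamma mu om ξ).re ^ 2 * Elastic.normSq3 (As ξ))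
          {ξ | ‖ξ‖ < Elastic.kappaS mu om} ∧
        IntegrableOn (fun ξ => (Elastic.beta lam mu om ξ).re * ‖Ap ξ‖ ^ 2)
          {ξ | ‖ξ‖ < Elastic.kappaP lam mu om} ∧
        IntegrableOn (fun ξ => (Elastic.gamma mu om ξ).re * Elastic.normSq3 (As ξ))
          {ξ | ‖ξ‖ < Elastic.kappaS mu om} ∧
        Integrable (fun x' => Elastic.rellichIntegrand lam mu om ![0, 0, 1]
          (fun j => v j x') (G x')) ∧
        Integrable (fun x' => Elastic.traction lam mu ![0, 0, 1] (G x')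
          ⬝ᵥ star (fun j => v j x')) ∧
        ∫ x', Elastic.rellichIntegrand lam mu om ![0, 0, 1] (fun j => v j x') (G x')
          = 2 * (om ^ 2 * (∫ ξ in {ξ | ‖ξ‖ < Elastic.kappaP lam mu om},
                (Elastic.beta lam mu om ξ).re ^ 2 * ‖Ap ξ‖ ^ 2)
              + mu * ∫ ξ in {ξ | ‖ξ‖ < Elastic.kappaS mu om},
                (Elastic.gamma mu om ξ).re ^ 2 * Elastic.normSq3 (As ξ)) ∧
        (∫ x', Elastic.traction lam mu ![0, 0, 1] (G x') ⬝ᵥ star (fun j => v j x')).im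
          = om ^ 2 * (∫ ξ in {ξ | ‖ξ‖ < Elastic.kappaP lam mu om},
                (Elastic.beta lam mu om ξ).re * ‖Ap ξ‖ ^ 2)
              + mu * ∫ ξ in {ξ | ‖ξ‖ < Elastic.kappaS mu om},
                (Elastic.gamma mu om ξ).re * Elastic.normSq3 (As ξ)) ∧
    -- (iii) the regularity in (ii) is automatic above any plane on which the representation holds
    (∀ (c b : ℝ), c < b → ∀ (u : Elastic.Space → Fin 3 → ℂ)
        (v : Fin 3 → Lp (α := Elastic.Plane) ℂ 2 volume)
        (Ap : Elastic.Plane → ℂ) (As : Elastic.Plane → Fin 3 → ℂ),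
      Elastic.UpwardASR lam mu om c u v Ap As →
      ∃ v' : Fin 3 → Lp (α := Elastic.Plane) ℂ 2 volume,
        Elastic.TraceInH1 v' ∧
        Elastic.UpwardASR lam mu om b u v'
          (fun ξ => Ap ξ
            * Complex.exp (Complex.I * Elastic.beta lam mu om ξ * ((b - c : ℝ) : ℂ)))
          (fun ξ j => As ξ j
            * Complex.exp (Complex.I * Elastic.gamma mu om ξ * ((b - c : ℝ) : ℂ)))) := by
  refine ⟨fun f L fplus b hf _ hle hb u Du u₀ G hu hu₀ h0 hG => ?_,
    fun b u v Ap As h hv => h.rellich hmu hlam hom hv, fun c b hcb u v Ap As h =>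
      h.shift (Elastic.kappaP_pos hmu hlam hom) (Elastic.kappaP_le_kappaS hmu hlam hom) hcb⟩
  have htan : ∀ᵐ x', ∀ (α : Fin 2) j,
      G x' α.castSucc j + (Elastic.partialDeriv f α x' : ℂ) * G x' 2 j = 0 := by
    simp only [ae_all_iff]
    exact fun α j => hu.tangential_zero hf hle hb hu₀ h0 hG α j
  have key : ∀ᵐ x', Elastic.rellichIntegrand lam mu om (Elastic.graphNormal f x') (u₀ x') (G x')
      = mu * Elastic.normSq3 (Elastic.normalDeriv (Elastic.graphNormal f x') (G x'))
          * Elastic.graphNormal f x' 2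
        + (lam + mu) * ‖Elastic.divergence (G x')‖ ^ 2 * Elastic.graphNormal f x' 2 := by
    filter_upwards [h0, htan] with x' hx hx'
    rw [hx]
    exact Elastic.rellich_of_dirichlet lam mu om hx'
  refine ⟨key, fun hG2 => ?_, integral_congr_ae (key.mono fun x' hx => by simp only [hx])⟩
  exact (Elastic.integrable_dirichlet (hf.of_le (by norm_num)) lam mu hG2).congr
    (key.mono fun x' hx => by simp only [hx])
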